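/- Let $n\ge 1$, let $\mathcal S\subset\mathbb R^{n+1}$ be a smooth embedded hypersurface and $p\in\mathcal S$. Let $N$ be a smooth unit normal field of $\mathcal S$ near $p$, and let $d_1,\dots,d_n$ be an orthonormal basis of $T_p\mathcal S$ of principal directions: $-D_{d_\mu}N(p)=\kappa_\mu d_\mu$. Put $H=\sum_\mu\kappa_\mu$ and $\mathcal R=2\sum_{\mu<\nu}\kappa_\mu\kappa_\nu$ (mean and scalar curvature at $p$). For $\varepsilon>0$ let $D_\varepsilon=\mathcal S\cap\{x:\|x-p\|\le\varepsilon\}$, with $n$-dimensional area measure $dA$; let $V=\int_{D_\varepsilon}dA$ be its area, $b=\frac1V\int_{D_\varepsilon}x\,dA$ its barycenter, $s=b-p$ the barycenter relative to $p$, and $C=\int_{D_\varepsilon}(x-b)(x-b)^T\,dA$ its covariance matrix. Let $\lambda_1\ge\dots\ge\lambda_{n+1}$ be the eigenvalues of $C$ and $e_1,\dots,e_{n+1}$ any corresponding orthonormal basis of eigenvectors. Let $V_n(\varepsilon)$ be the volume of the ball of radius $\varepsilon$ in $\mathbb R^n$. Define $$\mathcal R(D_\varepsilon)=2(n+2)^2(n+4)\frac{\lambda_{n+1}}{n\varepsilon^4V_n(\varepsilon)}-\frac{8(n+1)(n+2)}{n\varepsilon^2}\Big(\frac{V}{V_n(\varepsilon)}-1\Big),$$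 $$Q(D_\varepsilon)=4(n+2)^2(n+4)\frac{\lambda_{n+1}}{n\varepsilon^4V_n(\varepsilon)}+\frac{8(n+2)^2}{n\varepsilon^2}\Big(1-\frac{V}{V_n(\varepsilon)}\Big),\qquad H(D_\varepsilon)=\operatorname{sgn}\langle e_{n+1},s\rangle\sqrt{Q(D_\varepsilon)}$$ (the root of a negative number being read as $0$, and $\operatorname{sgn}0=0$), and, when $H(D_\varepsilon)\ne0$, $$\kappa_\mu(D_\varepsilon)=\frac{2(n+2)}{\varepsilon^2H(D_\varepsilon)}\Big[\frac{V}{V_n(\varepsilon)}+\frac{n+4}{\varepsilon^2}\Big(\frac{\varepsilon^2}{n+2}-\frac{\lambda_\mu}{V_n(\varepsilon)}\Big)-1\Big],\qquad \mu=1,\dots,n.$$ Then there are constants $K$ and $\varepsilon_0>0$ (depending on $\mathcal S$ and $p$, but not on $\varepsilon$ or on the choice of eigenvectors) such that, for $0<\varepsilon<\varepsilon_0$: (1) $0<V<\infty$, $|\mathcal R-\mathcal R(D_\varepsilon)|\le K\varepsilon$, $|H^2-Q(D_\varepsilon)|\le K\varepsilon$ and $|H^2-H(D_\varepsilon)^2|\le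 K\varepsilon$. (2) If $H\neq0$, and the principal curvatures are numbered so that $H\kappa_1\le\dots\le H\kappa_n$, then $\operatorname{sgn}\langle e_{n+1},s\rangle=\operatorname{sgn}(H\langle e_{n+1},N(p)\rangle)\ne0$ (that is, $H(D_\varepsilon)$ has the sign of the mean curvature with respect to the unit normal at $p$ that is oriented by $e_{n+1}$), $H(D_\varepsilon)\ne0$, and $|\kappa_\mu^2-\kappa_\mu(D_\varepsilon)^2|\le K\varepsilon$ for $\mu=1,\dots,n$. Moreover, as $\varepsilon\to0^+$, the eigenvector $e_{n+1}$ converges, up to sign, to $N(p)$; and, if $H\ne0$ and the curvatures are numbered as in (2), then for every $\mu$ with $\kappa_\mu\neq\kappa_\nu$ for all $\nu\ne\mu$ (hence for all $\mu$ if the principal curvatures are distinct) the eigenvector $e_\mu$ converges, up to sign, to the principal direction $d_\mu$. -/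

import Mathlib

open MeasureTheory
open scoped ContDiff MeasureTheory

namespace PatchInvariants

noncomputable section

/-- A smooth embedded hypersurface of `ℝⁿ⁺¹`: locally a regular level set of a smooth function. -/
def IsSmoothHypersurface {n : ℕ} (S : Set (EuclideanSpace ℝ (Fin (n + 1)))) : Prop :=
  ∀ q ∈ S, ∃ (W : Set (EuclideanSpace ℝ (Fin (n + 1)))) (f : EuclideanSpace ℝ (Fin (n + 1)) → ℝ),
    IsOpen W ∧ q ∈ W ∧ ContDiffOn ℝ ∞ f W ∧ (∀ x ∈ W, fderiv ℝ f x ≠ 0) ∧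
      S ∩ W = {x | x ∈ W ∧ f x = 0}

/-- The tangent vectors of `S` at `q`: velocities at `q` of curves lying in `S`. -/
def tangentVectors {n : ℕ} (S : Set (EuclideanSpace ℝ (Fin (n + 1))))
    (q : EuclideanSpace ℝ (Fin (n + 1))) : Set (EuclideanSpace ℝ (Fin (n + 1))) :=
  {v | ∃ γ : ℝ → EuclideanSpace ℝ (Fin (n + 1)),
    (∀ t, γ t ∈ S) ∧ γ 0 = q ∧ HasDerivAt γ v 0}

/-- `N` restricts to a smooth unit normal vector field of `S` on `S ∩ U`
(given through a smooth extension to the open set `U` of the ambient space). -/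
structure IsUnitNormalField {n : ℕ} (S U : Set (EuclideanSpace ℝ (Fin (n + 1))))
    (N : EuclideanSpace ℝ (Fin (n + 1)) → EuclideanSpace ℝ (Fin (n + 1))) : Prop where
  isOpen : IsOpen U
  smooth : ContDiffOn ℝ ∞ N U
  norm_eq_one : ∀ q ∈ S ∩ U, ‖N q‖ = 1
  normal : ∀ q ∈ S ∩ U, ∀ v ∈ tangentVectors S q, inner ℝ (N q) v = 0

/-- `d 0, …, d (n-1)` is an orthonormal basis of the tangent space of `S` at `p` consisting of
eigenvectors (principal directions) of the shape operator `v ↦ -D_v N`, with eigenvalues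
(principal curvatures) `κ 0, …, κ (n-1)`. -/
structure IsPrincipalFrame {n : ℕ} (S : Set (EuclideanSpace ℝ (Fin (n + 1))))
    (N : EuclideanSpace ℝ (Fin (n + 1)) → EuclideanSpace ℝ (Fin (n + 1)))
    (p : EuclideanSpace ℝ (Fin (n + 1))) (κ : Fin n → ℝ)
    (d : Fin n → EuclideanSpace ℝ (Fin (n + 1))) : Prop where
  orthonormal : Orthonormal ℝ d
  tangent : ∀ μ, d μ ∈ tangentVectors S p
  shape_eq : ∀ μ, -(fderiv ℝ N p (d μ)) = κ μ • d μ

/-- Mean curvature `H = K₁`, the trace of the shape operator. -/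
def meanCurvature {n : ℕ} (κ : Fin n → ℝ) : ℝ := ∑ μ, κ μ

/-- Scalar curvature `R = 2 K₂` of a hypersurface. -/
def scalarCurvature {n : ℕ} (κ : Fin n → ℝ) : ℝ :=
  2 * ∑ μ, ∑ ν ∈ Finset.Ioi μ, κ μ * κ ν

/-- The hypersurface patch cut out by the closed ball of radius `ε` about `p`. -/
def patch {n : ℕ} (S : Set (EuclideanSpace ℝ (Fin (n + 1))))
    (p : EuclideanSpace ℝ (Fin (n + 1))) (ε : ℝ) : Set (EuclideanSpace ℝ (Fin (n + 1))) :=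
  S ∩ Metric.closedBall p ε

/-- The `n`-dimensional area measure on the patch: `n`-dimensional Hausdorff measure,
normalized to agree with Lebesgue measure on `ℝⁿ`. -/
def patchMeasure {n : ℕ} (S : Set (EuclideanSpace ℝ (Fin (n + 1))))
    (p : EuclideanSpace ℝ (Fin (n + 1))) (ε : ℝ) : Measure (EuclideanSpace ℝ (Fin (n + 1))) :=
  (μHE[n] : Measure (EuclideanSpace ℝ (Fin (n + 1)))).restrict (patch S p ε)

/-- Total mass. -/
def mass {m : ℕ} (ρ : Measure (EuclideanSpace ℝ (Fin m))) : ℝ := ρ.real Set.univ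

/-- Barycenter. -/
def barycenter {m : ℕ} (ρ : Measure (EuclideanSpace ℝ (Fin m))) : EuclideanSpace ℝ (Fin m) :=
  (mass ρ)⁻¹ • ∫ x, x ∂ρ

/-- Covariance matrix (not divided by the mass). -/
def covarianceMatrix {m : ℕ} (ρ : Measure (EuclideanSpace ℝ (Fin m))) :
    Matrix (Fin m) (Fin m) ℝ :=
  Matrix.of fun i j => ∫ x, (x i - barycenter ρ i) * (x j - barycenter ρ j) ∂ρ

/-- An eigenvalue decomposition, the eigenvalues in decreasing order. -/
structure IsEVD {m : ℕ} (C : Matrix (Fin m) (Fin m) ℝ) (lam : Fin m → ℝ)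
    (e : OrthonormalBasis (Fin m) ℝ (EuclideanSpace ℝ (Fin m))) : Prop where
  antitone : Antitone lam
  eigen : ∀ i, Matrix.toEuclideanLin C (e i) = lam i • e i

/-- Volume `Vₙ(ε)` of the `n`-dimensional ball of radius `ε`. -/
def ballVolume (n : ℕ) (ε : ℝ) : ℝ :=
  volume.real (Metric.closedBall (0 : EuclideanSpace ℝ (Fin n)) ε)

/-- Descriptor of the scalar curvature, from the patch area `V` and the last eigenvalue `l`. -/
def scalarDescriptor (n : ℕ) (ε V l : ℝ) : ℝ :=
  2 * ((n : ℝ) + 2) ^ 2 * ((n : ℝ) + 4) * (l / ((n : ℝ) * ε ^ 4 * ballVolume n ε)) -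
    8 * ((n : ℝ) + 1) * ((n : ℝ) + 2) / ((n : ℝ) * ε ^ 2) * (V / ballVolume n ε - 1)

/-- The quantity under the square root in the descriptor of the mean curvature. -/
def meanRadicand (n : ℕ) (ε V l : ℝ) : ℝ :=
  4 * ((n : ℝ) + 2) ^ 2 * ((n : ℝ) + 4) * (l / ((n : ℝ) * ε ^ 4 * ballVolume n ε)) +
    8 * ((n : ℝ) + 2) ^ 2 / ((n : ℝ) * ε ^ 2) * (1 - V / ballVolume n ε)

/-- Descriptor of the mean curvature; `σ` is the overall sign. -/
def meanDescriptor (n : ℕ) (ε V l σ : ℝ) : ℝ := σ * Real.sqrt (meanRadicand n ε V l)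

/-- Descriptor of a principal curvature, from the area `V`, the tangential eigenvalue `l` and the
value `h` of the mean curvature descriptor. -/
def principalDescriptor (n : ℕ) (ε V l h : ℝ) : ℝ :=
  2 * ((n : ℝ) + 2) / (ε ^ 2 * h) *
    (V / ballVolume n ε +
      ((n : ℝ) + 4) / ε ^ 2 * (ε ^ 2 / ((n : ℝ) + 2) - l / ballVolume n ε) - 1)

/-- The sign of `⟨eₙ₊₁, s⟩`, where `s` is the barycenter of the patch in coordinates centered
at `p` and `eₙ₊₁` is the eigenvector of the smallest eigenvalue. -/
def orientationSign {n : ℕ} (S : Set (EuclideanSpace ℝ (Fin (n + 1))))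
    (p : EuclideanSpace ℝ (Fin (n + 1))) (ε : ℝ)
    (e : OrthonormalBasis (Fin (n + 1)) ℝ (EuclideanSpace ℝ (Fin (n + 1)))) : ℝ :=
  Real.sign (inner ℝ (e (Fin.last n)) (barycenter (patchMeasure S p ε) - p))

/-- The scalar curvature descriptor of the patch. -/
def patchScalar {n : ℕ} (S : Set (EuclideanSpace ℝ (Fin (n + 1))))
    (p : EuclideanSpace ℝ (Fin (n + 1))) (ε : ℝ) (lam : Fin (n + 1) → ℝ) : ℝ :=
  scalarDescriptor n ε (mass (patchMeasure S p ε)) (lam (Fin.last n))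

/-- The mean curvature descriptor of the patch. -/
def patchMean {n : ℕ} (S : Set (EuclideanSpace ℝ (Fin (n + 1))))
    (p : EuclideanSpace ℝ (Fin (n + 1))) (ε : ℝ) (lam : Fin (n + 1) → ℝ)
    (e : OrthonormalBasis (Fin (n + 1)) ℝ (EuclideanSpace ℝ (Fin (n + 1)))) : ℝ :=
  meanDescriptor n ε (mass (patchMeasure S p ε)) (lam (Fin.last n)) (orientationSign S p ε e)

/-- The principal curvature descriptors of the patch. -/
def patchPrincipal {n : ℕ} (S : Set (EuclideanSpace ℝ (Fin (n + 1))))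
    (p : EuclideanSpace ℝ (Fin (n + 1))) (ε : ℝ) (lam : Fin (n + 1) → ℝ)
    (e : OrthonormalBasis (Fin (n + 1)) ℝ (EuclideanSpace ℝ (Fin (n + 1)))) (μ : Fin n) : ℝ :=
  principalDescriptor n ε (mass (patchMeasure S p ε)) (lam μ.castSucc) (patchMean S p ε lam e)

end

end PatchInvariants

/-!
In an orthonormal frame `w` at `p`, formed by the principal directions and the unit normal, the
hypersurface is the graph of a function `g` over its tangent space with `g = ½ ∑ κ_i x_i² + O(|x|³)`
and area density `√(1 + |∇g|²) = 1 + ½ ∑ κ_i² x_i² + O(|x|³)`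
(`IsSmoothHypersurface.exists_graph`, `fderiv_fderiv_eq_of_principal`, `exists_isGraphExpansion`).
The area measure of the patch is the image of the corresponding weighted Lebesgue measure, by the
area formula `comap_euclideanHausdorffMeasure_eq_withDensity`.

In polar coordinates, the ray in the direction `θ` meets the patch in radii up to
`ε - ½ (½ ∑ κ_i θ_i²)² ε³ + O(ε⁴)`. So the integral over the patch of a homogeneous function of the
tangential coordinates is given, to second order, by integrals over the sphere
(`IsGraphExpansion.exists_abs_setIntegral_sub_le`), and those that occur are evaluated recursively
by the divergence theorem on the sphere (`IsHomogeneous.sphereIntegral_inner_mul`). The area divided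
by `V_n(ε)` is `1 + v ε² + O(ε³)`, the barycenter relative to `p` is `h ε² N + O(ε³)`, and the
covariance matrix in the frame `w`, divided by `V_n(ε)`, has the tangential block
`diag (ε² / (n + 2) + t_i ε⁴) + O(ε⁵)`, the normal entry `τ ε⁴ + O(ε⁵)` and mixed entries `O(ε⁴)`,
where `v`, `h`, `t_i` and `τ` are explicit polynomials in the curvatures (`massCoeff`,
`heightCoeff`, `tangentCoeff` and `heightSqCoeff κ - heightCoeff κ ^ 2`).

Tangential and normal blocks have different orders of magnitude, so the last eigenvector tends to
the normal, with tangential components `O(ε²)`, and the eigenvalues are those of the diagonal part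
up to `O(ε⁵)` (`IsPerturbedEVD.last_isBigO`, `IsPerturbedEVD.tangent_isBigO`). The `n` largest
eigenvalues are matched with the `t_i` by their order, without any separation between them: among
the first `k` rows of an orthogonal matrix some entry outside the first `k - 1` columns is bounded
below (`exists_one_div_le_abs_entry`), which is a quantitative replacement for the minimax
principle. Since `t_i` is a constant minus a positive multiple of `H κ_i`, the numbering with
`H κ_i` increasing is the one for which the `t_i` decrease. The descriptors are the combinations of `V`
and the eigenvalues whose limits are `ℛ`, `H²` and, after division by the sign-carrying root, `± κ_μ`.

Estimates uniform in the choice of the eigenvectors are expressed as asymptotic relations along the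
filter `smallRadius` on the type `PatchEVD` of all eigenvalue decompositions.
-/

namespace PatchInvariants

/-! ### The area formula for embeddings of class `C¹` -/

section AreaFormula

open Filter Topology Set

/-- If `F` expands distances on `s` at most `k` times as much as `G` does, then the Hausdorff
measures of the two images compare accordingly. -/
lemma euclideanHausdorffMeasure_image_le_of_dist_le {U V W : Type*} [Nonempty U]
    [MetricSpace V] [MeasurableSpace V] [BorelSpace V]
    [MetricSpace W] [MeasurableSpace W] [BorelSpace W]
    {F : U → V} {G : U → W} {s : Set U} {k : NNReal} (d : ℕ)
    (h : ∀ x ∈ s, ∀ y ∈ s, dist (F x) (F y) ≤ k * dist (G x) (G y)) :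
    μHE[d] (F '' s) ≤ (k : ENNReal) ^ d * μHE[d] (G '' s) := by
  classical
  set i : W → U := Function.invFunOn G s
  have hi : ∀ x ∈ s, i (G x) ∈ s ∧ G (i (G x)) = G x := fun x hx =>
    ⟨Function.invFunOn_mem ⟨x, hx, rfl⟩, Function.invFunOn_eq ⟨x, hx, rfl⟩⟩
  have hL : LipschitzOnWith k (F ∘ i) (G '' s) := by
    refine LipschitzOnWith.of_dist_le_mul ?_
    rintro _ ⟨x, hx, rfl⟩ _ ⟨y, hy, rfl⟩
    have := h _ (hi x hx).1 _ (hi y hy).1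
    rwa [(hi x hx).2, (hi y hy).2] at this
  have himg : (F ∘ i) '' (G '' s) = F '' s := by
    rw [image_image]
    refine image_congr fun x hx => ?_
    have := h _ (hi x hx).1 _ hx
    rw [(hi x hx).2, dist_self, mul_zero] at this
    exact dist_le_zero.1 this
  have := hL.hausdorffMeasure_image_le (d := (d : ℝ)) (Nat.cast_nonneg d)
  rw [himg, ENNReal.rpow_natCast] at this
  simp only [Measure.euclideanHausdorffMeasure_def, Measure.smul_apply, ENNReal.smul_def,
    smul_eq_mul]
  rw [mul_left_comm]
  gcongr

variable {U V : Type*} [NormedAddCommGroup U] [InnerProductSpace ℝ U] [FiniteDimensional ℝ U]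
  [MeasurableSpace U] [BorelSpace U]
  [NormedAddCommGroup V] [InnerProductSpace ℝ V]
  [MeasurableSpace V] [BorelSpace V]

/-- Near a point where its strict derivative is injective, a map distorts Hausdorff measure
by the Jacobian of the derivative, up to a factor arbitrarily close to one. -/
lemma exists_nhds_euclideanHausdorffMeasure_image_le {F : U → V} {L : U →L[ℝ] V} {x : U}
    (hF : HasStrictFDerivAt F L x) (hL : Function.Injective L) {k : NNReal} (hk : 1 < k) :
    ∃ t ∈ 𝓝 x, ∀ s ⊆ t,
      μHE[Module.finrank ℝ U] (F '' s) ≤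
        (k : ENNReal) ^ (Module.finrank ℝ U) *
          (ENNReal.ofReal (L : U →ₗ[ℝ] V).normDet * volume s) ∧
      ENNReal.ofReal (L : U →ₗ[ℝ] V).normDet * volume s ≤
        (k : ENNReal) ^ (Module.finrank ℝ U) * μHE[Module.finrank ℝ U] (F '' s) := by
  obtain ⟨K, hK, hanti⟩ := (L : U →ₗ[ℝ] V).exists_antilipschitzWith (LinearMap.ker_eq_bot.2 hL)
  have hk' : (1 : ℝ) < k := by exact_mod_cast hk
  have hK' : (0 : ℝ) < K := by exact_mod_cast hK
  -- the tolerance `c` satisfies both `1 + c K ≤ k` and `1 ≤ k (1 - c K)`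
  set c : NNReal := (k - 1) / (k * K) with hc
  have hc0 : 0 < c := by
    rw [hc]; exact div_pos (tsub_pos_of_lt hk) (mul_pos (zero_lt_one.trans hk) hK)
  have hcr : (c : ℝ) = ((k : ℝ) - 1) / (k * K) := by
    rw [hc]; push_cast [NNReal.coe_sub hk.le]; rfl
  have hcK : (c : ℝ) * K = 1 - 1 / k := by
    rw [hcr]; field_simp
  obtain ⟨t, ht, happ⟩ := hF.approximates_deriv_on_nhds (c := c) (Or.inr hc0)
  refine ⟨t, ht, fun s hs => ?_⟩
  have hb : ∀ y ∈ s, ∀ z ∈ s, ‖F y - F z - L (y - z)‖ ≤ c * K * ‖L y - L z‖ := by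
    intro y hy z hz
    refine (happ y (hs hy) z (hs hz)).trans ?_
    have := hanti.le_mul_dist y z
    rw [dist_eq_norm, dist_eq_norm] at this
    rw [mul_assoc]
    exact mul_le_mul_of_nonneg_left (by simpa using this) c.2
  have hkinv : 1 / (k : ℝ) * k = 1 := by field_simp
  have hkpos : 0 < 1 / (k : ℝ) := by positivity
  have h1 : ∀ y ∈ s, ∀ z ∈ s, dist (F y) (F z) ≤ k * dist (L y) (L z) := by
    intro y hy z hz
    have h := hb y hy z hz
    rw [hcK] at h
    rw [dist_eq_norm, dist_eq_norm]
    have h2 : ‖F y - F z‖ ≤ ‖F y - F z - L (y - z)‖ + ‖L y - L z‖ := by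
      rw [← map_sub]
      simpa using norm_add_le (F y - F z - L (y - z)) (L (y - z))
    have h3 : 1 - 1 / (k : ℝ) ≤ k - 1 := by
      rw [sub_le_sub_iff, ← sub_nonneg]
      have : (k : ℝ) + 1 / k - (1 + 1) = (k - 1) ^ 2 / k := by field_simp; ring
      rw [this]; positivity
    nlinarith [norm_nonneg (L y - L z)]
  have h2 : ∀ y ∈ s, ∀ z ∈ s, dist (L y) (L z) ≤ k * dist (F y) (F z) := by
    intro y hy z hz
    have h := hb y hy z hz
    rw [hcK] at h
    rw [dist_eq_norm, dist_eq_norm]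
    have h2 : ‖L y - L z‖ ≤ ‖F y - F z‖ + ‖F y - F z - L (y - z)‖ := by
      rw [← map_sub]
      simpa using norm_sub_le (F y - F z) (F y - F z - L (y - z))
    have h3 : 1 / (k : ℝ) * ‖L y - L z‖ ≤ ‖F y - F z‖ := by linarith
    calc ‖L y - L z‖ = k * (1 / (k : ℝ) * ‖L y - L z‖) := by
          rw [← mul_assoc, mul_comm (k : ℝ), hkinv, one_mul]
      _ ≤ _ := by gcongr
  have e := (L : U →ₗ[ℝ] V).euclideanHausdorffMeasure_image_eq_normDet_mul_volume s
  rw [← e]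
  exact ⟨euclideanHausdorffMeasure_image_le_of_dist_le _ h1,
    euclideanHausdorffMeasure_image_le_of_dist_le _ h2⟩

lemma le_of_forall_one_lt_pow_mul {a b : ENNReal} (d : ℕ)
    (h : ∀ k : NNReal, 1 < k → a ≤ (k : ENNReal) ^ d * b) : a ≤ b := by
  have ht : Tendsto (fun k : NNReal => (k : ENNReal) ^ d * b) (𝓝[>] 1) (𝓝 (1 ^ d * b)) := by
    refine ENNReal.Tendsto.mul_const ?_ (Or.inl (by simp))
    refine ENNReal.Tendsto.pow ?_
    exact (ENNReal.tendsto_coe.2 (tendsto_id.mono_left nhdsWithin_le_nhds))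
  rw [one_pow, one_mul] at ht
  exact ge_of_tendsto ht (eventually_mem_nhdsWithin.mono fun k hk => h k hk)

/-- Area formula: Hausdorff measure, pulled back along an embedding of class `C¹`, has the Jacobian
as density. The density of the pullback is computed on small balls by Besicovitch's
differentiation theorem. -/
theorem comap_euclideanHausdorffMeasure_eq_withDensity {F : U → V} {F' : U → U →L[ℝ] V}
    (hF : ∀ x, HasStrictFDerivAt F (F' x) x) (hinj : ∀ x, Function.Injective (F' x))
    (hemb : MeasurableEmbedding F) :
    Measure.comap F μHE[Module.finrank ℝ U] =
      (volume : Measure U).withDensity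
        fun x => ENNReal.ofReal (F' x : U →ₗ[ℝ] V).normDet := by
  set ν : Measure U := Measure.comap F μHE[Module.finrank ℝ U] with hν
  have hνa : ∀ s, ν s = μHE[Module.finrank ℝ U] (F '' s) := fun s => hemb.comap_apply _ s
  have hac : ν ≪ volume := by
    intro s hs
    refine measure_null_of_locally_null s fun x _ => ?_
    obtain ⟨t, ht, h⟩ := exists_nhds_euclideanHausdorffMeasure_image_le (hF x) (hinj x)
      (k := 2) (by norm_num)
    refine ⟨s ∩ t, inter_mem_nhdsWithin s ht, ?_⟩
    rw [hνa]
    refine le_antisymm ((h (s ∩ t) inter_subset_right).1.trans ?_) bot_le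
    rw [measure_mono_null inter_subset_left hs]; simp
  have hlf : IsLocallyFiniteMeasure ν := by
    refine ⟨fun x => ?_⟩
    obtain ⟨t, ht, h⟩ := exists_nhds_euclideanHausdorffMeasure_image_le (hF x) (hinj x)
      (k := 2) (by norm_num)
    obtain ⟨r, hr, hrt⟩ := Metric.nhds_basis_closedBall.mem_iff.1 ht
    refine ⟨Metric.closedBall x r, Metric.closedBall_mem_nhds x hr, ?_⟩
    rw [hνa]
    refine (h _ hrt).1.trans_lt ?_
    exact ENNReal.mul_lt_top (by simp) (ENNReal.mul_lt_top (by simp) measure_closedBall_lt_top)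
  rw [← Measure.withDensity_rnDeriv_eq ν volume hac]
  refine withDensity_congr_ae ?_
  filter_upwards [Besicovitch.ae_tendsto_rnDeriv ν (volume : Measure U)] with x hx
  have hball : ∀ k : NNReal, 1 < k → ∀ᶠ r in 𝓝[>] (0 : ℝ),
      ν (Metric.closedBall x r) / volume (Metric.closedBall x r) ≤
        (k : ENNReal) ^ (Module.finrank ℝ U) * ENNReal.ofReal (F' x : U →ₗ[ℝ] V).normDet ∧
      ENNReal.ofReal (F' x : U →ₗ[ℝ] V).normDet ≤ (k : ENNReal) ^ (Module.finrank ℝ U) *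
        (ν (Metric.closedBall x r) / volume (Metric.closedBall x r)) := by
    intro k hk
    obtain ⟨t, ht, h⟩ := exists_nhds_euclideanHausdorffMeasure_image_le (hF x) (hinj x) hk
    obtain ⟨r₀, hr₀, hrt⟩ := Metric.nhds_basis_closedBall.mem_iff.1 ht
    filter_upwards [Ioc_mem_nhdsGT hr₀] with r hr
    have hsub : Metric.closedBall x r ⊆ t := (Metric.closedBall_subset_closedBall hr.2).trans hrt
    have hv0 : volume (Metric.closedBall x r) ≠ 0 := (Metric.measure_closedBall_pos _ _ hr.1).ne'
    have hvt : volume (Metric.closedBall x r) ≠ ⊤ := measure_closedBall_lt_top.ne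
    obtain ⟨h1, h2⟩ := h _ hsub
    rw [← hνa] at h1 h2
    refine ⟨?_, ?_⟩
    · rw [ENNReal.div_le_iff hv0 hvt, mul_assoc]; exact h1
    · rw [← mul_div_assoc, ENNReal.le_div_iff_mul_le (Or.inl hv0) (Or.inl hvt)]; exact h2
  refine le_antisymm ?_ ?_
  · refine le_of_forall_one_lt_pow_mul (Module.finrank ℝ U) fun k hk => ?_
    exact le_of_tendsto hx ((hball k hk).mono fun r hr => hr.1)
  · refine le_of_forall_one_lt_pow_mul (Module.finrank ℝ U) fun k hk => ?_
    have hm := ENNReal.Tendsto.const_mul (a := (k : ENNReal) ^ (Module.finrank ℝ U)) hx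
      (Or.inr (by simp))
    exact ge_of_tendsto hm ((hball k hk).mono fun r hr => hr.2)

/-- The Jacobian of the differential of a graph over a hyperplane: `L` is `v ↦ v + ⟪a, v⟫ N` up to
an isometry, `a` being the gradient of the height function. -/
lemma normDet_eq_sqrt_one_add_norm_sq {X E : Type*} [NormedAddCommGroup X] [InnerProductSpace ℝ X]
    [FiniteDimensional ℝ X] [NormedAddCommGroup E] [InnerProductSpace ℝ E] (L : X →ₗ[ℝ] E) (a : X)
    (h : ∀ v w, inner ℝ (L v) (L w) = inner ℝ v w + inner ℝ a v * inner ℝ a w) :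
    L.normDet = √(1 + ‖a‖ ^ 2) := by
  set b := stdOrthonormalBasis ℝ X
  have h1 := L.normDet_sq_eq_det_gram b
  have h2 : (Matrix.gram ℝ fun x => L (b x)) =
      1 + Matrix.replicateCol Unit (fun i => inner ℝ a (b i)) *
        Matrix.replicateRow Unit (fun i => inner ℝ a (b i)) := by
    ext i j
    simp [Matrix.gram, Matrix.mul_apply, h, Matrix.one_apply,
      orthonormal_iff_ite.1 b.orthonormal i j]
  rw [h2, Matrix.det_one_add_replicateCol_mul_replicateRow] at h1
  have h3 : ∑ i, inner ℝ a (b i) ^ 2 = ‖a‖ ^ 2 := b.sum_sq_inner_left a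
  have h4 : L.normDet ^ 2 = 1 + ‖a‖ ^ 2 := by
    rw [← h3]; simpa [dotProduct, sq] using h1
  rw [← h4, Real.sqrt_sq L.normDet_nonneg]

end AreaFormula

/-! ### Homogeneous functions in polar coordinates -/

section Polar

open Set Metric Module

variable {X : Type*} [NormedAddCommGroup X] [InnerProductSpace ℝ X]

/-- `f` is continuous and positively homogeneous of degree `k`. -/
structure IsHomogeneous (f : X → ℝ) (k : ℕ) : Prop where
  continuous : Continuous f
  map_smul : ∀ (r : ℝ) (x : X), 0 < r → f (r • x) = r ^ k * f x

lemma IsHomogeneous.mul {f g : X → ℝ} {k l : ℕ} (hf : IsHomogeneous f k)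
    (hg : IsHomogeneous g l) : IsHomogeneous (fun x => f x * g x) (k + l) :=
  ⟨hf.continuous.mul hg.continuous, fun r x hr => by
    rw [hf.map_smul r x hr, hg.map_smul r x hr]; ring⟩

lemma IsHomogeneous.pow {f : X → ℝ} {k : ℕ} (hf : IsHomogeneous f k) (l : ℕ) :
    IsHomogeneous (fun x => f x ^ l) (k * l) :=
  ⟨hf.continuous.pow l, fun r x hr => by rw [hf.map_smul r x hr, mul_pow, pow_mul]⟩

lemma isHomogeneous_inner (v : X) : IsHomogeneous (fun x => inner ℝ v x) 1 :=
  ⟨by fun_prop, fun r x _ => by rw [inner_smul_right, pow_one]⟩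

variable [FiniteDimensional ℝ X]

lemma IsHomogeneous.exists_abs_le {f : X → ℝ} {k : ℕ} (hf : IsHomogeneous f k) :
    ∃ C, 0 ≤ C ∧ ∀ x, x ≠ 0 → |f x| ≤ C * ‖x‖ ^ k := by
  obtain ⟨C, hC⟩ := (isCompact_sphere (0 : X) 1).exists_bound_of_continuousOn
    hf.continuous.continuousOn
  refine ⟨max C 0, le_max_right _ _, fun x hx => ?_⟩
  have hx' : 0 < ‖x‖ := norm_pos_iff.2 hx
  have h1 : f x = ‖x‖ ^ k * f (‖x‖⁻¹ • x) := by
    rw [← hf.map_smul _ _ hx', smul_smul, mul_inv_cancel₀ hx'.ne', one_smul]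
  have h2 := hC (‖x‖⁻¹ • x) (by simp [norm_smul, hx'.ne'])
  rw [h1, abs_mul, abs_of_nonneg (by positivity : 0 ≤ ‖x‖ ^ k), mul_comm]
  exact mul_le_mul_of_nonneg_right (h2.trans (le_max_left _ _)) (by positivity)

variable [MeasurableSpace X] [BorelSpace X]

/-- Integration in polar coordinates. -/
lemma integral_eq_integral_sphere_integral_Ioi [Nontrivial X] {f : X → ℝ} (hf : Integrable f) :
    Integrable (fun θ : sphere (0 : X) 1 =>
      ∫ r in Ioi (0 : ℝ), r ^ (finrank ℝ X - 1) * f (r • (θ : X)))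
      (volume : Measure X).toSphere ∧
    ∫ x, f x = ∫ θ : sphere (0 : X) 1,
      (∫ r in Ioi (0 : ℝ), r ^ (finrank ℝ X - 1) * f (r • (θ : X)))
        ∂(volume : Measure X).toSphere := by
  have hmp := (volume : Measure X).measurePreserving_homeomorphUnitSphereProd
  have hcomp : ∀ x : ({(0 : X)}ᶜ : Set X),
      f x = (fun y : sphere (0 : X) 1 × Ioi (0 : ℝ) => f ((y.2 : ℝ) • (y.1 : X)))
        (homeomorphUnitSphereProd X x) := by
    intro x
    have := homeomorphUnitSphereProd_symm_apply_coe X (homeomorphUnitSphereProd X x)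
    rw [Homeomorph.symm_apply_apply] at this
    rw [this]
  have hint : Integrable (fun y : sphere (0 : X) 1 × Ioi (0 : ℝ) => f ((y.2 : ℝ) • (y.1 : X)))
      ((volume : Measure X).toSphere.prod (Measure.volumeIoiPow (finrank ℝ X - 1))) := by
    rw [← hmp.integrable_comp_emb (Homeomorph.measurableEmbedding _)]
    have h0 : Integrable (fun x : ({(0 : X)}ᶜ : Set X) => f x)
        (Measure.comap Subtype.val volume) := by
      rw [← Function.comp_def f, ← integrableOn_iff_comap_subtypeVal
        (measurableSet_singleton _).compl]
      exact hf.integrableOn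
    refine h0.congr (Filter.Eventually.of_forall fun x => ?_)
    exact hcomp x
  have hinner : (fun θ : sphere (0 : X) 1 =>
      ∫ r, f ((r : ℝ) • (θ : X)) ∂(Measure.volumeIoiPow (finrank ℝ X - 1))) =
      fun θ : sphere (0 : X) 1 =>
        ∫ r in Ioi (0 : ℝ), r ^ (finrank ℝ X - 1) * f (r • (θ : X)) := by
    funext θ
    simp only [Measure.volumeIoiPow, ENNReal.ofReal]
    rw [integral_withDensity_eq_integral_smul
      ((measurable_subtype_coe.pow_const _).real_toNNReal),
      integral_subtype_comap measurableSet_Ioi fun a : ℝ =>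
        Real.toNNReal (a ^ (finrank ℝ X - 1)) • f (a • (θ : X)),
      setIntegral_congr_fun measurableSet_Ioi fun x hx => ?_]
    rw [NNReal.smul_def, Real.coe_toNNReal _ (pow_nonneg (le_of_lt hx) _), smul_eq_mul]
  refine ⟨hinner ▸ hint.integral_prod_left, ?_⟩
  calc ∫ x, f x = ∫ x : ({(0 : X)}ᶜ : Set X), f x ∂(Measure.comap Subtype.val volume) := by
        rw [integral_subtype_comap (measurableSet_singleton _).compl fun x => f x,
          restrict_compl_singleton]
    _ = ∫ y, f ((y.2 : ℝ) • (y.1 : X))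
          ∂(volume : Measure X).toSphere.prod (Measure.volumeIoiPow (finrank ℝ X - 1)) := by
        rw [← hmp.integral_comp (Homeomorph.measurableEmbedding _)]
        exact integral_congr_ae (Filter.Eventually.of_forall hcomp)
    _ = _ := by rw [integral_prod _ hint, hinner]

/-- The integral of a function over the unit sphere. -/
noncomputable def sphereIntegral (f : X → ℝ) : ℝ :=
  ∫ θ : sphere (0 : X) 1, f θ ∂(volume : Measure X).toSphere

lemma integrable_sphere {f : X → ℝ} (hf : Continuous f) :
    Integrable (fun θ : sphere (0 : X) 1 => f θ) (volume : Measure X).toSphere :=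
  (hf.comp continuous_subtype_val).integrable_of_hasCompactSupport
    (HasCompactSupport.of_compactSpace _)

/-- A homogeneous function integrates against a radial weight to the product of a radial integral
and of its integral over the sphere. -/
lemma IsHomogeneous.integral_mul_radial [Nontrivial X] {f : X → ℝ} {k : ℕ}
    (hf : IsHomogeneous f k) {w : ℝ → ℝ} (hi : Integrable fun x => f x * w ‖x‖) :
    ∫ x, f x * w ‖x‖ =
      (∫ r in Ioi (0 : ℝ), r ^ (finrank ℝ X + k - 1) * w r) * sphereIntegral f := by
  rw [(integral_eq_integral_sphere_integral_Ioi hi).2, sphereIntegral, ← integral_const_mul]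
  refine integral_congr_ae (Filter.Eventually.of_forall fun θ => ?_)
  have hθ : ‖(θ : X)‖ = 1 := by simp
  beta_reduce
  rw [← integral_mul_const]
  refine setIntegral_congr_fun measurableSet_Ioi fun r (hr : 0 < r) => ?_
  have hd : 0 < finrank ℝ X := finrank_pos
  have e : finrank ℝ X + k - 1 = (finrank ℝ X - 1) + k := by omega
  rw [hf.map_smul r _ hr, norm_smul, hθ, mul_one, Real.norm_of_nonneg hr.le, e, pow_add]
  ring

lemma sphereIntegral_of_odd {f : X → ℝ} {k : ℕ} [Nontrivial X] (hf : IsHomogeneous f k)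
    (hodd : ∀ x, f (-x) = -f x) : sphereIntegral f = 0 := by
  have hc : Continuous fun x : X => f x := hf.continuous
  have hi : Integrable fun x => f x * (Iic (1 : ℝ)).indicator 1 ‖x‖ := by
    have h1 : IntegrableOn f (closedBall 0 1) :=
      hc.continuousOn.integrableOn_compact (isCompact_closedBall 0 1)
    rw [← integrable_indicator_iff measurableSet_closedBall] at h1
    refine h1.congr (Filter.Eventually.of_forall fun x => ?_)
    by_cases hx : ‖x‖ ≤ 1 <;> simp [indicator, hx]
  have h1 := hf.integral_mul_radial hi
  have h2 : ∫ x, f x * (Iic (1 : ℝ)).indicator 1 ‖x‖ = 0 := by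
    have := integral_neg_eq_self (fun x => f x * (Iic (1 : ℝ)).indicator (1 : ℝ → ℝ) ‖x‖) volume
    simp only [hodd, norm_neg, neg_mul, integral_neg] at this
    linarith
  rw [h2] at h1
  have h3 : ∫ r in Ioi (0 : ℝ), r ^ (finrank ℝ X + k - 1) * (Iic (1 : ℝ)).indicator 1 r ≠ 0 := by
    have e : ∀ r : ℝ, r ^ (finrank ℝ X + k - 1) * (Iic (1 : ℝ)).indicator 1 r =
        (Iic (1 : ℝ)).indicator (fun r => r ^ (finrank ℝ X + k - 1)) r := by
      intro r; by_cases hr : r ≤ 1 <;> simp [indicator, hr]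
    simp only [e]
    rw [setIntegral_indicator measurableSet_Iic, Ioi_inter_Iic,
      ← intervalIntegral.integral_of_le zero_le_one, integral_pow]
    simp
    positivity
  exact (mul_eq_zero.1 h1.symm).resolve_left h3

lemma sphereIntegral_one [Nontrivial X] :
    sphereIntegral (fun _ : X => 1) =
      finrank ℝ X * (volume : Measure X).real (closedBall (0 : X) 1) := by
  simp only [sphereIntegral, integral_const, smul_eq_mul, mul_one]
  rw [Measure.toSphere_real_apply_univ, Measure.addHaar_real_closedBall_eq_addHaar_real_ball]

/-- The Gaussian moments on the half line. -/
noncomputable def gaussianMoment (s : ℕ) : ℝ :=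
  ∫ r in Ioi (0 : ℝ), r ^ s * Real.exp (-(1 / 2) * r ^ 2)

lemma gaussianMoment_eq (s : ℕ) :
    gaussianMoment s =
      (1 / 2) ^ (-((s : ℝ) + 1) / 2) * (1 / 2) * Real.Gamma (((s : ℝ) + 1) / 2) := by
  rw [← integral_rpow_mul_exp_neg_mul_rpow (p := 2) (q := s) (b := 1 / 2) (by norm_num)
    (by have : (0 : ℝ) ≤ s := Nat.cast_nonneg s
        linarith) (by norm_num), gaussianMoment]
  norm_cast

lemma gaussianMoment_pos (s : ℕ) : 0 < gaussianMoment s := by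
  rw [gaussianMoment_eq]
  have : 0 < Real.Gamma (((s : ℝ) + 1) / 2) := Real.Gamma_pos_of_pos (by positivity)
  positivity

lemma gaussianMoment_add_two (s : ℕ) :
    gaussianMoment (s + 2) = (s + 1) * gaussianMoment s := by
  rw [gaussianMoment_eq, gaussianMoment_eq]
  have e1 : (((s + 2 : ℕ) : ℝ) + 1) / 2 = ((s : ℝ) + 1) / 2 + 1 := by push_cast; ring
  have e2 : -(((s + 2 : ℕ) : ℝ) + 1) / 2 = -((s : ℝ) + 1) / 2 - 1 := by push_cast; ring
  rw [e1, e2, Real.Gamma_add_one (by positivity), Real.rpow_sub_one (by norm_num)]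
  ring

lemma IsHomogeneous.integrable_mul_gaussian [Nontrivial X] {f : X → ℝ} {k : ℕ}
    (hf : IsHomogeneous f k) :
    Integrable fun x => f x * Real.exp (-(1 / 2) * ‖x‖ ^ 2) := by
  obtain ⟨C, hC0, hC⟩ := hf.exists_abs_le
  have h1 : Integrable fun x : X => C * ‖x‖ ^ k * Real.exp (-(1 / 2) * ‖x‖ ^ 2) := by
    rw [integrable_fun_norm_addHaar volume
      (f := fun r => C * r ^ k * Real.exp (-(1 / 2) * r ^ 2))]
    have h := (integrableOn_rpow_mul_exp_neg_mul_sq (b := 1 / 2) (by norm_num)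
      (s := ((finrank ℝ X - 1 + k : ℕ) : ℝ))
      (by have := Nat.cast_nonneg (α := ℝ) (finrank ℝ X - 1 + k)
          linarith)).const_mul C
    refine h.congr (Filter.Eventually.of_forall fun r => ?_)
    simp only [Real.rpow_natCast, smul_eq_mul, pow_add]
    ring
  refine h1.mono' ?_ ?_
  · exact (hf.continuous.mul (by fun_prop)).aestronglyMeasurable
  · have : ∀ᵐ x : X, x ≠ 0 := by
      rw [ae_iff]; simp
    filter_upwards [this] with x hx
    rw [norm_mul, Real.norm_eq_abs, Real.norm_of_nonneg (Real.exp_nonneg _)]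
    exact mul_le_mul_of_nonneg_right (hC x hx) (Real.exp_nonneg _)

lemma IsHomogeneous.integral_mul_gaussian [Nontrivial X] {f : X → ℝ} {k : ℕ}
    (hf : IsHomogeneous f k) :
    ∫ x, f x * Real.exp (-(1 / 2) * ‖x‖ ^ 2) =
      gaussianMoment (finrank ℝ X + k - 1) * sphereIntegral f :=
  hf.integral_mul_radial (w := fun r => Real.exp (-(1 / 2) * r ^ 2)) hf.integrable_mul_gaussian

/-- The divergence theorem on the sphere for a homogeneous function, which evaluates the moments
of the sphere recursively. It is integration by parts against the Gaussian weight, read in polar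
coordinates. -/
lemma IsHomogeneous.sphereIntegral_inner_mul [Nontrivial X] {P Q : X → ℝ} {m : ℕ} (v : X)
    (hP : IsHomogeneous P (m + 1)) (hQ : IsHomogeneous Q m) (hd : Differentiable ℝ P)
    (hPQ : ∀ x, fderiv ℝ P x v = Q x) :
    (finrank ℝ X + m) * sphereIntegral (fun x => inner ℝ v x * P x) = sphereIntegral Q := by
  have hG : ∀ x : X, HasFDerivAt (fun x : X => Real.exp (-(1 / 2) * ‖x‖ ^ 2))
      (Real.exp (-(1 / 2) * ‖x‖ ^ 2) • ((-(1 / 2) : ℝ) • (2 • innerSL ℝ x))) x := fun x =>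
    (((hasStrictFDerivAt_norm_sq x).hasFDerivAt).const_mul (-(1 / 2) : ℝ)).exp
  have hGv : ∀ x : X, fderiv ℝ (fun x : X => Real.exp (-(1 / 2) * ‖x‖ ^ 2)) x v =
      -(inner ℝ v x * Real.exp (-(1 / 2) * ‖x‖ ^ 2)) := by
    intro x
    rw [(hG x).fderiv]
    simp [real_inner_comm v x]
    ring
  have hvP := (isHomogeneous_inner v).mul hP
  have i1 := hQ.integrable_mul_gaussian
  have i2 := hvP.integrable_mul_gaussian
  have i3 := hP.integrable_mul_gaussian
  have key := integral_mul_fderiv_eq_neg_fderiv_mul_of_integrable (μ := (volume : Measure X))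
    (f := P) (g := fun x : X => Real.exp (-(1 / 2) * ‖x‖ ^ 2)) (v := v)
    (by simpa only [hPQ] using i1)
    (by simp only [hGv]
        refine i2.neg.congr (Filter.Eventually.of_forall fun x => ?_)
        simp only [Pi.neg_apply]; ring) i3 (fun x _ => hd x)
    (fun x _ => (hG x).differentiableAt)
  simp only [hPQ, hGv] at key
  have e : ∀ x : X, P x * -(inner ℝ v x * Real.exp (-(1 / 2) * ‖x‖ ^ 2)) =
      -(inner ℝ v x * P x * Real.exp (-(1 / 2) * ‖x‖ ^ 2)) := fun x => by ring
  simp only [e, integral_neg, neg_inj] at key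
  rw [hvP.integral_mul_gaussian, hQ.integral_mul_gaussian] at key
  have hpos : 0 < finrank ℝ X := finrank_pos
  have hs : finrank ℝ X + (1 + (m + 1)) - 1 = (finrank ℝ X + m - 1) + 2 := by omega
  have hs' : ((finrank ℝ X + m - 1 : ℕ) : ℝ) + 1 = finrank ℝ X + m := by
    rw [Nat.cast_sub (by omega)]; push_cast; ring
  rw [hs, gaussianMoment_add_two, hs'] at key
  have hc := gaussianMoment_pos (finrank ℝ X + m - 1)
  refine mul_left_cancel₀ hc.ne' ?_
  rw [← key]; ring

end Polar

/-! ### Moments of the sphere weighted by a diagonal quadratic form -/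

section SphereMoments

open Module

variable {n : ℕ}

/-- The quadratic form `½ ∑ κ_i x_i²`: the second fundamental form in principal coordinates. -/
noncomputable def quad (κ : Fin n → ℝ) (x : EuclideanSpace ℝ (Fin n)) : ℝ :=
  1 / 2 * ∑ i, κ i * x i ^ 2

lemma isHomogeneous_quad (κ : Fin n → ℝ) : IsHomogeneous (quad κ) 2 := by
  refine ⟨by unfold quad; fun_prop, fun r x _ => ?_⟩
  simp only [quad, PiLp.smul_apply, smul_eq_mul, Finset.mul_sum]
  exact Finset.sum_congr rfl fun i _ => by ring

lemma isHomogeneous_coord (i : Fin n) :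
    IsHomogeneous (fun x : EuclideanSpace ℝ (Fin n) => x i) 1 :=
  ⟨by fun_prop, fun r x _ => by simp⟩

lemma isHomogeneous_const (c : ℝ) : IsHomogeneous (fun _ : EuclideanSpace ℝ (Fin n) => c) 0 :=
  ⟨by fun_prop, fun r x _ => by simp⟩

lemma quad_neg (κ : Fin n → ℝ) (x : EuclideanSpace ℝ (Fin n)) : quad κ (-x) = quad κ x := by
  simp [quad]

/-- The volume of the unit ball of `ℝⁿ`. -/
noncomputable def unitVolume (n : ℕ) : ℝ := ballVolume n 1

lemma unitVolume_pos : 0 < unitVolume n := by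
  unfold unitVolume ballVolume
  exact ENNReal.toReal_pos (Metric.measure_closedBall_pos _ _ one_pos).ne'
    measure_closedBall_lt_top.ne

lemma ballVolume_eq {ε : ℝ} (hε : 0 ≤ ε) : ballVolume n ε = ε ^ n * unitVolume n := by
  unfold unitVolume ballVolume
  rw [Measure.addHaar_real_closedBall' _ _ hε]
  simp

lemma hasFDerivAt_coord (i : Fin n) (x : EuclideanSpace ℝ (Fin n)) :
    HasFDerivAt (fun x : EuclideanSpace ℝ (Fin n) => x i)
      (EuclideanSpace.proj i : EuclideanSpace ℝ (Fin n) →L[ℝ] ℝ) x :=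
  (EuclideanSpace.proj i : EuclideanSpace ℝ (Fin n) →L[ℝ] ℝ).hasFDerivAt

lemma hasFDerivAt_quad (κ : Fin n → ℝ) (x : EuclideanSpace ℝ (Fin n)) :
    HasFDerivAt (quad κ) (∑ i, (κ i * x i) •
      (EuclideanSpace.proj i : EuclideanSpace ℝ (Fin n) →L[ℝ] ℝ)) x := by
  have h : HasFDerivAt (fun x : EuclideanSpace ℝ (Fin n) => ∑ i, κ i * x i ^ 2)
      (∑ i, κ i • ((2 * x i ^ 1) • (EuclideanSpace.proj i : EuclideanSpace ℝ (Fin n) →L[ℝ] ℝ))) x :=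
    HasFDerivAt.fun_sum fun i _ =>
      (((hasFDerivAt_coord i x).pow 2).congr_fderiv (by simp)).const_mul (κ i)
  refine (h.const_mul (1 / 2)).congr_fderiv ?_
  rw [Finset.smul_sum]
  refine Finset.sum_congr rfl fun i _ => ?_
  simp only [smul_smul]
  congr 1; ring

lemma isHomogeneous_coord_mul_quad_pow (κ : Fin n → ℝ) (i : Fin n) (k : ℕ) :
    IsHomogeneous (fun x : EuclideanSpace ℝ (Fin n) => x i * quad κ x ^ k) (2 * k + 1) := by
  have := (isHomogeneous_coord i).mul ((isHomogeneous_quad κ).pow k)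
  rwa [add_comm] at this

lemma sphereIntegral_add_const_mul {f g : EuclideanSpace ℝ (Fin n) → ℝ} (hf : Continuous f)
    (hg : Continuous g) (a b : ℝ) :
    sphereIntegral (fun x => a * f x + b * g x) = a * sphereIntegral f + b * sphereIntegral g := by
  unfold sphereIntegral
  rw [integral_add ((integrable_sphere hf).const_mul a) ((integrable_sphere hg).const_mul b),
    integral_const_mul, integral_const_mul]

lemma sphereIntegral_quad_mul (κ : Fin n → ℝ) {f : EuclideanSpace ℝ (Fin n) → ℝ}
    (hf : Continuous f) :
    sphereIntegral (fun x => quad κ x * f x) =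
      1 / 2 * ∑ i, κ i * sphereIntegral (fun x => x i * (x i * f x)) := by
  unfold sphereIntegral
  have hi : ∀ i, Integrable (fun θ : Metric.sphere (0 : EuclideanSpace ℝ (Fin n)) 1 =>
      (θ : EuclideanSpace ℝ (Fin n)) i * ((θ : EuclideanSpace ℝ (Fin n)) i * f θ))
      (volume : Measure (EuclideanSpace ℝ (Fin n))).toSphere := fun i =>
    integrable_sphere (f := fun x : EuclideanSpace ℝ (Fin n) => x i * (x i * f x)) (by fun_prop)
  simp only [← integral_const_mul]
  rw [← integral_finsetSum _ fun i _ => (hi i).const_mul (κ i), ← integral_const_mul]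
  refine integral_congr_ae (Filter.Eventually.of_forall fun θ => ?_)
  simp only [quad]
  rw [mul_assoc, Finset.sum_mul]
  congr 1
  exact Finset.sum_congr rfl fun i _ => by ring

lemma continuous_quad (κ : Fin n → ℝ) : Continuous (quad κ) := (isHomogeneous_quad κ).continuous

variable [NeZero n]

lemma sphereIntegral_const_one :
    sphereIntegral (fun _ : EuclideanSpace ℝ (Fin n) => 1) = n * unitVolume n := by
  rw [sphereIntegral_one]
  simp [unitVolume, ballVolume]

/-- The divergence theorem applied to `x_j q^k`, where `q` is the quadratic form. -/
lemma sphereIntegral_coord_mul_coord_mul_quad_pow (κ : Fin n → ℝ) (i j : Fin n) (k : ℕ) :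
    (n + 2 * k) * sphereIntegral
        (fun x : EuclideanSpace ℝ (Fin n) => x i * (x j * quad κ x ^ k)) =
      sphereIntegral (fun x : EuclideanSpace ℝ (Fin n) =>
        (if i = j then 1 else 0) * quad κ x ^ k +
          x j * (k * quad κ x ^ (k - 1) * (κ i * x i))) := by
  have hd : ∀ x : EuclideanSpace ℝ (Fin n), HasFDerivAt
      (fun x : EuclideanSpace ℝ (Fin n) => x j * quad κ x ^ k)
      (x j • ((k * quad κ x ^ (k - 1)) • ∑ i, (κ i * x i) •
        (EuclideanSpace.proj i : EuclideanSpace ℝ (Fin n) →L[ℝ] ℝ)) +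
        quad κ x ^ k • (EuclideanSpace.proj j : EuclideanSpace ℝ (Fin n) →L[ℝ] ℝ)) x := fun x =>
    ((hasFDerivAt_coord j x).mul ((hasFDerivAt_quad κ x).pow k)).congr_fderiv (by simp)
  have h := (isHomogeneous_coord_mul_quad_pow κ j k).sphereIntegral_inner_mul (m := 2 * k)
    (Q := fun x : EuclideanSpace ℝ (Fin n) =>
        (if i = j then 1 else 0) * quad κ x ^ k + x j * (k * quad κ x ^ (k - 1) * (κ i * x i)))
    (EuclideanSpace.single i 1) ?_ (fun x => (hd x).differentiableAt) ?_
  · simpa only [EuclideanSpace.inner_single_left, map_one, one_mul, finrank_euclideanSpace_fin,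
      Nat.cast_mul, Nat.cast_ofNat] using h
  · refine ⟨by unfold quad; fun_prop, fun r x hr => ?_⟩
    rcases k with _ | k
    · simp
    · rw [(isHomogeneous_quad κ).map_smul r x hr]
      simp only [PiLp.smul_apply, smul_eq_mul, Nat.add_sub_cancel, mul_pow, ← pow_mul]
      ring
  · intro x
    rw [(hd x).fderiv]
    simp [Finset.sum_ite_eq, eq_comm]
    ring

lemma sphereIntegral_coord_mul_coord (i j : Fin n) :
    sphereIntegral (fun x : EuclideanSpace ℝ (Fin n) => x i * x j) =
      if i = j then unitVolume n else 0 := by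
  have h := sphereIntegral_coord_mul_coord_mul_quad_pow (0 : Fin n → ℝ) i j 0
  have hn : (n : ℝ) ≠ 0 := Nat.cast_ne_zero.2 (NeZero.ne n)
  simp only [pow_zero, mul_one, Nat.cast_zero, mul_zero, add_zero, zero_mul] at h
  refine mul_left_cancel₀ hn ?_
  rw [h]
  split_ifs with hij
  · exact sphereIntegral_const_one
  · simp [sphereIntegral]

lemma sphereIntegral_quad (κ : Fin n → ℝ) :
    sphereIntegral (quad κ) = (∑ i, κ i) / 2 * unitVolume n := by
  have h := sphereIntegral_quad_mul κ (f := fun _ => 1) continuous_const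
  simp only [mul_one, sphereIntegral_coord_mul_coord, if_true] at h
  rw [h, ← Finset.sum_mul]; ring

lemma sphereIntegral_coord_mul_coord_mul_quad (κ : Fin n → ℝ) (i j : Fin n) :
    sphereIntegral (fun x : EuclideanSpace ℝ (Fin n) => x i * (x j * quad κ x)) =
      if i = j then ((∑ i, κ i) / 2 + κ i) * unitVolume n / (n + 2) else 0 := by
  have h := sphereIntegral_coord_mul_coord_mul_quad_pow κ i j 1
  have e : (fun x : EuclideanSpace ℝ (Fin n) => (if i = j then (1 : ℝ) else 0) * quad κ x ^ 1 +
      x j * ((1 : ℕ) * quad κ x ^ (1 - 1) * (κ i * x i))) =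
      fun x => (if i = j then (1 : ℝ) else 0) * quad κ x + κ i * (x i * x j) := by
    funext x; simp; ring
  rw [e, sphereIntegral_add_const_mul (continuous_quad κ) (by fun_prop), sphereIntegral_quad,
    sphereIntegral_coord_mul_coord] at h
  simp only [pow_one, Nat.cast_one, mul_one] at h
  rw [mul_comm, ← eq_div_iff (by positivity)] at h
  rw [h]
  split_ifs <;> ring

lemma sphereIntegral_quad_sq (κ : Fin n → ℝ) :
    sphereIntegral (fun x : EuclideanSpace ℝ (Fin n) => quad κ x ^ 2) =
      ((∑ i, κ i) ^ 2 / 4 + (∑ i, κ i ^ 2) / 2) * unitVolume n / (n + 2) := by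
  have h := sphereIntegral_quad_mul κ (continuous_quad κ)
  simp only [sphereIntegral_coord_mul_coord_mul_quad, if_true, ← sq] at h
  rw [h]
  have : ∀ i, κ i * (((∑ i, κ i) / 2 + κ i) * unitVolume n / (n + 2)) =
      κ i * ((∑ i, κ i) / 2 * unitVolume n / (n + 2)) +
        κ i ^ 2 * (unitVolume n / (n + 2)) := fun i => by ring
  simp only [this, Finset.sum_add_distrib, ← Finset.sum_mul]
  ring

lemma sphereIntegral_coord_mul_coord_mul_quad_sq (κ : Fin n → ℝ) (i j : Fin n) :
    sphereIntegral (fun x : EuclideanSpace ℝ (Fin n) => x i * (x j * quad κ x ^ 2)) =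
      if i = j then ((∑ i, κ i) ^ 2 / 4 + (∑ i, κ i ^ 2) / 2 + (∑ i, κ i) * κ i + 2 * κ i ^ 2) *
        unitVolume n / ((n + 2) * (n + 4)) else 0 := by
  have h := sphereIntegral_coord_mul_coord_mul_quad_pow κ i j 2
  have e : (fun x : EuclideanSpace ℝ (Fin n) => (if i = j then (1 : ℝ) else 0) * quad κ x ^ 2 +
      x j * ((2 : ℕ) * quad κ x ^ (2 - 1) * (κ i * x i))) =
      fun x => (if i = j then (1 : ℝ) else 0) * quad κ x ^ 2 +
        2 * κ i * (x i * (x j * quad κ x)) := by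
    funext x; simp; ring
  have hq := continuous_quad κ
  rw [e, sphereIntegral_add_const_mul (by fun_prop) (by fun_prop), sphereIntegral_quad_sq,
    sphereIntegral_coord_mul_coord_mul_quad] at h
  rw [mul_comm, ← eq_div_iff (by positivity)] at h
  rw [h]
  have h2 : (n : ℝ) + 2 ≠ 0 := by positivity
  have h4 : (n : ℝ) + 4 ≠ 0 := by positivity
  split_ifs
  · push_cast; field_simp; ring
  · simp

end SphereMoments

/-! ### Radial moments of a graph along a ray -/

section Radial

open Set

lemma abs_one_sub_pow_sub_le (p : ℕ) {u : ℝ} (hu : |u| ≤ 1) :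
    |(1 - u) ^ p - 1 + p * u| ≤ 3 ^ p * u ^ 2 := by
  induction p with
  | zero => simp; positivity
  | succ p ih =>
    have e : (1 - u) ^ (p + 1) - 1 + ((p + 1 : ℕ) : ℝ) * u =
        (1 - u) * ((1 - u) ^ p - 1 + p * u) + p * u ^ 2 := by push_cast; ring
    have h1 : |1 - u| ≤ 2 := by rw [abs_le] at hu ⊢; constructor <;> linarith
    have h2 : (p : ℝ) ≤ 3 ^ p := by exact_mod_cast (Nat.lt_pow_self (by norm_num)).le
    rw [e]
    calc _ ≤ |1 - u| * |(1 - u) ^ p - 1 + p * u| + p * u ^ 2 := by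
          refine (abs_add_le _ _).trans ?_
          rw [abs_mul, abs_of_nonneg (by positivity : (0 : ℝ) ≤ p * u ^ 2)]
      _ ≤ 2 * (3 ^ p * u ^ 2) + 3 ^ p * u ^ 2 := by gcongr
      _ = _ := by ring

lemma setIntegral_Ioc_pow (p : ℕ) {r : ℝ} (hr : 0 ≤ r) :
    ∫ t in Ioc 0 r, t ^ p = r ^ (p + 1) / (p + 1) := by
  rw [← intervalIntegral.integral_of_le hr, integral_pow]; simp

lemma integrableOn_Ioc_pow (p : ℕ) (r : ℝ) : IntegrableOn (fun t : ℝ => t ^ p) (Ioc 0 r) :=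
  ((continuous_pow p).integrableOn_Icc (a := 0) (b := r)).mono_set Ioc_subset_Icc_self

/-- The power moments of a set of radii squeezed between `(0, ε - bε³/2 - Cε⁴]` and
`(0, ε - bε³/2 + Cε⁴]`. -/
lemma abs_setIntegral_pow_sub_le (p : ℕ) {b B C ε : ℝ} (hb : 0 ≤ b) (hbB : b ≤ B) (hC : 0 ≤ C)
    (hε : 0 < ε) (hε1 : ε ≤ 1) (hsmall : (B / 2 + C) * ε ^ 2 ≤ 1) {I : Set ℝ}
    (hlo : Ioc 0 (ε - b * ε ^ 3 / 2 - C * ε ^ 4) ⊆ I)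
    (hhi : I ⊆ Ioc 0 (ε - b * ε ^ 3 / 2 + C * ε ^ 4)) :
    |(∫ t in I, t ^ p) - (ε ^ (p + 1) / (p + 1) - b * ε ^ (p + 3) / 2)| ≤
      (C + 3 ^ (p + 1) * (B / 2 + C) ^ 2) * ε ^ (p + 4) := by
  -- moments of `(0, ε (1 - u)]` up to second order in `u = b ε² / 2 - c ε³`
  have key : ∀ c, |c| ≤ C → 0 ≤ ε - b * ε ^ 3 / 2 + c * ε ^ 4 ∧
      |(ε - b * ε ^ 3 / 2 + c * ε ^ 4) ^ (p + 1) / (p + 1) -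
        (ε ^ (p + 1) / (p + 1) - b * ε ^ (p + 3) / 2 + c * ε ^ (p + 4))| ≤
      3 ^ (p + 1) * (B / 2 + C) ^ 2 * ε ^ (p + 4) := by
    intro c hc
    set u := b * ε ^ 2 / 2 - c * ε ^ 3 with hu
    have hu1 : |u| ≤ (B / 2 + C) * ε ^ 2 := by
      rw [hu]
      calc _ ≤ |b * ε ^ 2 / 2| + |c * ε ^ 3| := abs_sub _ _
        _ = b * ε ^ 2 / 2 + |c| * (ε * ε ^ 2) := by
            rw [abs_of_nonneg (by positivity), abs_mul, abs_of_nonneg (by positivity : 0 ≤ ε ^ 3)]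
            ring
        _ ≤ B * ε ^ 2 / 2 + C * (1 * ε ^ 2) := by gcongr
        _ = _ := by ring
    have hu2 : |u| ≤ 1 := hu1.trans hsmall
    have e1 : ε - b * ε ^ 3 / 2 + c * ε ^ 4 = ε * (1 - u) := by rw [hu]; ring
    refine ⟨by rw [e1]; exact mul_nonneg hε.le (by linarith [(abs_le.1 hu2).2]), ?_⟩
    have e2 : (ε - b * ε ^ 3 / 2 + c * ε ^ 4) ^ (p + 1) / (p + 1) -
        (ε ^ (p + 1) / (p + 1) - b * ε ^ (p + 3) / 2 + c * ε ^ (p + 4)) =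
        ε ^ (p + 1) / (p + 1) * ((1 - u) ^ (p + 1) - 1 + ((p + 1 : ℕ) : ℝ) * u) := by
      rw [e1, mul_pow, hu]
      have : (p : ℝ) + 1 ≠ 0 := by positivity
      push_cast
      field_simp
      ring
    rw [e2, abs_mul, abs_of_nonneg (by positivity)]
    have h3 := abs_one_sub_pow_sub_le (p + 1) hu2
    have h4 : u ^ 2 ≤ ((B / 2 + C) * ε ^ 2) ^ 2 := by
      rw [← sq_abs]; exact pow_le_pow_left₀ (abs_nonneg _) hu1 2
    have h5 : ε ^ (p + 1) / ((p : ℝ) + 1) ≤ ε ^ (p + 1) :=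
      div_le_self (by positivity) (by linarith [Nat.cast_nonneg (α := ℝ) p])
    calc _ ≤ ε ^ (p + 1) * (3 ^ (p + 1) * ((B / 2 + C) * ε ^ 2) ^ 2) := by
          gcongr
          exact h3.trans (by gcongr)
      _ = 3 ^ (p + 1) * (B / 2 + C) ^ 2 * (ε ^ (p + 4) * ε) := by ring
      _ ≤ 3 ^ (p + 1) * (B / 2 + C) ^ 2 * (ε ^ (p + 4) * 1) := by gcongr
      _ = _ := by ring
  obtain ⟨hp, kp⟩ := key C (abs_of_nonneg hC).le
  obtain ⟨hm, km⟩ := key (-C) (by rw [abs_neg, abs_of_nonneg hC])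
  rw [neg_mul, ← sub_eq_add_neg] at hm
  have hpow :
      0 ≤ᵐ[volume.restrict (Ioc 0 (ε - b * ε ^ 3 / 2 + C * ε ^ 4))] fun t : ℝ => t ^ p :=
    (ae_restrict_mem measurableSet_Ioc).mono fun t ht => pow_nonneg ht.1.le p
  have hup : ∫ t in I, t ^ p ≤ _ :=
    setIntegral_mono_set (integrableOn_Ioc_pow p _) hpow hhi.eventuallyLE
  have hnn : 0 ≤ᵐ[volume.restrict I] fun t : ℝ => t ^ p :=
    ae_restrict_of_ae_restrict_of_subset hhi hpow
  have hdn : _ ≤ ∫ t in I, t ^ p :=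
    setIntegral_mono_set ((integrableOn_Ioc_pow p _).mono_set hhi) hnn hlo.eventuallyLE
  rw [setIntegral_Ioc_pow p hp] at hup
  rw [setIntegral_Ioc_pow p hm] at hdn
  rw [neg_mul, ← sub_eq_add_neg] at km
  rw [abs_le] at kp km ⊢
  constructor <;> linarith [kp.1, kp.2, km.1, km.2]

/-- Along a ray on which the height is `q r² + O(r³)`, the set of radii of points of the graph at
distance at most `ε` from the origin is `(0, ε - q²ε³/2 + O(ε⁴)]`. -/
lemma exists_radii_sandwich {Q K : ℝ} (hQ : 0 ≤ Q) (hK : 0 ≤ K) :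
    ∃ C ≥ 0, ∃ ε₀ > 0, ∀ ε, 0 < ε → ε < ε₀ → ∀ (q : ℝ) (G : ℝ → ℝ), |q| ≤ Q →
      (∀ r, 0 < r → r ≤ 1 → |G r - q * r ^ 2| ≤ K * r ^ 3) →
      Ioc 0 (ε - q ^ 2 * ε ^ 3 / 2 - C * ε ^ 4) ⊆ {r | 0 < r ∧ r ^ 2 + G r ^ 2 ≤ ε ^ 2} ∧
      {r | 0 < r ∧ r ^ 2 + G r ^ 2 ≤ ε ^ 2} ⊆ Ioc 0 (ε - q ^ 2 * ε ^ 3 / 2 + C * ε ^ 4) := by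
  -- `B` bounds `q²`, and `M r⁵` is the error of `G² ≈ q² r⁴`
  set B := Q ^ 2 with hB
  set M := K * (2 * Q + K) with hM
  have hB0 : 0 ≤ B := by positivity
  have hM0 : 0 ≤ M := by positivity
  -- `C` absorbs `M` and the error `2 B² ε⁵` of replacing `r⁴` by `ε⁴`, with a margin of `1`
  set C := 2 * B ^ 2 + M + 1 with hC
  have hC1 : 1 ≤ C := by nlinarith [sq_nonneg B]
  refine ⟨C, by linarith, min 1 (1 / ((B / 2 + C) ^ 2 + B + 1)), by positivity, ?_⟩
  intro ε hε hε₀ q G hq hG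
  have hε1 : ε ≤ 1 := (hε₀.trans_le (min_le_left _ _)).le
  have hε2 : ε * ((B / 2 + C) ^ 2 + B + 1) ≤ 1 := by
    have := (hε₀.trans_le (min_le_right _ _)).le
    rwa [le_div_iff₀ (by positivity)] at this
  have hsq : (B / 2 + C) ^ 2 * ε ≤ 1 := by nlinarith
  have hBε : B * ε ≤ 1 := by nlinarith [sq_nonneg (B / 2 + C)]
  have hBε2 : B * ε ^ 2 ≤ 1 := by nlinarith [mul_nonneg hB0 hε.le]
  have hqB : q ^ 2 ≤ B := by rw [hB, ← sq_abs]; exact pow_le_pow_left₀ (abs_nonneg _) hq 2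
  have hq0 : 0 ≤ q ^ 2 := sq_nonneg q
  have hG2 : ∀ r, 0 < r → r ≤ 1 → |G r ^ 2 - q ^ 2 * r ^ 4| ≤ M * r ^ 5 := by
    intro r hr hr1
    have h1 := hG r hr hr1
    have h2 : |G r + q * r ^ 2| ≤ (2 * Q + K) * r ^ 2 := by
      have e : G r + q * r ^ 2 = (G r - q * r ^ 2) + 2 * (q * r ^ 2) := by ring
      rw [e]
      refine (abs_add_le _ _).trans ?_
      rw [abs_mul 2, abs_mul q, abs_two, abs_of_nonneg (sq_nonneg r)]
      have h3 : K * r ^ 3 ≤ K * r ^ 2 := by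
        gcongr 1
        exact pow_le_pow_of_le_one hr.le hr1 (by norm_num)
      have h4 : |q| * r ^ 2 ≤ Q * r ^ 2 := by gcongr
      linarith
    have e : G r ^ 2 - q ^ 2 * r ^ 4 = (G r - q * r ^ 2) * (G r + q * r ^ 2) := by ring
    rw [e, abs_mul]
    calc _ ≤ (K * r ^ 3) * ((2 * Q + K) * r ^ 2) := by gcongr
      _ = _ := by rw [hM]; ring
  have hε5 : 0 < ε ^ 5 := by positivity
  constructor
  · rintro r ⟨hr, hr2⟩
    have hC4 : 0 ≤ C * ε ^ 4 := by positivity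
    have hb3 : 0 ≤ q ^ 2 * ε ^ 3 / 2 := by positivity
    have hrε : r ≤ ε := by linarith
    refine ⟨hr, ?_⟩
    have h1 := (abs_le.1 (hG2 r hr (hrε.trans hε1))).2
    have h2 : r ^ 4 ≤ ε ^ 4 := pow_le_pow_left₀ hr.le hrε 4
    have h3 : r ^ 5 ≤ ε ^ 5 := pow_le_pow_left₀ hr.le hrε 5
    have h4 : r ^ 2 ≤ (ε - q ^ 2 * ε ^ 3 / 2 - C * ε ^ 4) ^ 2 := pow_le_pow_left₀ hr.le hr2 2
    have h5 : q ^ 2 * ε ^ 3 / 2 + C * ε ^ 4 ≤ (B / 2 + C) * ε ^ 3 := by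
      have : C * ε ^ 4 ≤ C * ε ^ 3 := by
        gcongr 1
        exact pow_le_pow_of_le_one hε.le hε1 (by norm_num)
      have : q ^ 2 * ε ^ 3 ≤ B * ε ^ 3 := by gcongr
      linarith
    have h6 : (q ^ 2 * ε ^ 3 / 2 + C * ε ^ 4) ^ 2 ≤ ε ^ 5 := by
      calc _ ≤ ((B / 2 + C) * ε ^ 3) ^ 2 := pow_le_pow_left₀ (by positivity) h5 2
        _ = (B / 2 + C) ^ 2 * ε * ε ^ 5 := by ring
        _ ≤ 1 * ε ^ 5 := by gcongr
        _ = _ := one_mul _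
    have h7 : (ε - q ^ 2 * ε ^ 3 / 2 - C * ε ^ 4) ^ 2 =
        ε ^ 2 - q ^ 2 * ε ^ 4 - 2 * C * ε ^ 5 + (q ^ 2 * ε ^ 3 / 2 + C * ε ^ 4) ^ 2 := by ring
    have h8 : q ^ 2 * r ^ 4 ≤ q ^ 2 * ε ^ 4 := by gcongr
    have h9 : M * r ^ 5 ≤ M * ε ^ 5 := by gcongr
    have h10 : M * ε ^ 5 + ε ^ 5 ≤ 2 * C * ε ^ 5 := by
      have : 0 ≤ B ^ 2 * ε ^ 5 := by positivity
      have : 0 ≤ M * ε ^ 5 := by positivity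
      rw [hC]; linarith
    linarith
  · -- a radius beyond the upper end would have `r² + G r² > ε²`
    rintro r ⟨hr, hr2⟩
    refine ⟨hr, ?_⟩
    by_contra! hcon
    have hrε : r ≤ ε := by
      refine abs_le_of_sq_le_sq' ?_ hε.le |>.2
      linarith [sq_nonneg (G r)]
    have h1 := (abs_le.1 (hG2 r hr (hrε.trans hε1))).1
    have h3 : M * r ^ 5 ≤ M * ε ^ 5 := by gcongr
    have hb3 : q ^ 2 * ε ^ 3 ≤ B * ε ^ 3 := by gcongr
    have hC4 : 0 ≤ C * ε ^ 4 := by positivity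
    have h4 : ε * (1 - B * ε ^ 2 / 2) ≤ r := by linarith
    have h5 : ε ^ 4 * (1 - 2 * B * ε ^ 2) ≤ r ^ 4 := by
      have := one_add_mul_le_pow (a := -(B * ε ^ 2 / 2)) (by linarith) 4
      calc _ ≤ ε ^ 4 * (1 + -(B * ε ^ 2 / 2)) ^ 4 := by
            gcongr
            push_cast at this
            linarith
        _ = (ε * (1 - B * ε ^ 2 / 2)) ^ 4 := by ring
        _ ≤ _ := pow_le_pow_left₀ (mul_nonneg hε.le (by linarith)) h4 4
    have h6 : q ^ 2 * ε ^ 4 - 2 * B ^ 2 * ε ^ 5 ≤ q ^ 2 * r ^ 4 := by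
      have h61 : q ^ 2 * (ε ^ 4 * (1 - 2 * B * ε ^ 2)) ≤ q ^ 2 * r ^ 4 := by gcongr
      have h62 : q ^ 2 * (B * (ε ^ 5 * ε)) ≤ B * (B * (ε ^ 5 * 1)) := by gcongr
      have : q ^ 2 * (ε ^ 4 * (1 - 2 * B * ε ^ 2)) =
        q ^ 2 * ε ^ 4 - 2 * (q ^ 2 * (B * (ε ^ 5 * ε))) := by ring
      linarith
    have hpos : 0 < ε - q ^ 2 * ε ^ 3 / 2 := by
      have : B * ε ^ 3 = (B * ε ^ 2) * ε := by ring
      nlinarith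
    have h7 : (ε - q ^ 2 * ε ^ 3 / 2 + C * ε ^ 4) ^ 2 < r ^ 2 :=
      pow_lt_pow_left₀ hcon (by linarith) (by norm_num)
    have h8 : ε ^ 2 - q ^ 2 * ε ^ 4 + C * ε ^ 5 ≤ (ε - q ^ 2 * ε ^ 3 / 2 + C * ε ^ 4) ^ 2 := by
      have e : (ε - q ^ 2 * ε ^ 3 / 2 + C * ε ^ 4) ^ 2 = ε ^ 2 - q ^ 2 * ε ^ 4 +
          (q ^ 2 * ε ^ 3 / 2) ^ 2 + 2 * C * ε ^ 5 - q ^ 2 * ε ^ 2 * (C * ε ^ 5) +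
            (C * ε ^ 4) ^ 2 := by ring
      have h81 : q ^ 2 * ε ^ 2 * (C * ε ^ 5) ≤ 1 * (C * ε ^ 5) := by
        gcongr
        exact (mul_le_mul_of_nonneg_right hqB (sq_nonneg ε)).trans hBε2
      have h82 : 0 ≤ (q ^ 2 * ε ^ 3 / 2) ^ 2 := sq_nonneg _
      have h83 : 0 ≤ (C * ε ^ 4) ^ 2 := sq_nonneg _
      linarith
    have h9 : C * ε ^ 5 = 2 * B ^ 2 * ε ^ 5 + M * ε ^ 5 + ε ^ 5 := by rw [hC]; ring
    linarith

end Radial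

/-! ### Second order expansion of integrals over a small patch of a graph -/

section Expansion

open Set Metric Module Filter

/-- The moments of a set of radii as in `exists_radii_sandwich` (with `b = q²`), weighted by a
density `1 + a t² + O(t³)`. -/
lemma exists_abs_setIntegral_pow_mul_sub_le (p : ℕ) {A B C K : ℝ} (hB : 0 ≤ B) (hC : 0 ≤ C)
    (hK : 0 ≤ K) :
    ∃ C' ≥ 0, ∀ ε, 0 < ε → ε ≤ 1 → (B / 2 + C) * ε ^ 2 ≤ 1 → ∀ (a b : ℝ) (J : ℝ → ℝ) (I : Set ℝ),
      |a| ≤ A → 0 ≤ b → b ≤ B → Continuous J → MeasurableSet I →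
      (∀ t, 0 < t → t ≤ 1 → |J t - 1 - a * t ^ 2| ≤ K * t ^ 3) → I ⊆ Ioc 0 ε →
      Ioc 0 (ε - b * ε ^ 3 / 2 - C * ε ^ 4) ⊆ I →
      I ⊆ Ioc 0 (ε - b * ε ^ 3 / 2 + C * ε ^ 4) →
      |(∫ t in I, t ^ p * J t) -
        (ε ^ (p + 1) / (p + 1) + ε ^ (p + 3) * (a / (p + 3) - b / 2))| ≤ C' * ε ^ (p + 4) := by
  set D : ℕ → ℝ := fun q => C + 3 ^ (q + 1) * (B / 2 + C) ^ 2 with hD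
  have hD0 : ∀ q, 0 ≤ D q := fun q => by simp only [hD]; positivity
  refine ⟨max (D p + A * (B / 2 + D (p + 2)) + K) 0, le_max_right _ _, ?_⟩
  intro ε hε hε1 hsmall a b J I ha hb hbB hJ hI hJa hIε hlo hhi
  have hA : 0 ≤ A := (abs_nonneg a).trans ha
  refine le_trans ?_ (mul_le_mul_of_nonneg_right (le_max_left _ _) (by positivity))
  have k1 := abs_setIntegral_pow_sub_le p hb hbB hC hε hε1 hsmall hlo hhi
  have k2 := abs_setIntegral_pow_sub_le (p + 2) hb hbB hC hε hε1 hsmall hlo hhi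
  have hvol : volume.real I ≤ ε := by
    have := measureReal_mono hIε (μ := (volume : Measure ℝ)) (by simp)
    simpa [hε.le] using this
  have hfin : volume I < ⊤ := (measure_mono hIε).trans_lt (by simp)
  have k3 : |∫ t in I, t ^ p * (J t - 1 - a * t ^ 2)| ≤ K * ε ^ (p + 4) := by
    have := norm_setIntegral_le_of_norm_le_const (C := K * ε ^ (p + 3)) (μ := (volume : Measure ℝ))
      hfin (f := fun t => t ^ p * (J t - 1 - a * t ^ 2)) (fun t ht => by
        obtain ⟨ht0, htε⟩ := hIε ht
        rw [norm_mul, Real.norm_eq_abs, Real.norm_eq_abs, abs_of_nonneg (by positivity)]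
        calc _ ≤ t ^ p * (K * t ^ 3) := by gcongr; exact hJa t ht0 (htε.trans hε1)
          _ = K * t ^ (p + 3) := by ring
          _ ≤ _ := by gcongr)
    rw [← Real.norm_eq_abs]
    refine this.trans ?_
    calc _ ≤ K * ε ^ (p + 3) * ε := by gcongr
      _ = _ := by ring
  have hint : ∀ f : ℝ → ℝ, Continuous f → IntegrableOn f I := fun f hf =>
    (hf.integrableOn_Icc (a := 0) (b := ε)).mono_set (hIε.trans Ioc_subset_Icc_self)
  -- the leading terms of the density give the moments of order `p` and `p + 2`
  have hsplit : ∫ t in I, t ^ p * J t = (∫ t in I, t ^ p) + a * (∫ t in I, t ^ (p + 2)) +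
      ∫ t in I, t ^ p * (J t - 1 - a * t ^ 2) := by
    rw [← integral_const_mul, ← integral_add (hint _ (by fun_prop)) (hint _ (by fun_prop)),
      ← integral_add (hint _ (by fun_prop)) (hint _ (by fun_prop))]
    congr 1
    funext t
    ring
  set I₂ := ∫ t in I, t ^ (p + 2)
  have k4 : |a * I₂ - a * (ε ^ (p + 3) / (p + 3))| ≤ A * (B / 2 + D (p + 2)) * ε ^ (p + 4) := by
    rw [← mul_sub, abs_mul, mul_assoc]
    gcongr
    have e : I₂ - ε ^ (p + 3) / (p + 3) = (I₂ - (ε ^ (p + 2 + 1) / ((p + 2 : ℕ) + 1) -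
        b * ε ^ (p + 2 + 3) / 2)) - b * ε ^ (p + 5) / 2 := by push_cast; ring
    rw [e]
    refine (abs_sub _ _).trans ?_
    rw [abs_of_nonneg (by positivity : 0 ≤ b * ε ^ (p + 5) / 2)]
    have h1 : ε ^ (p + 5) ≤ ε ^ (p + 4) := pow_le_pow_of_le_one hε.le hε1 (by omega)
    have h2 : ε ^ (p + 2 + 4) ≤ ε ^ (p + 4) := pow_le_pow_of_le_one hε.le hε1 (by omega)
    have h3 : b * ε ^ (p + 5) ≤ B * ε ^ (p + 4) := by gcongr
    have h4 : D (p + 2) * ε ^ (p + 2 + 4) ≤ D (p + 2) * ε ^ (p + 4) :=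
      mul_le_mul_of_nonneg_left h2 (hD0 _)
    have h5 : |I₂ - (ε ^ (p + 2 + 1) / ((p + 2 : ℕ) + 1) - b * ε ^ (p + 2 + 3) / 2)| ≤
      D (p + 2) * ε ^ (p + 2 + 4) := k2
    linarith
  have k1' : |(∫ t in I, t ^ p) - (ε ^ (p + 1) / (p + 1) - b * ε ^ (p + 3) / 2)| ≤
    D p * ε ^ (p + 4) := k1
  rw [hsplit]
  have e : (∫ t in I, t ^ p) + a * I₂ + (∫ t in I, t ^ p * (J t - 1 - a * t ^ 2)) -
      (ε ^ (p + 1) / (p + 1) + ε ^ (p + 3) * (a / (p + 3) - b / 2)) =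
      ((∫ t in I, t ^ p) - (ε ^ (p + 1) / (p + 1) - b * ε ^ (p + 3) / 2)) +
      (a * I₂ - a * (ε ^ (p + 3) / (p + 3))) + ∫ t in I, t ^ p * (J t - 1 - a * t ^ 2) := by ring
  rw [e]
  refine (abs_add_three _ _ _).trans ?_
  linarith

variable {n : ℕ}

/-- The height `g` of a graph and its area density `J` agree near the origin with
`½ ∑ κ_i x_i²` and `1 + ½ ∑ κ_i² x_i²`, up to an error of third order. -/
structure IsGraphExpansion (κ : Fin n → ℝ) (g J : EuclideanSpace ℝ (Fin n) → ℝ) (K : ℝ) :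
    Prop where
  continuous_height : Continuous g
  continuous_density : Continuous J
  nonneg : 0 ≤ K
  height : ∀ x, ‖x‖ ≤ 1 → |g x - quad κ x| ≤ K * ‖x‖ ^ 3
  density : ∀ x, ‖x‖ ≤ 1 → |J x - 1 - quad (fun i => κ i ^ 2) x| ≤ K * ‖x‖ ^ 3

/-- The projection to the tangent space of the part of the graph of `g` within distance `ε` of
the origin. -/
def projectedPatch (g : EuclideanSpace ℝ (Fin n) → ℝ) (ε : ℝ) : Set (EuclideanSpace ℝ (Fin n)) :=
  {x | ‖x‖ ^ 2 + g x ^ 2 ≤ ε ^ 2}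

lemma norm_le_of_mem_projectedPatch {g : EuclideanSpace ℝ (Fin n) → ℝ} {ε : ℝ} (hε : 0 ≤ ε)
    {x : EuclideanSpace ℝ (Fin n)} (hx : x ∈ projectedPatch g ε) : ‖x‖ ≤ ε := by
  have hx' : ‖x‖ ^ 2 + g x ^ 2 ≤ ε ^ 2 := hx
  exact (abs_le_of_sq_le_sq' (by linarith [sq_nonneg (g x)]) hε).2

lemma isCompact_projectedPatch {g : EuclideanSpace ℝ (Fin n) → ℝ} (hg : Continuous g) {ε : ℝ}
    (hε : 0 ≤ ε) : IsCompact (projectedPatch g ε) := by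
  refine (isCompact_closedBall (0 : EuclideanSpace ℝ (Fin n)) ε).of_isClosed_subset ?_ ?_
  · exact isClosed_le (by fun_prop) continuous_const
  · intro x hx
    simpa using norm_le_of_mem_projectedPatch hε hx

variable [NeZero n]

/-- Second order expansion of the integral of a homogeneous function over a small patch of a
graph: in polar coordinates, the radial integral over each ray is expanded by means of
`exists_radii_sandwich` and `exists_abs_setIntegral_pow_mul_sub_le`. -/
theorem IsGraphExpansion.exists_abs_setIntegral_sub_le {κ : Fin n → ℝ}
    {g J : EuclideanSpace ℝ (Fin n) → ℝ} {K : ℝ} (h : IsGraphExpansion κ g J K)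
    {φ : EuclideanSpace ℝ (Fin n) → ℝ} {k : ℕ} (hφ : IsHomogeneous φ k) :
    ∃ C ≥ 0, ∃ ε₀ > 0, ∀ ε, 0 < ε → ε < ε₀ →
      |(∫ x in projectedPatch g ε, φ x * J x) -
        (ε ^ (n + k) * (sphereIntegral φ / (n + k)) + ε ^ (n + k + 2) *
          (sphereIntegral (fun x => φ x * quad (fun i => κ i ^ 2) x) / (n + k + 2) -
            sphereIntegral (fun x => φ x * quad κ x ^ 2) / 2))| ≤ C * ε ^ (n + k + 3) := by
  have hcq := continuous_quad κ
  have hcq2 := continuous_quad (fun i => κ i ^ 2)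
  have bound : ∀ f : EuclideanSpace ℝ (Fin n) → ℝ, Continuous f →
      ∃ C, 0 ≤ C ∧ ∀ θ : sphere (0 : EuclideanSpace ℝ (Fin n)) 1, |f θ| ≤ C := by
    intro f hf
    obtain ⟨C, hC⟩ :=
      (isCompact_sphere (0 : EuclideanSpace ℝ (Fin n)) 1).exists_bound_of_continuousOn
        hf.continuousOn
    exact ⟨max C 0, le_max_right _ _, fun θ => (hC θ θ.2).trans (le_max_left _ _)⟩
  obtain ⟨Q, hQ0, hQ⟩ := bound _ hcq
  obtain ⟨A, hA0, hA⟩ := bound _ hcq2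
  obtain ⟨P, hP0, hP⟩ := bound _ hφ.continuous
  obtain ⟨C, hC0, ε₁, hε₁, hsand⟩ := exists_radii_sandwich hQ0 h.nonneg
  have hn : 0 < n := Nat.pos_of_ne_zero (NeZero.ne n)
  obtain ⟨p, hp⟩ : ∃ p, n + k = p + 1 := ⟨n + k - 1, by omega⟩
  obtain ⟨C', hC'0, hrad⟩ := exists_abs_setIntegral_pow_mul_sub_le p (A := A) (B := Q ^ 2)
    (sq_nonneg Q) hC0 h.nonneg
  set σ := (volume : Measure (EuclideanSpace ℝ (Fin n))).toSphere with hσ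
  refine ⟨P * C' * σ.real univ, by positivity, min ε₁ (1 / (Q ^ 2 / 2 + C + 1)), by positivity, ?_⟩
  intro ε hε hε₀
  have hε2 : ε * (Q ^ 2 / 2 + C + 1) ≤ 1 := by
    have := (hε₀.trans_le (min_le_right _ _)).le
    rwa [le_div_iff₀ (by positivity)] at this
  have hQC : 0 ≤ Q ^ 2 / 2 + C := by positivity
  have hε1 : ε ≤ 1 := by nlinarith [mul_nonneg hε.le hQC]
  have hsmall : (Q ^ 2 / 2 + C) * ε ^ 2 ≤ 1 := by nlinarith [mul_nonneg hε.le hQC]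
  set Ω := projectedPatch g ε
  have hΩ : IsCompact Ω := isCompact_projectedPatch h.continuous_height hε.le
  have hint : Integrable (Ω.indicator fun x => φ x * J x) := by
    rw [integrable_indicator_iff hΩ.measurableSet]
    exact (hφ.continuous.mul h.continuous_density).continuousOn.integrableOn_compact hΩ
  obtain ⟨hI1, hI2⟩ := integral_eq_integral_sphere_integral_Ioi hint
  rw [← integral_indicator hΩ.measurableSet, hI2]
  -- the target, as an integral over the sphere
  have htarget : ε ^ (n + k) * (sphereIntegral φ / (n + k)) + ε ^ (n + k + 2) *
          (sphereIntegral (fun x => φ x * quad (fun i => κ i ^ 2) x) / (n + k + 2) -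
            sphereIntegral (fun x => φ x * quad κ x ^ 2) / 2) =
      ∫ θ : sphere (0 : EuclideanSpace ℝ (Fin n)) 1, φ θ * (ε ^ (p + 1) / (p + 1) + ε ^ (p + 3) *
        (quad (fun i => κ i ^ 2) θ / (p + 3) - quad κ θ ^ 2 / 2)) ∂σ := by
    have hpk : (n : ℝ) + k = p + 1 := by exact_mod_cast hp
    have e : ∀ θ : EuclideanSpace ℝ (Fin n), φ θ * (ε ^ (p + 1) / (p + 1) + ε ^ (p + 3) *
        (quad (fun i => κ i ^ 2) θ / (p + 3) - quad κ θ ^ 2 / 2)) =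
        1 * (ε ^ (p + 1) / (p + 1) * φ θ +
          ε ^ (p + 3) / (p + 3) * (φ θ * quad (fun i => κ i ^ 2) θ)) +
        (-(ε ^ (p + 3) / 2)) * (φ θ * quad κ θ ^ 2) := fun θ => by ring
    have hc := hφ.continuous
    have h1 := sphereIntegral_add_const_mul (f := φ)
      (g := fun θ => φ θ * quad (fun i => κ i ^ 2) θ) hc (by fun_prop)
      (ε ^ (p + 1) / (p + 1)) (ε ^ (p + 3) / (p + 3))
    have h2 := sphereIntegral_add_const_mul
      (f := fun θ => ε ^ (p + 1) / (p + 1) * φ θ +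
          ε ^ (p + 3) / (p + 3) * (φ θ * quad (fun i => κ i ^ 2) θ))
      (g := fun θ => φ θ * quad κ θ ^ 2) (by fun_prop) (by fun_prop) 1 (-(ε ^ (p + 3) / 2))
    have h3 : ∫ θ : sphere (0 : EuclideanSpace ℝ (Fin n)) 1,
        φ θ * (ε ^ (p + 1) / (p + 1) + ε ^ (p + 3) *
        (quad (fun i => κ i ^ 2) θ / (p + 3) - quad κ θ ^ 2 / 2)) ∂σ =
        sphereIntegral (fun θ => 1 * (ε ^ (p + 1) / (p + 1) * φ θ +
          ε ^ (p + 3) / (p + 3) * (φ θ * quad (fun i => κ i ^ 2) θ)) +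
        (-(ε ^ (p + 3) / 2)) * (φ θ * quad κ θ ^ 2)) := by
      simp only [← e]; rfl
    rw [h3, h2, h1, hpk, hp]
    ring
  have hcT : Continuous fun θ : EuclideanSpace ℝ (Fin n) =>
      φ θ * (ε ^ (p + 1) / (p + 1) + ε ^ (p + 3) *
        (quad (fun i => κ i ^ 2) θ / (p + 3) - quad κ θ ^ 2 / 2)) := by
    have hc := hφ.continuous
    fun_prop
  rw [htarget, ← integral_sub hI1 (integrable_sphere hcT), ← Real.norm_eq_abs]
  have hfinal : ∀ θ : sphere (0 : EuclideanSpace ℝ (Fin n)) 1,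
      ‖(∫ r in Ioi (0 : ℝ), r ^ (finrank ℝ (EuclideanSpace ℝ (Fin n)) - 1) *
          Ω.indicator (fun x => φ x * J x) (r • (θ : EuclideanSpace ℝ (Fin n)))) -
        φ θ * (ε ^ (p + 1) / (p + 1) + ε ^ (p + 3) *
        (quad (fun i => κ i ^ 2) θ / (p + 3) - quad κ θ ^ 2 / 2))‖ ≤ P * C' * ε ^ (n + k + 3) := by
    intro θ
    have hθ : ‖(θ : EuclideanSpace ℝ (Fin n))‖ = 1 := by simp
    have hnorm : ∀ r : ℝ, 0 < r → ‖r • (θ : EuclideanSpace ℝ (Fin n))‖ = r := fun r hr => by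
      rw [norm_smul, hθ, mul_one, Real.norm_of_nonneg hr.le]
    set I : Set ℝ := {r | 0 < r ∧ r ^ 2 + g (r • (θ : EuclideanSpace ℝ (Fin n))) ^ 2 ≤ ε ^ 2}
      with hIdef
    have hcray : Continuous fun r : ℝ => r • (θ : EuclideanSpace ℝ (Fin n)) := by fun_prop
    have hIm : MeasurableSet I :=
      measurableSet_Ioi.inter (isClosed_le ((continuous_pow 2).add
        ((h.continuous_height.comp hcray).pow 2)) continuous_const).measurableSet
    -- along the ray through `θ`, the integrand is `φ θ r ^ (n - 1 + k) J`
    have hinner : ∫ r in Ioi (0 : ℝ), r ^ (finrank ℝ (EuclideanSpace ℝ (Fin n)) - 1) *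
          Ω.indicator (fun x => φ x * J x) (r • (θ : EuclideanSpace ℝ (Fin n))) =
        φ θ * ∫ r in I, r ^ p * J (r • (θ : EuclideanSpace ℝ (Fin n))) := by
      rw [← integral_const_mul, ← integral_indicator measurableSet_Ioi,
        ← integral_indicator hIm]
      congr 1
      funext r
      by_cases hr : 0 < r
      · rw [indicator_of_mem (show r ∈ Ioi (0 : ℝ) from hr)]
        by_cases hrI : r ∈ I
        · have : r • (θ : EuclideanSpace ℝ (Fin n)) ∈ Ω := by
            change ‖_‖ ^ 2 + _ ≤ _
            rw [hnorm r hr]; exact hrI.2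
          rw [indicator_of_mem hrI, indicator_of_mem this, hφ.map_smul r _ hr,
            finrank_euclideanSpace_fin]
          have : p = (n - 1) + k := by omega
          rw [this, pow_add]; ring
        · have : r • (θ : EuclideanSpace ℝ (Fin n)) ∉ Ω := by
            intro hmem
            change ‖_‖ ^ 2 + _ ≤ _ at hmem
            rw [hnorm r hr] at hmem
            exact hrI ⟨hr, hmem⟩
          rw [indicator_of_notMem hrI, indicator_of_notMem this, mul_zero]
      · rw [indicator_of_notMem (show r ∉ Ioi (0 : ℝ) from hr),
          indicator_of_notMem (fun hI => hr hI.1)]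
    have hgθ : ∀ r, 0 < r → r ≤ 1 → |g (r • (θ : EuclideanSpace ℝ (Fin n))) -
        quad κ θ * r ^ 2| ≤ K * r ^ 3 := by
      intro r hr hr1
      have := h.height (r • (θ : EuclideanSpace ℝ (Fin n))) (by rw [hnorm r hr]; exact hr1)
      rwa [hnorm r hr, (isHomogeneous_quad κ).map_smul r _ hr, mul_comm (r ^ 2)] at this
    have hJθ : ∀ r, 0 < r → r ≤ 1 → |J (r • (θ : EuclideanSpace ℝ (Fin n))) - 1 -
        quad (fun i => κ i ^ 2) θ * r ^ 2| ≤ K * r ^ 3 := by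
      intro r hr hr1
      have := h.density (r • (θ : EuclideanSpace ℝ (Fin n))) (by rw [hnorm r hr]; exact hr1)
      rwa [hnorm r hr, (isHomogeneous_quad _).map_smul r _ hr, mul_comm (r ^ 2)] at this
    obtain ⟨hs1, hs2⟩ := hsand ε hε (hε₀.trans_le (min_le_left _ _)) (quad κ θ)
      (fun r => g (r • (θ : EuclideanSpace ℝ (Fin n)))) (hQ θ) hgθ
    have hIε : I ⊆ Ioc 0 ε := fun r hr => ⟨hr.1, (abs_le_of_sq_le_sq'
      (by have := hr.2; linarith [sq_nonneg (g (r • (θ : EuclideanSpace ℝ (Fin n))))]) hε.le).2⟩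
    have hq2 : quad κ (θ : EuclideanSpace ℝ (Fin n)) ^ 2 ≤ Q ^ 2 := by
      rw [← sq_abs]; exact pow_le_pow_left₀ (abs_nonneg _) (hQ θ) 2
    have := hrad ε hε hε1 hsmall (quad (fun i => κ i ^ 2) θ) (quad κ θ ^ 2)
      (fun r => J (r • (θ : EuclideanSpace ℝ (Fin n)))) I (hA θ) (sq_nonneg _) hq2
      (h.continuous_density.comp hcray) hIm hJθ hIε hs1 hs2
    rw [hinner, ← mul_sub, norm_mul, hp, mul_assoc]
    exact mul_le_mul (hP θ) this (abs_nonneg _) hP0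
  refine (norm_integral_le_of_norm_le_const (Eventually.of_forall hfinal)).trans (le_of_eq ?_)
  ring

end Expansion

/-! ### Normalized moments of a small patch of a graph -/

section NormalizedMoments

open Set Metric Filter Topology Asymptotics

lemma pow_isBigO_pow {a b : ℕ} (h : a ≤ b) :
    (fun ε : ℝ => ε ^ b) =O[𝓝[>] 0] fun ε => ε ^ a := by
  refine IsBigO.of_bound 1 ?_
  filter_upwards [Ioc_mem_nhdsGT (one_pos : (0 : ℝ) < 1)] with ε hε
  rw [one_mul, Real.norm_of_nonneg (pow_nonneg hε.1.le _),
    Real.norm_of_nonneg (pow_nonneg hε.1.le _)]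
  exact pow_le_pow_of_le_one hε.1.le hε.2 h

variable {n : ℕ} {κ : Fin n → ℝ} {g J : EuclideanSpace ℝ (Fin n) → ℝ} {K : ℝ}

/-- The integral of `f` over a small patch of the graph of `g`, `f` being given on the tangent
space, divided by the volume of the flat ball of the same radius. -/
noncomputable def patchMoment (g J f : EuclideanSpace ℝ (Fin n) → ℝ) (ε : ℝ) : ℝ :=
  (∫ x in projectedPatch g ε, f x * J x) / ballVolume n ε

lemma IsGraphExpansion.integrableOn (h : IsGraphExpansion κ g J K)
    {f : EuclideanSpace ℝ (Fin n) → ℝ} (hf : Continuous f) {ε : ℝ} (hε : 0 ≤ ε) :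
    IntegrableOn (fun x => f x * J x) (projectedPatch g ε) :=
  (hf.mul h.continuous_density).continuousOn.integrableOn_compact
    (isCompact_projectedPatch h.continuous_height hε)

lemma ballVolume_pos {ε : ℝ} (hε : 0 < ε) : 0 < ballVolume n ε := by
  rw [ballVolume_eq hε.le]
  exact mul_pos (pow_pos hε n) unitVolume_pos

/-- A function vanishing to order `m` at the origin has a moment of order `ε ^ m`. -/
lemma IsGraphExpansion.patchMoment_isBigO (h : IsGraphExpansion κ g J K)
    {f : EuclideanSpace ℝ (Fin n) → ℝ} {m : ℕ} {C : ℝ} (hC : 0 ≤ C)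
    (hf : ∀ x, ‖x‖ ≤ 1 → |f x| ≤ C * ‖x‖ ^ m) :
    patchMoment g J f =O[𝓝[>] 0] fun ε => ε ^ m := by
  obtain ⟨D, hD⟩ :=
    (isCompact_closedBall (0 : EuclideanSpace ℝ (Fin n)) 1).exists_bound_of_continuousOn
    h.continuous_density.continuousOn
  have hD0 : 0 ≤ D := (norm_nonneg _).trans (hD 0 (by simp))
  refine IsBigO.of_bound (C * D) ?_
  filter_upwards [Ioc_mem_nhdsGT (one_pos : (0 : ℝ) < 1)] with ε hε
  have hv := ballVolume_pos (n := n) hε.1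
  have hΩ := isCompact_projectedPatch h.continuous_height hε.1.le
  have h1 := norm_setIntegral_le_of_norm_le_const (μ := volume) (C := C * D * ε ^ m)
    (f := fun x => f x * J x) hΩ.measure_lt_top (fun x hx => by
      have hx1 := norm_le_of_mem_projectedPatch hε.1.le hx
      rw [norm_mul]
      calc _ ≤ (C * ‖x‖ ^ m) * D := by
            gcongr
            · exact hf x (hx1.trans hε.2)
            · exact hD x (by simpa using hx1.trans hε.2)
        _ ≤ (C * ε ^ m) * D := by gcongr
        _ = _ := by ring)
  have h2 : volume.real (projectedPatch g ε) ≤ ballVolume n ε :=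
    measureReal_mono (fun x hx => by simpa using norm_le_of_mem_projectedPatch hε.1.le hx)
      (measure_closedBall_lt_top.ne)
  rw [patchMoment, norm_div, Real.norm_of_nonneg hv.le, div_le_iff₀ hv,
    Real.norm_of_nonneg (pow_nonneg hε.1.le m)]
  have hε0 := hε.1
  exact h1.trans (by gcongr)

lemma IsGraphExpansion.patchMoment_add (h : IsGraphExpansion κ g J K)
    {f₁ f₂ : EuclideanSpace ℝ (Fin n) → ℝ} (h1 : Continuous f₁) (h2 : Continuous f₂) {ε : ℝ}
    (hε : 0 ≤ ε) :
    patchMoment g J (fun x => f₁ x + f₂ x) ε = patchMoment g J f₁ ε + patchMoment g J f₂ ε := by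
  unfold patchMoment
  simp only [add_mul]
  rw [integral_add (h.integrableOn h1 hε) (h.integrableOn h2 hε), add_div]

/-- The coefficient of `ε²` in the normalized area of the patch. -/
noncomputable def massCoeff (κ : Fin n → ℝ) : ℝ :=
  (2 * ∑ i, κ i ^ 2 - (∑ i, κ i) ^ 2) / (8 * (n + 2))

/-- The coefficient of `ε⁴` in the normalized second moment in the `i`-th principal direction. -/
noncomputable def tangentCoeff (κ : Fin n → ℝ) (i : Fin n) : ℝ :=
  (2 * ∑ i, κ i ^ 2 - (∑ i, κ i) ^ 2 - 4 * (∑ i, κ i) * κ i) / (8 * ((n + 2) * (n + 4)))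

/-- The coefficient of `ε²` in the normalized first moment in the normal direction. -/
noncomputable def heightCoeff (κ : Fin n → ℝ) : ℝ := (∑ i, κ i) / (2 * (n + 2))

/-- The coefficient of `ε⁴` in the normalized second moment in the normal direction. -/
noncomputable def heightSqCoeff (κ : Fin n → ℝ) : ℝ :=
  ((∑ i, κ i) ^ 2 / 4 + (∑ i, κ i ^ 2) / 2) / ((n + 2) * (n + 4))

lemma IsGraphExpansion.abs_mul_height_sub_le (h : IsGraphExpansion κ g J K)
    {f : EuclideanSpace ℝ (Fin n) → ℝ} {m : ℕ} {C : ℝ}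
    (hf : ∀ x, ‖x‖ ≤ 1 → |f x| ≤ C * ‖x‖ ^ m) (x : EuclideanSpace ℝ (Fin n)) (hx : ‖x‖ ≤ 1) :
    |f x * (g x - quad κ x)| ≤ (C * K) * ‖x‖ ^ (m + 3) := by
  rw [abs_mul]
  calc _ ≤ (C * ‖x‖ ^ m) * (K * ‖x‖ ^ 3) :=
        mul_le_mul (hf x hx) (h.height x hx) (abs_nonneg _) ((abs_nonneg _).trans (hf x hx))
    _ = _ := by ring

lemma abs_coord_le (i : Fin n) (x : EuclideanSpace ℝ (Fin n)) : |x i| ≤ 1 * ‖x‖ ^ 1 := by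
  rw [one_mul, pow_one]; exact PiLp.norm_apply_le x i

variable [NeZero n]

lemma IsGraphExpansion.patchMoment_homogeneous (h : IsGraphExpansion κ g J K)
    {φ : EuclideanSpace ℝ (Fin n) → ℝ} {k : ℕ} (hφ : IsHomogeneous φ k) :
    (fun ε => patchMoment g J φ ε -
        (ε ^ k * (sphereIntegral φ / (n + k)) + ε ^ (k + 2) *
          (sphereIntegral (fun x => φ x * quad (fun i => κ i ^ 2) x) / (n + k + 2) -
            sphereIntegral (fun x => φ x * quad κ x ^ 2) / 2)) / unitVolume n)
      =O[𝓝[>] 0] fun ε => ε ^ (k + 3) := by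
  obtain ⟨C, hC, ε₀, hε₀, hb⟩ := h.exists_abs_setIntegral_sub_le hφ
  refine IsBigO.of_bound (C / unitVolume n) ?_
  filter_upwards [Ioo_mem_nhdsGT hε₀] with ε hε
  have hv : 0 < unitVolume n := unitVolume_pos
  have hεn : 0 < ε ^ n := pow_pos hε.1 n
  have := hb ε hε.1 hε.2
  set I := ∫ x in projectedPatch g ε, φ x * J x with hI
  rw [patchMoment, ← hI, ballVolume_eq hε.1.le, Real.norm_of_nonneg (pow_nonneg hε.1.le _)]
  have e : ∀ a b : ℝ, I / (ε ^ n * unitVolume n) - (ε ^ k * a + ε ^ (k + 2) * b) / unitVolume n =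
      (I - (ε ^ (n + k) * a + ε ^ (n + k + 2) * b)) / (ε ^ n * unitVolume n) := by
    intro a b; field_simp; ring
  rw [e, norm_div, Real.norm_of_nonneg (by positivity : 0 ≤ ε ^ n * unitVolume n),
    div_le_iff₀ (by positivity), Real.norm_eq_abs]
  refine this.trans (le_of_eq ?_)
  field_simp
  ring

lemma IsGraphExpansion.patchMoment_homogeneous_leading (h : IsGraphExpansion κ g J K)
    {φ : EuclideanSpace ℝ (Fin n) → ℝ} {k : ℕ} (hφ : IsHomogeneous φ k) :
    (fun ε => patchMoment g J φ ε - ε ^ k * (sphereIntegral φ / (n + k) / unitVolume n))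
      =O[𝓝[>] 0] fun ε => ε ^ (k + 2) := by
  have h1 := h.patchMoment_homogeneous hφ
  set c := sphereIntegral (fun x => φ x * quad (fun i => κ i ^ 2) x) / (n + k + 2) -
            sphereIntegral (fun x => φ x * quad κ x ^ 2) / 2
  have h2 : (fun ε : ℝ => ε ^ (k + 3)) =O[𝓝[>] 0] fun ε => ε ^ (k + 2) :=
    pow_isBigO_pow (by omega)
  have h3 : (fun ε : ℝ => c / unitVolume n * ε ^ (k + 2)) =O[𝓝[>] 0] fun ε => ε ^ (k + 2) :=
    isBigO_const_mul_self _ _ _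
  refine ((h1.trans h2).add h3).congr_left fun ε => ?_
  ring

lemma IsGraphExpansion.mass_isBigO (h : IsGraphExpansion κ g J K) :
    (fun ε => patchMoment g J (fun _ => 1) ε - (1 + massCoeff κ * ε ^ 2))
      =O[𝓝[>] 0] fun ε => ε ^ 3 := by
  refine (h.patchMoment_homogeneous (isHomogeneous_const 1)).congr (fun ε => ?_) fun ε => by simp
  have hv : unitVolume n ≠ 0 := unitVolume_pos.ne'
  have hn : (n : ℝ) ≠ 0 := Nat.cast_ne_zero.2 (NeZero.ne n)
  have hn2 : (n : ℝ) + 2 ≠ 0 := by positivity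
  have e := sphereIntegral_quad (fun i => κ i ^ 2)
  simp only [one_mul]
  rw [sphereIntegral_const_one, show sphereIntegral (fun x => quad (fun i => κ i ^ 2) x) = _ from e,
    sphereIntegral_quad_sq, massCoeff]
  push_cast
  field_simp
  ring

/-- The first tangential moments vanish to second order, the sphere being symmetric. -/
lemma IsGraphExpansion.coord_isBigO (h : IsGraphExpansion κ g J K) (i : Fin n) :
    patchMoment g J (fun x => x i) =O[𝓝[>] 0] fun ε => ε ^ 3 := by
  refine (h.patchMoment_homogeneous_leading (isHomogeneous_coord i)).congr_left fun ε => ?_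
  rw [sphereIntegral_of_odd (isHomogeneous_coord i) fun x => by simp]
  simp

lemma IsGraphExpansion.coord_mul_coord_isBigO (h : IsGraphExpansion κ g J K) (i j : Fin n) :
    (fun ε => patchMoment g J (fun x => x i * x j) ε -
      if i = j then ε ^ 2 / (n + 2) + tangentCoeff κ i * ε ^ 4 else 0)
      =O[𝓝[>] 0] fun ε => ε ^ 5 := by
  refine (h.patchMoment_homogeneous
    ((isHomogeneous_coord i).mul (isHomogeneous_coord j))).congr_left fun ε => ?_
  have hv : unitVolume n ≠ 0 := unitVolume_pos.ne'
  have hn2 : (n : ℝ) + 2 ≠ 0 := by positivity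
  have hn4 : (n : ℝ) + 4 ≠ 0 := by positivity
  have e1 := sphereIntegral_coord_mul_coord_mul_quad (fun i => κ i ^ 2) i j
  have e2 := sphereIntegral_coord_mul_coord_mul_quad_sq κ i j
  simp only [← mul_assoc] at e1 e2
  rw [e1, e2, sphereIntegral_coord_mul_coord]
  split_ifs
  · rw [tangentCoeff]
    push_cast
    rw [show (n : ℝ) + 2 + 2 = n + 4 by ring]
    field_simp
    ring
  · simp

/-- The first moment of the height. Here and below, `g` is replaced by its homogeneous second order
part, at the cost of an error of higher order. -/
lemma IsGraphExpansion.height_isBigO (h : IsGraphExpansion κ g J K) :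
    (fun ε => patchMoment g J g ε - heightCoeff κ * ε ^ 2) =O[𝓝[>] 0] fun ε => ε ^ 3 := by
  have hg := h.continuous_height
  have hq := continuous_quad κ
  have h1 := h.patchMoment_isBigO (m := 3) h.nonneg h.height
  have h2 := (h.patchMoment_homogeneous_leading (isHomogeneous_quad κ)).trans
    (pow_isBigO_pow (show 3 ≤ 2 + 2 by norm_num))
  refine (h1.add h2).congr' ?_ EventuallyEq.rfl
  filter_upwards [self_mem_nhdsWithin] with ε hε
  have e := h.patchMoment_add (hg.sub hq) hq (le_of_lt hε)
  simp only [Pi.sub_apply, sub_add_cancel] at e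
  rw [show patchMoment g J g ε = patchMoment g J (fun x => g x) ε from rfl, e,
    sphereIntegral_quad, heightCoeff]
  have hv : unitVolume n ≠ 0 := unitVolume_pos.ne'
  have hn2 : (n : ℝ) + 2 ≠ 0 := by positivity
  push_cast
  have e2 : (∑ i, κ i) / 2 * unitVolume n / ((n : ℝ) + 2) / unitVolume n =
    (∑ i, κ i) / (2 * (n + 2)) := by field_simp
  rw [e2]
  simp only [show (fun x => g x - quad κ x) = g - quad κ from rfl]
  ring

lemma IsGraphExpansion.coord_mul_height_isBigO (h : IsGraphExpansion κ g J K) (i : Fin n) :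
    patchMoment g J (fun x => x i * g x) =O[𝓝[>] 0] fun ε => ε ^ 4 := by
  have hg := h.continuous_height
  have hq := continuous_quad κ
  have hhom : IsHomogeneous (fun x : EuclideanSpace ℝ (Fin n) => x i * quad κ x) (1 + 2) :=
    (isHomogeneous_coord i).mul (isHomogeneous_quad κ)
  have h1 := h.patchMoment_isBigO (m := 4) (mul_nonneg zero_le_one h.nonneg)
    (h.abs_mul_height_sub_le (f := fun x => x i) (m := 1) fun x _ => abs_coord_le i x)
  have h2 := (h.patchMoment_homogeneous_leading hhom).trans
    (pow_isBigO_pow (show 4 ≤ 1 + 2 + 2 by norm_num))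
  refine (h1.add h2).congr' ?_ EventuallyEq.rfl
  filter_upwards [self_mem_nhdsWithin] with ε hε
  have e := h.patchMoment_add (f₁ := fun x => x i * (g x - quad κ x))
    (f₂ := fun x => x i * quad κ x) (by fun_prop) (by fun_prop) (le_of_lt hε)
  simp only [← mul_add, sub_add_cancel] at e
  rw [e, sphereIntegral_of_odd hhom fun x => by simp [quad_neg]]
  ring

lemma IsGraphExpansion.height_sq_isBigO (h : IsGraphExpansion κ g J K) :
    (fun ε => patchMoment g J (fun x => g x * g x) ε - heightSqCoeff κ * ε ^ 4)
      =O[𝓝[>] 0] fun ε => ε ^ 5 := by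
  have hg := h.continuous_height
  have hq := continuous_quad κ
  obtain ⟨Q, hQ0, hQ⟩ := (isHomogeneous_quad κ).exists_abs_le
  have hsum : ∀ x, ‖x‖ ≤ 1 → |g x + quad κ x| ≤ (K + 2 * Q) * ‖x‖ ^ 2 := by
    intro x hx
    have e : g x + quad κ x = (g x - quad κ x) + 2 * quad κ x := by ring
    have h1 : |quad κ x| ≤ Q * ‖x‖ ^ 2 := by
      rcases eq_or_ne x 0 with rfl | hx0
      · simp [quad]
      · exact hQ x hx0
    rw [e]
    refine (abs_add_le _ _).trans ?_
    rw [abs_mul, abs_two]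
    have h2 : K * ‖x‖ ^ 3 ≤ K * ‖x‖ ^ 2 := by
      have := h.nonneg
      gcongr K * ?_
      exact pow_le_pow_of_le_one (norm_nonneg x) hx (by norm_num)
    linarith [h.height x hx]
  have h1 := h.patchMoment_isBigO (m := 5)
    (mul_nonneg (by linarith [h.nonneg] : 0 ≤ K + 2 * Q) h.nonneg)
    (h.abs_mul_height_sub_le (m := 2) hsum)
  have h2 := (h.patchMoment_homogeneous_leading ((isHomogeneous_quad κ).pow 2)).trans
    (pow_isBigO_pow (show 5 ≤ 2 * 2 + 2 by norm_num))
  refine (h1.add h2).congr' ?_ EventuallyEq.rfl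
  filter_upwards [self_mem_nhdsWithin] with ε hε
  have e := h.patchMoment_add (f₁ := fun x => (g x + quad κ x) * (g x - quad κ x))
    (f₂ := fun x => quad κ x ^ 2) (by fun_prop) (by fun_prop) (le_of_lt hε)
  have e' : ∀ x, (g x + quad κ x) * (g x - quad κ x) + quad κ x ^ 2 = g x * g x :=
    fun x => by ring
  simp only [e'] at e
  rw [e, sphereIntegral_quad_sq, heightSqCoeff]
  have hv : unitVolume n ≠ 0 := unitVolume_pos.ne'
  have hn2 : (n : ℝ) + 2 ≠ 0 := by positivity
  have hn4 : (n : ℝ) + 4 ≠ 0 := by positivity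
  push_cast
  field_simp
  ring

end NormalizedMoments

/-! ### Perturbation of eigenvalues -/

section Perturbation

open Filter Topology Asymptotics

/-- In an orthogonal matrix, the first `k + 1` rows cannot be supported on the first `k` columns:
some entry outside has modulus at least `1 / m`. -/
lemma exists_one_div_le_abs_entry {m : ℕ} {O : Fin m → Fin m → ℝ}
    (hrow : ∀ k, ∑ i, O k i ^ 2 = 1) (hcol : ∀ i, ∑ k, O k i ^ 2 = 1) (k : Fin m) :
    ∃ l ≤ k, ∃ i, k ≤ i ∧ 1 / (m : ℝ) ≤ |O l i| := by
  by_contra! hcon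
  have hm : 0 < (m : ℝ) := by exact_mod_cast k.pos
  have h1 : ∑ l ∈ Finset.Iic k, ∑ i, O l i ^ 2 = (k : ℝ) + 1 := by
    simp [hrow]
  have h2 : ∑ l ∈ Finset.Iic k, ∑ i ∈ Finset.Iio k, O l i ^ 2 ≤ (k : ℝ) := by
    rw [Finset.sum_comm]
    calc _ ≤ ∑ i ∈ Finset.Iio k, (1 : ℝ) := by
          refine Finset.sum_le_sum fun i _ => ?_
          rw [← hcol i]
          exact Finset.sum_le_sum_of_subset_of_nonneg (Finset.subset_univ _)
            fun _ _ _ => sq_nonneg _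
      _ = _ := by simp
  have h3 : ∑ l ∈ Finset.Iic k, ∑ i ∈ Finset.Ici k, O l i ^ 2 < 1 := by
    have hlt : ∀ l ∈ Finset.Iic k, ∑ i ∈ Finset.Ici k, O l i ^ 2 <
        ∑ i ∈ Finset.Ici k, (1 / (m : ℝ)) ^ 2 := by
      intro l hl
      refine Finset.sum_lt_sum_of_nonempty ⟨k, by simp⟩ fun i hi => ?_
      rw [← sq_abs (O l i)]
      exact pow_lt_pow_left₀ (hcon l (by simpa using hl) i (by simpa using hi))
        (abs_nonneg _) two_ne_zero
    calc _ < ∑ l ∈ Finset.Iic k, ∑ i ∈ Finset.Ici k, (1 / (m : ℝ)) ^ 2 :=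
          Finset.sum_lt_sum_of_nonempty ⟨k, by simp⟩ hlt
      _ ≤ ∑ l : Fin m, ∑ i : Fin m, (1 / (m : ℝ)) ^ 2 := by
          refine (Finset.sum_le_sum fun l _ => Finset.sum_le_sum_of_subset_of_nonneg
            (Finset.subset_univ _) fun _ _ _ => by positivity).trans ?_
          exact Finset.sum_le_sum_of_subset_of_nonneg (Finset.subset_univ _)
            fun _ _ _ => by positivity
      _ = 1 := by simp; field_simp
  have h4 : ∀ l, ∑ i, O l i ^ 2 =
      ∑ i ∈ Finset.Iio k, O l i ^ 2 + ∑ i ∈ Finset.Ici k, O l i ^ 2 := by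
    intro l
    rw [← Finset.sum_union]
    · congr 1
      ext i
      simp [lt_or_ge]
    · rw [Finset.disjoint_left]
      intro i hi
      simpa using hi
  simp only [h4, Finset.sum_add_distrib] at h1
  linarith

/-- The same statement with the order of rows and columns reversed. -/
lemma exists_one_div_le_abs_entry' {m : ℕ} {O : Fin m → Fin m → ℝ}
    (hrow : ∀ k, ∑ i, O k i ^ 2 = 1) (hcol : ∀ i, ∑ k, O k i ^ 2 = 1) (k : Fin m) :
    ∃ l, k ≤ l ∧ ∃ i ≤ k, 1 / (m : ℝ) ≤ |O l i| := by
  obtain ⟨i, hi, l, hl, h⟩ := exists_one_div_le_abs_entry (O := fun i k => O k i) hcol hrow k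
  exact ⟨l, hl, i, hi, h⟩

variable {ι : Type*} {l : Filter ι} {ε : ι → ℝ} {n : ℕ}

/-- Data for the perturbation argument, over an index set on which `ε → 0⁺`: symmetric matrices
`M` close to a diagonal one with entries `α ε² + t_i ε⁴` (`i < n`) and `τ ε⁴`, the matrix `O` of
an orthonormal eigenbasis of `M` (one eigenvector in each row), and its eigenvalues `lam`. -/
structure IsPerturbedEVD (l : Filter ι) (ε : ι → ℝ) (α τ : ℝ) (t : Fin n → ℝ)
    (M O : ι → Fin (n + 1) → Fin (n + 1) → ℝ) (lam : ι → Fin (n + 1) → ℝ) : Prop where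
  tendsto : Tendsto ε l (𝓝[>] 0)
  pos : 0 < α
  tangent : ∀ i j : Fin n, (fun x => M x i.castSucc j.castSucc -
    if i = j then α * ε x ^ 2 + t i * ε x ^ 4 else 0) =O[l] fun x => ε x ^ 5
  mixed : ∀ i : Fin n, (fun x => M x i.castSucc (Fin.last n)) =O[l] fun x => ε x ^ 4
  symm : ∀ x i j, M x i j = M x j i
  normal : (fun x => M x (Fin.last n) (Fin.last n) - τ * ε x ^ 4) =O[l] fun x => ε x ^ 5
  row : ∀ x k, ∑ i, O x k i ^ 2 = 1
  col : ∀ x i, ∑ k, O x k i ^ 2 = 1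
  orth : ∀ x k k', k ≠ k' → ∑ i, O x k i * O x k' i = 0
  eigen : ∀ x k i, ∑ j, M x i j * O x k j = lam x k * O x k i
  antitone : ∀ x, Antitone (lam x)

namespace IsPerturbedEVD

variable {α τ : ℝ} {t : Fin n → ℝ} {M O : ι → Fin (n + 1) → Fin (n + 1) → ℝ}
  {lam : ι → Fin (n + 1) → ℝ}

section
variable (h : IsPerturbedEVD l ε α τ t M O lam)
include h

lemma pow_isBigO {a b : ℕ} (hab : a ≤ b) : (fun x => ε x ^ b) =O[l] fun x => ε x ^ a := by
  refine IsBigO.of_bound 1 ?_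
  filter_upwards [h.tendsto (Ioc_mem_nhdsGT one_pos)] with x hx
  have hx' : 0 < ε x ∧ ε x ≤ 1 := hx
  rw [one_mul, Real.norm_of_nonneg (pow_nonneg hx'.1.le _),
    Real.norm_of_nonneg (pow_nonneg hx'.1.le _)]
  exact pow_le_pow_of_le_one hx'.1.le hx'.2 hab

lemma abs_entry_le_one (x : ι) (k i : Fin (n + 1)) : |O x k i| ≤ 1 := by
  rw [← sq_le_one_iff_abs_le_one, ← h.row x k]
  exact Finset.single_le_sum (f := fun i => O x k i ^ 2) (fun _ _ => sq_nonneg _)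
    (Finset.mem_univ i)

lemma entry_isBigO_one (k i : Fin (n + 1)) : (fun x => O x k i) =O[l] fun _ => (1 : ℝ) :=
  IsBigO.of_bound 1 (Eventually.of_forall fun x => by simpa using h.abs_entry_le_one x k i)

lemma eventually_pos : ∀ᶠ x in l, 0 < ε x := h.tendsto self_mem_nhdsWithin

/-- The smallest eigenvalue is at most of order `ε⁴`. -/
lemma exists_last_le : ∃ C, ∀ᶠ x in l, lam x (Fin.last n) ≤ C * ε x ^ 4 := by
  have hM : (fun x => ∑ j, |M x (Fin.last n) j|) =O[l] fun x => ε x ^ 4 := by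
    refine IsBigO.fun_sum fun j _ => IsBigO.abs_left ?_
    refine Fin.lastCases ?_ (fun j => ?_) j
    · have h1 := h.normal.trans (h.pow_isBigO (show 4 ≤ 5 by norm_num))
      have h2 : (fun x => τ * ε x ^ 4) =O[l] fun x => ε x ^ 4 := isBigO_const_mul_self _ _ _
      exact (h1.add h2).congr_left fun x => by ring
    · exact (h.mixed j).congr_left fun x => h.symm x _ _
  obtain ⟨C, hC⟩ := hM.bound
  refine ⟨(n + 1 : ℕ) * C, ?_⟩
  filter_upwards [hC, h.eventually_pos] with x hx hpos
  obtain ⟨k, _, i, hi, hO⟩ := exists_one_div_le_abs_entry (h.row x) (h.col x) (Fin.last n)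
  obtain rfl : i = Fin.last n := le_antisymm (Fin.le_last i) hi
  have hn : (0 : ℝ) < (n + 1 : ℕ) := by positivity
  have h1 : |lam x k * O x k (Fin.last n)| ≤ C * ε x ^ 4 := by
    rw [← h.eigen]
    rw [Real.norm_of_nonneg (Finset.sum_nonneg fun _ _ => abs_nonneg _),
      Real.norm_of_nonneg (by positivity)] at hx
    refine le_trans ?_ hx
    refine (Finset.abs_sum_le_sum_abs _ _).trans (Finset.sum_le_sum fun j _ => ?_)
    rw [abs_mul]
    exact mul_le_of_le_one_right (abs_nonneg _) (h.abs_entry_le_one x k j)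
  rw [abs_mul] at h1
  have h2 : |lam x k| * (1 / (n + 1 : ℕ)) ≤ C * ε x ^ 4 :=
    (mul_le_mul_of_nonneg_left hO (abs_nonneg _)).trans h1
  rw [mul_one_div, div_le_iff₀ hn] at h2
  calc _ ≤ lam x k := h.antitone x (Fin.le_last k)
    _ ≤ |lam x k| := le_abs_self _
    _ ≤ _ := by linarith

/-- The tangential rows of `M`, less the leading part `α ε²` of the diagonal. -/
lemma tangent_row_isBigO (k : Fin (n + 1)) (i : Fin n) :
    (fun x => (lam x k - α * ε x ^ 2) * O x k i.castSucc) =O[l] fun x => ε x ^ 4 := by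
  have h1 : (fun x => ∑ j : Fin n, (M x i.castSucc j.castSucc -
      if i = j then α * ε x ^ 2 else 0) * O x k j.castSucc) =O[l] fun x => ε x ^ 4 := by
    refine IsBigO.fun_sum fun j _ => ?_
    have h2 : (fun x => M x i.castSucc j.castSucc - if i = j then α * ε x ^ 2 else 0)
        =O[l] fun x => ε x ^ 4 := by
      have h3 := (h.tangent i j).trans (h.pow_isBigO (show 4 ≤ 5 by norm_num))
      have h4 : (fun x => (if i = j then t i else 0) * ε x ^ 4) =O[l] fun x => ε x ^ 4 :=
        isBigO_const_mul_self _ _ _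
      exact (h3.add h4).congr_left fun x => by split_ifs <;> ring
    simpa using h2.mul (h.entry_isBigO_one k j.castSucc)
  have h5 := (h.mixed i).mul (h.entry_isBigO_one k (Fin.last n))
  simp only [mul_one] at h5
  refine (h1.add h5).congr_left fun x => ?_
  have := h.eigen x k i.castSucc
  rw [Fin.sum_univ_castSucc] at this
  rw [sub_mul, ← this]
  simp only [sub_mul, Finset.sum_sub_distrib, ite_mul, zero_mul, Finset.sum_ite_eq,
    Finset.mem_univ, if_true]
  ring

/-- The last eigenvector is normal up to order `ε²`, as its eigenvalue is far from `α ε²`. -/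
lemma last_tangent_isBigO (i : Fin n) :
    (fun x => O x (Fin.last n) i.castSucc) =O[l] fun x => ε x ^ 2 := by
  obtain ⟨C, hC⟩ := h.exists_last_le
  obtain ⟨D, hD⟩ := (h.tangent_row_isBigO (Fin.last n) i).bound
  refine IsBigO.of_bound (D / (α / 2)) ?_
  have hα := h.pos
  have hsm : ∀ᶠ x in l, C * ε x ^ 2 < α / 2 := by
    have h0 : Tendsto (fun r : ℝ => C * r ^ 2) (𝓝[>] 0) (𝓝 0) := by
      have : Tendsto (fun r : ℝ => C * r ^ 2) (𝓝 0) (𝓝 (C * 0 ^ 2)) :=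
        (Continuous.tendsto (by fun_prop) 0)
      simp only [ne_eq, OfNat.ofNat_ne_zero, not_false_eq_true, zero_pow, mul_zero] at this
      exact this.mono_left nhdsWithin_le_nhds
    exact (h0.comp h.tendsto).eventually (gt_mem_nhds (by positivity))
  filter_upwards [hC, hD, h.eventually_pos, hsm] with x h1 h2 hpos h3
  rw [norm_mul, Real.norm_of_nonneg (pow_nonneg hpos.le 4)] at h2
  have h4 : α / 2 * ε x ^ 2 ≤ ‖lam x (Fin.last n) - α * ε x ^ 2‖ := by
    rw [Real.norm_eq_abs, abs_sub_comm]
    refine le_trans ?_ (le_abs_self _)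
    have : C * ε x ^ 4 = (C * ε x ^ 2) * ε x ^ 2 := by ring
    have : (C * ε x ^ 2) * ε x ^ 2 ≤ α / 2 * ε x ^ 2 := by gcongr
    linarith
  have h5 : α / 2 * ε x ^ 2 * ‖O x (Fin.last n) i.castSucc‖ ≤ D * ε x ^ 4 :=
    (mul_le_mul_of_nonneg_right h4 (norm_nonneg _)).trans h2
  rw [Real.norm_of_nonneg (pow_nonneg hpos.le 2), div_mul_eq_mul_div, le_div_iff₀ (by positivity)]
  refine le_of_mul_le_mul_left ?_ (pow_pos hpos 2)
  calc _ = α / 2 * ε x ^ 2 * ‖O x (Fin.last n) i.castSucc‖ := by ring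
    _ ≤ _ := h5
    _ = _ := by ring

lemma tendsto_of_isBigO_pow {f : ι → ℝ} {k : ℕ} (hk : k ≠ 0)
    (hf : f =O[l] fun x => ε x ^ k) : Tendsto f l (𝓝 0) := by
  refine hf.trans_tendsto ?_
  have h0 : Tendsto (fun r : ℝ => r ^ k) (𝓝[>] 0) (𝓝 0) := by
    have : Tendsto (fun r : ℝ => r ^ k) (𝓝 0) (𝓝 (0 ^ k)) := (continuous_pow k).tendsto 0
    rw [zero_pow hk] at this
    exact this.mono_left nhdsWithin_le_nhds
  exact h0.comp h.tendsto

lemma eventually_half_le_abs_last : ∀ᶠ x in l, 1 / 2 ≤ |O x (Fin.last n) (Fin.last n)| := by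
  have h1 : Tendsto (fun x => ∑ i : Fin n, O x (Fin.last n) i.castSucc ^ 2) l (𝓝 0) := by
    have : Tendsto (fun x => ∑ i : Fin n, O x (Fin.last n) i.castSucc ^ 2) l
        (𝓝 (∑ i : Fin n, 0 ^ 2)) :=
      tendsto_finsetSum _ fun i _ =>
        (h.tendsto_of_isBigO_pow two_ne_zero (h.last_tangent_isBigO i)).pow 2
    simpa using this
  filter_upwards [h1.eventually (gt_mem_nhds (show (0 : ℝ) < 3 / 4 by norm_num))] with x hx
  have h2 := h.row x (Fin.last n)
  rw [Fin.sum_univ_castSucc] at h2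
  have h3 : (1 / 2 : ℝ) ^ 2 ≤ O x (Fin.last n) (Fin.last n) ^ 2 := by linarith
  have := sq_le_sq.1 h3
  rwa [abs_of_pos (by norm_num : (0 : ℝ) < 1 / 2)] at this

lemma div_last_isBigO {f : ι → ℝ} {k : ℕ}
    (hf : (fun x => f x * O x (Fin.last n) (Fin.last n)) =O[l] fun x => ε x ^ k) :
    f =O[l] fun x => ε x ^ k := by
  obtain ⟨C, hC⟩ := hf.bound
  refine IsBigO.of_bound (2 * C) ?_
  filter_upwards [hC, h.eventually_half_le_abs_last] with x h1 h2
  rw [norm_mul, Real.norm_eq_abs (O x _ _)] at h1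
  have := mul_le_mul_of_nonneg_left h2 (norm_nonneg (f x))
  linarith

/-- The smallest eigenvalue is the normal entry, up to an error of order `ε⁵`. -/
lemma last_isBigO : (fun x => lam x (Fin.last n) - τ * ε x ^ 4) =O[l] fun x => ε x ^ 5 := by
  refine h.div_last_isBigO ?_
  have h1 : (fun x => ∑ i : Fin n, M x (Fin.last n) i.castSucc * O x (Fin.last n) i.castSucc)
      =O[l] fun x => ε x ^ 5 := by
    refine IsBigO.fun_sum fun i _ => ?_
    have h2 := ((h.mixed i).congr_left fun x => h.symm x _ _).mul (h.last_tangent_isBigO i)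
    simp only [← pow_add] at h2
    exact h2.trans (h.pow_isBigO (by norm_num))
  have h3 := h.normal.mul (h.entry_isBigO_one (Fin.last n) (Fin.last n))
  simp only [mul_one] at h3
  refine (h1.add h3).congr_left fun x => ?_
  have := h.eigen x (Fin.last n) (Fin.last n)
  rw [Fin.sum_univ_castSucc] at this
  rw [sub_mul (lam x _), ← this]
  ring

/-- The other eigenvectors are orthogonal to the last one, hence almost tangential. -/
lemma tangent_last_isBigO (k : Fin n) :
    (fun x => O x k.castSucc (Fin.last n)) =O[l] fun x => ε x ^ 2 := by
  refine h.div_last_isBigO ?_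
  have h1 : (fun x => ∑ i : Fin n, O x (Fin.last n) i.castSucc * O x k.castSucc i.castSucc)
      =O[l] fun x => ε x ^ 2 := by
    refine IsBigO.fun_sum fun i _ => ?_
    simpa using (h.last_tangent_isBigO i).mul (h.entry_isBigO_one k.castSucc i.castSucc)
  refine h1.neg_left.congr_left fun x => ?_
  have := h.orth x k.castSucc (Fin.last n) (Fin.castSucc_lt_last k).ne
  rw [Fin.sum_univ_castSucc] at this
  simp only [mul_comm (O x (Fin.last n) _)]
  linarith

/-- The tangential rows of the eigenvalue equation: an eigenvector with a component in the `i`-th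
direction that is bounded below has an eigenvalue close to the `i`-th diagonal entry. -/
lemma sub_mul_tangent_isBigO (k i : Fin n) :
    (fun x => (lam x k.castSucc - (α * ε x ^ 2 + t i * ε x ^ 4)) * O x k.castSucc i.castSucc)
      =O[l] fun x => ε x ^ 5 := by
  have h1 : (fun x => ∑ j : Fin n, (M x i.castSucc j.castSucc -
      if i = j then α * ε x ^ 2 + t i * ε x ^ 4 else 0) * O x k.castSucc j.castSucc)
      =O[l] fun x => ε x ^ 5 := by
    refine IsBigO.fun_sum fun j _ => ?_
    simpa using (h.tangent i j).mul (h.entry_isBigO_one k.castSucc j.castSucc)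
  have h2 := (h.mixed i).mul (h.tangent_last_isBigO k)
  simp only [← pow_add] at h2
  refine (h1.add (h2.trans (h.pow_isBigO (show 5 ≤ 4 + 2 by norm_num)))).congr_left fun x => ?_
  have := h.eigen x k.castSucc i.castSucc
  rw [Fin.sum_univ_castSucc] at this
  rw [sub_mul, ← this]
  simp only [sub_mul, Finset.sum_sub_distrib, ite_mul, zero_mul, Finset.sum_ite_eq,
    Finset.mem_univ, if_true]
  ring

/-- The larger eigenvalues are the tangential diagonal entries in the same order, up to an error of
order `ε⁵`. For the upper bound, one of the first `k + 1` eigenvectors has a large component in a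
direction of index `i ≥ k`, so that `lam k ≤ lam k' ≈ α ε² + t i ε⁴ ≤ α ε² + t k ε⁴`; the lower
bound is symmetric. -/
lemma tangent_isBigO (ht : Antitone t) (k : Fin n) :
    (fun x => lam x k.castSucc - (α * ε x ^ 2 + t k * ε x ^ 4)) =O[l] fun x => ε x ^ 5 := by
  have hall : (fun x => ∑ k : Fin n, ∑ i : Fin n, |(lam x k.castSucc -
      (α * ε x ^ 2 + t i * ε x ^ 4)) * O x k.castSucc i.castSucc|) =O[l] fun x => ε x ^ 5 :=
    IsBigO.fun_sum fun k _ => IsBigO.fun_sum fun i _ => (h.sub_mul_tangent_isBigO k i).abs_left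
  obtain ⟨C, hC⟩ := hall.bound
  have hn : (0 : ℝ) < (n + 1 : ℕ) := by positivity
  have hsmall : ∀ᶠ x in l, ∀ i : Fin n, |O x (Fin.last n) i.castSucc| < 1 / (n + 1 : ℕ) ∧
      |O x i.castSucc (Fin.last n)| < 1 / (n + 1 : ℕ) := by
    rw [eventually_all]
    intro i
    have h1 := (h.tendsto_of_isBigO_pow two_ne_zero (h.last_tangent_isBigO i)).abs
    have h2 := (h.tendsto_of_isBigO_pow two_ne_zero (h.tangent_last_isBigO i)).abs
    rw [abs_zero] at h1 h2
    exact (h1.eventually (gt_mem_nhds (by positivity))).and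
      (h2.eventually (gt_mem_nhds (by positivity)))
  refine IsBigO.of_bound ((n + 1 : ℕ) * C) ?_
  filter_upwards [hC, hsmall, h.eventually_pos] with x hx hs hpos
  have hpair : ∀ k i : Fin n, 1 / ((n + 1 : ℕ) : ℝ) ≤ |O x k.castSucc i.castSucc| →
      |lam x k.castSucc - (α * ε x ^ 2 + t i * ε x ^ 4)| ≤ (n + 1 : ℕ) * C * ε x ^ 5 := by
    intro k i hki
    rw [Real.norm_of_nonneg (Finset.sum_nonneg fun _ _ => Finset.sum_nonneg fun _ _ =>
      abs_nonneg _), Real.norm_of_nonneg (pow_nonneg hpos.le 5)] at hx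
    have h1 := (Finset.single_le_sum (f := fun i : Fin n => |(lam x k.castSucc -
      (α * ε x ^ 2 + t i * ε x ^ 4)) * O x k.castSucc i.castSucc|)
      (fun _ _ => abs_nonneg _) (Finset.mem_univ i)).trans
      (Finset.single_le_sum (f := fun k : Fin n => ∑ i : Fin n, |(lam x k.castSucc -
      (α * ε x ^ 2 + t i * ε x ^ 4)) * O x k.castSucc i.castSucc|)
      (fun _ _ => Finset.sum_nonneg fun _ _ => abs_nonneg _) (Finset.mem_univ k))
    rw [abs_mul] at h1
    have h2 := (mul_le_mul_of_nonneg_left hki (abs_nonneg (lam x k.castSucc -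
      (α * ε x ^ 2 + t i * ε x ^ 4)))).trans (h1.trans hx)
    rw [mul_one_div, div_le_iff₀ hn] at h2
    linarith
  have h4 : 0 ≤ ε x ^ 4 := by positivity
  rw [Real.norm_eq_abs, Real.norm_of_nonneg (pow_nonneg hpos.le 5), abs_le]
  constructor
  · obtain ⟨k', hk', i', hi', hO⟩ :=
      exists_one_div_le_abs_entry' (h.row x) (h.col x) k.castSucc
    obtain ⟨i, rfl⟩ : ∃ i : Fin n, i.castSucc = i' :=
      ⟨_, Fin.castSucc_castPred i' (hi'.trans_lt (Fin.castSucc_lt_last k)).ne⟩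
    have hik : i ≤ k := Fin.castSucc_le_castSucc_iff.1 hi'
    induction k' using Fin.lastCases with
    | last => exact absurd hO (not_le.2 (hs i).1)
    | cast k' =>
      have h1 := (abs_le.1 (hpair k' i hO)).1
      have h2 := h.antitone x hk'
      have h3 := mul_le_mul_of_nonneg_right (ht hik) h4
      linarith
  · obtain ⟨k', hk', i', hi', hO⟩ :=
      exists_one_div_le_abs_entry (h.row x) (h.col x) k.castSucc
    obtain ⟨k', rfl⟩ : ∃ i : Fin n, i.castSucc = k' :=
      ⟨_, Fin.castSucc_castPred k' (hk'.trans_lt (Fin.castSucc_lt_last k)).ne⟩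
    induction i' using Fin.lastCases with
    | last => exact absurd hO (not_le.2 (hs k').2)
    | cast i =>
      have hik : k ≤ i := Fin.castSucc_le_castSucc_iff.1 hi'
      have h1 := (abs_le.1 (hpair k' i hO)).2
      have h2 := h.antitone x hk'
      have h3 := mul_le_mul_of_nonneg_right (ht hik) h4
      linarith

/-- An eigenvector belonging to a simple value of `t` has no other component in the limit. -/
lemma tendsto_entry_of_ne (ht : Antitone t) {k i : Fin n} (hki : t k ≠ t i) :
    Tendsto (fun x => O x k.castSucc i.castSucc) l (𝓝 0) := by
  refine h.tendsto_of_isBigO_pow one_ne_zero ?_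
  have h1 := (h.tangent_isBigO ht k).mul (h.entry_isBigO_one k.castSucc i.castSucc)
  simp only [mul_one] at h1
  have h2 := (h.sub_mul_tangent_isBigO k i).sub h1
  obtain ⟨C, hC⟩ := h2.bound
  refine IsBigO.of_bound (C / |t k - t i|) ?_
  have hpos' : 0 < |t k - t i| := abs_pos.2 (sub_ne_zero.2 hki)
  filter_upwards [hC, h.eventually_pos] with x hx hpos
  have e : (lam x k.castSucc - (α * ε x ^ 2 + t i * ε x ^ 4)) * O x k.castSucc i.castSucc -
      (lam x k.castSucc - (α * ε x ^ 2 + t k * ε x ^ 4)) * O x k.castSucc i.castSucc =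
      (t k - t i) * ε x ^ 4 * O x k.castSucc i.castSucc := by ring
  rw [e, norm_mul, norm_mul, Real.norm_of_nonneg (pow_nonneg hpos.le 4),
    Real.norm_of_nonneg (pow_nonneg hpos.le 5), Real.norm_eq_abs (t k - t i)] at hx
  rw [pow_one, Real.norm_of_nonneg hpos.le, div_mul_eq_mul_div, le_div_iff₀ hpos']
  refine le_of_mul_le_mul_left ?_ (pow_pos hpos 4)
  calc _ = |t k - t i| * ε x ^ 4 * ‖O x k.castSucc i.castSucc‖ := by ring
    _ ≤ _ := hx
    _ = _ := by ring

end

end IsPerturbedEVD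

end Perturbation

/-! ### A hypersurface as a graph over its tangent space -/

section LocalGraph

open Filter Topology Set Metric

variable {n : ℕ}

/-- The embedding of `ℝⁿ` as the span of the first `n` vectors of an orthonormal basis. -/
noncomputable def tangentMap
    (w : OrthonormalBasis (Fin (n + 1)) ℝ (EuclideanSpace ℝ (Fin (n + 1)))) :
    EuclideanSpace ℝ (Fin n) →L[ℝ] EuclideanSpace ℝ (Fin (n + 1)) :=
  ∑ i : Fin n, (EuclideanSpace.proj i : EuclideanSpace ℝ (Fin n) →L[ℝ] ℝ).smulRight (w i.castSucc)

/-- The coordinates with respect to the first `n` vectors of an orthonormal basis. -/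
noncomputable def tangentCoords
    (w : OrthonormalBasis (Fin (n + 1)) ℝ (EuclideanSpace ℝ (Fin (n + 1))))
    (x : EuclideanSpace ℝ (Fin (n + 1))) : EuclideanSpace ℝ (Fin n) :=
  WithLp.toLp 2 fun i => inner ℝ (w i.castSucc) x

/-- The graph of `g`, drawn at `p` over the span of the first `n` vectors of an orthonormal basis,
with heights measured along the last vector. -/
noncomputable def graphMap
    (w : OrthonormalBasis (Fin (n + 1)) ℝ (EuclideanSpace ℝ (Fin (n + 1))))
    (p : EuclideanSpace ℝ (Fin (n + 1))) (g : EuclideanSpace ℝ (Fin n) → ℝ)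
    (y : EuclideanSpace ℝ (Fin n)) : EuclideanSpace ℝ (Fin (n + 1)) :=
  p + tangentMap w y + g y • w (Fin.last n)

variable (w : OrthonormalBasis (Fin (n + 1)) ℝ (EuclideanSpace ℝ (Fin (n + 1))))

lemma tangentMap_apply (y : EuclideanSpace ℝ (Fin n)) :
    tangentMap w y = ∑ i : Fin n, y i • w i.castSucc := by
  simp [tangentMap]

lemma inner_castSucc_tangentMap (i : Fin n) (y : EuclideanSpace ℝ (Fin n)) :
    inner ℝ (w i.castSucc) (tangentMap w y) = y i := by
  rw [tangentMap_apply, inner_sum]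
  simp [inner_smul_right, orthonormal_iff_ite.1 w.orthonormal]

lemma inner_last_tangentMap (y : EuclideanSpace ℝ (Fin n)) :
    inner ℝ (w (Fin.last n)) (tangentMap w y) = 0 := by
  rw [tangentMap_apply, inner_sum]
  simp [inner_smul_right, orthonormal_iff_ite.1 w.orthonormal, (Fin.castSucc_lt_last _).ne']

lemma inner_tangentMap (y z : EuclideanSpace ℝ (Fin n)) :
    inner ℝ (tangentMap w y) (tangentMap w z) = inner ℝ y z := by
  rw [tangentMap_apply, sum_inner]
  rw [PiLp.inner_apply]
  refine Finset.sum_congr rfl fun i _ => ?_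
  rw [inner_smul_left, inner_castSucc_tangentMap]
  simp [mul_comm]

lemma continuous_tangentCoords : Continuous (tangentCoords w) := by
  unfold tangentCoords
  fun_prop

lemma tangentCoords_zero : tangentCoords w 0 = 0 := by
  ext i; simp [tangentCoords]

lemma tangentMap_add_smul_last (x : EuclideanSpace ℝ (Fin (n + 1))) :
    tangentMap w (tangentCoords w x) + inner ℝ (w (Fin.last n)) x • w (Fin.last n) = x := by
  conv_rhs => rw [← w.sum_repr' x, Fin.sum_univ_castSucc]
  rw [tangentMap_apply]
  rfl

lemma tangentCoords_tangentMap_add (y : EuclideanSpace ℝ (Fin n)) (s : ℝ) :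
    tangentCoords w (tangentMap w y + s • w (Fin.last n)) = y := by
  ext i
  simp [tangentCoords, inner_add_right, inner_castSucc_tangentMap, inner_smul_right,
    orthonormal_iff_ite.1 w.orthonormal]

lemma inner_last_tangentMap_add (y : EuclideanSpace ℝ (Fin n)) (s : ℝ) :
    inner ℝ (w (Fin.last n)) (tangentMap w y + s • w (Fin.last n)) = s := by
  simp [inner_add_right, inner_last_tangentMap, inner_smul_right]

lemma graphMap_sub (p : EuclideanSpace ℝ (Fin (n + 1))) (g : EuclideanSpace ℝ (Fin n) → ℝ)
    (y : EuclideanSpace ℝ (Fin n)) :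
    graphMap w p g y - p = tangentMap w y + g y • w (Fin.last n) := by
  simp [graphMap, add_assoc]

lemma norm_graphMap_sub_sq (p : EuclideanSpace ℝ (Fin (n + 1)))
    (g : EuclideanSpace ℝ (Fin n) → ℝ) (y : EuclideanSpace ℝ (Fin n)) :
    ‖graphMap w p g y - p‖ ^ 2 = ‖y‖ ^ 2 + g y ^ 2 := by
  rw [graphMap_sub, ← real_inner_self_eq_norm_sq, inner_add_left, inner_add_right,
    inner_add_right, inner_tangentMap, inner_smul_left, inner_smul_left, inner_smul_right,
    inner_smul_right, inner_last_tangentMap, real_inner_comm (w (Fin.last n)),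
    inner_last_tangentMap]
  simp
  ring

/-- A point whose height is the value of `g` at its tangential coordinates is a point of the
graph. -/
lemma graphMap_tangentCoords {p : EuclideanSpace ℝ (Fin (n + 1))}
    {g : EuclideanSpace ℝ (Fin n) → ℝ} {x : EuclideanSpace ℝ (Fin (n + 1))}
    (h : inner ℝ (w (Fin.last n)) (x - p) = g (tangentCoords w (x - p))) :
    graphMap w p g (tangentCoords w (x - p)) = x := by
  rw [graphMap, ← h, add_assoc, tangentMap_add_smul_last]
  abel

lemma hasFDerivAt_graphMap {p : EuclideanSpace ℝ (Fin (n + 1))}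
    {g : EuclideanSpace ℝ (Fin n) → ℝ} {y : EuclideanSpace ℝ (Fin n)}
    {g' : EuclideanSpace ℝ (Fin n) →L[ℝ] ℝ} (hg : HasFDerivAt g g' y) :
    HasFDerivAt (graphMap w p g) (tangentMap w + g'.smulRight (w (Fin.last n))) y :=
  ((tangentMap w).hasFDerivAt.const_add p).add (hg.smul_const _)

lemma hasStrictFDerivAt_graphMap {p : EuclideanSpace ℝ (Fin (n + 1))}
    {g : EuclideanSpace ℝ (Fin n) → ℝ} {y : EuclideanSpace ℝ (Fin n)}
    {g' : EuclideanSpace ℝ (Fin n) →L[ℝ] ℝ} (hg : HasStrictFDerivAt g g' y) :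
    HasStrictFDerivAt (graphMap w p g) (tangentMap w + g'.smulRight (w (Fin.last n))) y :=
  ((tangentMap w).hasStrictFDerivAt.const_add p).add (hg.smul_const _)

/-- A function of class `Cᵏ` near a point agrees there with a globally defined one. -/
lemma exists_contDiff_eventuallyEq {X : Type*} [NormedAddCommGroup X] [InnerProductSpace ℝ X]
    [FiniteDimensional ℝ X] {g₀ : X → ℝ} {a : X} {k : ℕ} (hg : ContDiffAt ℝ k g₀ a) :
    ∃ g : X → ℝ, ContDiff ℝ k g ∧ g =ᶠ[𝓝 a] g₀ := by
  have hev := hg.eventually (by simp)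
  obtain ⟨r, hr, hball⟩ := Metric.eventually_nhds_iff_ball.1 hev
  let χ : ContDiffBump a := ⟨r / 3, r / 2, by positivity, by linarith⟩
  refine ⟨fun y => χ y * g₀ y, ?_, ?_⟩
  · rw [contDiff_iff_contDiffAt]
    intro y
    by_cases hy : y ∈ ball a r
    · exact χ.contDiff.contDiffAt.mul (hball y hy)
    · have hy' : y ∈ (closedBall a (r / 2))ᶜ := by
        intro h
        exact hy (closedBall_subset_ball (by linarith) h)
      have : (fun y => χ y * g₀ y) =ᶠ[𝓝 y] fun _ => 0 := by
        filter_upwards [isClosed_closedBall.isOpen_compl.mem_nhds hy'] with z hz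
        rw [χ.zero_of_le_dist, zero_mul]
        have : ¬ dist z a ≤ r / 2 := hz
        exact (not_le.1 this).le
      exact contDiffAt_const.congr_of_eventuallyEq this
  · filter_upwards [χ.eventuallyEq_one] with y hy
    simp [hy]

/-- Near one of its points, a hypersurface is a graph over the tangent space, by the implicit
function theorem. -/
lemma IsSmoothHypersurface.exists_graph {S : Set (EuclideanSpace ℝ (Fin (n + 1)))}
    (hS : IsSmoothHypersurface S) {p : EuclideanSpace ℝ (Fin (n + 1))} (hp : p ∈ S)
    (htan : ∀ i : Fin n, w i.castSucc ∈ tangentVectors S p) :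
    ∃ g : EuclideanSpace ℝ (Fin n) → ℝ, ContDiff ℝ 3 g ∧ g 0 = 0 ∧ fderiv ℝ g 0 = 0 ∧
      (∀ᶠ x in 𝓝 p,
        (x ∈ S ↔ inner ℝ (w (Fin.last n)) (x - p) = g (tangentCoords w (x - p)))) := by
  obtain ⟨W, f, hW, hpW, hf, hf', hSW⟩ := hS p hp
  have hfp : ContDiffAt ℝ 3 f p := (hf.contDiffAt (hW.mem_nhds hpW)).of_le (by
    exact WithTop.coe_le_coe.2 (le_top : (3 : ℕ∞) ≤ ⊤))
  have hfd : HasFDerivAt f (fderiv ℝ f p) p := (hfp.differentiableAt (by norm_num)).hasFDerivAt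
  have hmem : ∀ x ∈ W, (x ∈ S ↔ f x = 0) := fun x hx => by
    have := Set.ext_iff.1 hSW x
    simpa [hx] using this
  have hfp0 : f p = 0 := (hmem p hpW).1 hp
  -- the derivative of the defining function vanishes on tangent vectors
  have hzero : ∀ i : Fin n, fderiv ℝ f p (w i.castSucc) = 0 := by
    intro i
    obtain ⟨γ, hγS, hγ0, hγ'⟩ := htan i
    have h1 : HasDerivAt (f ∘ γ) (fderiv ℝ f p (w i.castSucc)) 0 := by
      rw [← hγ0] at hfd ⊢
      exact hfd.comp_hasDerivAt 0 hγ'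
    have h2 : f ∘ γ =ᶠ[𝓝 0] fun _ => 0 := by
      have hWγ : ∀ᶠ t in 𝓝 (0 : ℝ), γ t ∈ W :=
        hγ'.continuousAt.eventually (by rw [hγ0]; exact hW.mem_nhds hpW)
      filter_upwards [hWγ] with t ht
      exact (hmem _ ht).1 (hγS t)
    exact h1.unique ((hasDerivAt_const (0 : ℝ) (0 : ℝ)).congr_of_eventuallyEq h2)
  have htm : ∀ y, fderiv ℝ f p (tangentMap w y) = 0 := fun y => by
    rw [tangentMap_apply, map_sum]
    simp [hzero]
  set c := fderiv ℝ f p (w (Fin.last n)) with hc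
  have hc0 : c ≠ 0 := by
    intro h0
    refine hf' p hpW (ContinuousLinearMap.ext fun v => ?_)
    rw [← tangentMap_add_smul_last w v, map_add, map_smul, htm, ← hc, h0]
    simp
  -- the equation in tangential and normal coordinates
  set A : EuclideanSpace ℝ (Fin n) × ℝ →L[ℝ] EuclideanSpace ℝ (Fin (n + 1)) :=
    (tangentMap w).coprod ((ContinuousLinearMap.id ℝ ℝ).smulRight (w (Fin.last n))) with hA
  have hAapp : ∀ v, A v = tangentMap w v.1 + v.2 • w (Fin.last n) := fun v => by simp [hA]
  set ψ : EuclideanSpace ℝ (Fin n) × ℝ → ℝ := fun v => f (p + A v) with hψ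
  have hA0 : p + A ((0 : EuclideanSpace ℝ (Fin n)), (0 : ℝ)) = p := by simp [hAapp]
  have hψc : ContDiffAt ℝ 3 ψ (0, 0) := by
    refine ContDiffAt.comp (g := f) (0, 0) ?_ (contDiffAt_const.add A.contDiff.contDiffAt)
    rw [hA0]; exact hfp
  have hψd : HasFDerivAt ψ (fderiv ℝ f p ∘L A) (0, 0) := by
    refine HasFDerivAt.comp (g := f) (0, 0) ?_ (A.hasFDerivAt.const_add p)
    rw [hA0]; exact hfd
  have hinv : (fderiv ℝ ψ (0, 0) ∘L .inr ℝ (EuclideanSpace ℝ (Fin n)) ℝ).IsInvertible := by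
    refine ⟨ContinuousLinearEquiv.unitsEquivAut ℝ (Units.mk0 c hc0), ?_⟩
    rw [hψd.fderiv]
    ext
    simp [hAapp, hc]
  have h3 : (3 : WithTop ℕ∞) ≠ 0 := by norm_num
  set g₀ := hψc.implicitFunction h3 hinv with hg₀
  have hg₀0 : g₀ 0 = 0 := hψc.implicitFunction_apply_self h3 hinv
  have hg₀c : ContDiffAt ℝ (3 : ℕ) g₀ 0 := hψc.contDiffAt_implicitFunction h3 hinv
  obtain ⟨g, hg, hgg₀⟩ := exists_contDiff_eventuallyEq hg₀c
  have hψ0 : ψ (0, 0) = 0 := by rw [hψ]; simp only; rw [hA0, hfp0]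
  have hg0 : g 0 = 0 := by rw [hgg₀.eq_of_nhds, hg₀0]
  refine ⟨g, hg, hg0, ?_, ?_⟩
  · have hd : HasFDerivAt g (fderiv ℝ g 0) 0 :=
      (hg.differentiable (by norm_num) 0).hasFDerivAt
    have h1 := hψc.eventually_apply_implicitFunction h3 hinv
    have h2 : (fun y => ψ (y, g y)) =ᶠ[𝓝 0] fun _ => 0 := by
      filter_upwards [h1, hgg₀] with y hy hy'
      rw [hy', hy, hψ0]
    have h4 : HasFDerivAt (fun y => ψ (y, g y))
        ((fderiv ℝ f p ∘L A) ∘L (ContinuousLinearMap.id ℝ _).prod (fderiv ℝ g 0)) 0 := by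
      refine HasFDerivAt.comp (g := ψ) 0 ?_ ((hasFDerivAt_id _).prodMk hd)
      simpa [hg0] using hψd
    have h5 := h4.unique ((hasFDerivAt_const (0 : ℝ) _).congr_of_eventuallyEq h2)
    ext v
    have h6 := DFunLike.congr_fun h5 v
    simp only [ContinuousLinearMap.comp_apply, ContinuousLinearMap.prod_apply, hAapp, map_add,
      htm, zero_add, map_smul, ← hc, smul_eq_mul, zero_apply] at h6
    simpa [hc0] using h6
  · have h1 := hψc.eventually_apply_eq_iff_implicitFunction h3 hinv
    have hcoord : Tendsto (fun x => (tangentCoords w (x - p), inner ℝ (w (Fin.last n)) (x - p)))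
        (𝓝 p) (𝓝 ((0 : EuclideanSpace ℝ (Fin n)), (0 : ℝ))) := by
      have hcont : Continuous fun x : EuclideanSpace ℝ (Fin (n + 1)) =>
          (tangentCoords w (x - p), (inner ℝ (w (Fin.last n)) (x - p) : ℝ)) := by
        have := continuous_tangentCoords w
        fun_prop
      have := hcont.tendsto p
      simpa [tangentCoords_zero] using this
    have h2 : Tendsto (fun x => tangentCoords w (x - p)) (𝓝 p) (𝓝 0) := by
      have := (continuous_fst.tendsto _).comp hcoord
      exact this
    filter_upwards [hcoord.eventually h1, h2.eventually hgg₀, hW.mem_nhds hpW] with x hx hx' hxW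
    have hx2 : p + A (tangentCoords w (x - p), inner ℝ (w (Fin.last n)) (x - p)) = x := by
      rw [hAapp]
      simp only [tangentMap_add_smul_last]
      abel
    rw [hmem x hxW, hx', hψ0] at *
    simp only [hψ, hx2] at hx
    rw [hx, eq_comm]

end LocalGraph

/-! ### The Hessian of the height function -/

section SecondDerivative

open Filter Topology Set Metric

variable {n : ℕ} (w : OrthonormalBasis (Fin (n + 1)) ℝ (EuclideanSpace ℝ (Fin (n + 1))))
  {S : Set (EuclideanSpace ℝ (Fin (n + 1)))} {p : EuclideanSpace ℝ (Fin (n + 1))}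
  {g : EuclideanSpace ℝ (Fin n) → ℝ}

lemma graphMap_zero (hg0 : g 0 = 0) : graphMap w p g 0 = p := by simp [graphMap, hg0]

lemma continuous_graphMap (hg : Continuous g) : Continuous (graphMap w p g) := by
  unfold graphMap; fun_prop

lemma eventually_graphMap_mem (hg : Continuous g) (hg0 : g 0 = 0)
    (hS : ∀ᶠ x in 𝓝 p,
      (x ∈ S ↔ inner ℝ (w (Fin.last n)) (x - p) = g (tangentCoords w (x - p)))) :
    ∀ᶠ y in 𝓝 0, graphMap w p g y ∈ S := by
  have ht : Tendsto (graphMap w p g) (𝓝 0) (𝓝 p) := by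
    have := (continuous_graphMap w (p := p) hg).tendsto 0
    rwa [graphMap_zero w hg0] at this
  filter_upwards [ht.eventually hS] with y hy
  rw [hy, graphMap_sub, inner_last_tangentMap_add, tangentCoords_tangentMap_add]

/-- The velocities of coordinate curves in the graph are tangent vectors. -/
lemma mem_tangentVectors_graphMap (hg : Differentiable ℝ g)
    {y : EuclideanSpace ℝ (Fin n)} (hy : ∀ᶠ z in 𝓝 y, graphMap w p g z ∈ S)
    (v : EuclideanSpace ℝ (Fin n)) :
    tangentMap w v + fderiv ℝ g y v • w (Fin.last n) ∈ tangentVectors S (graphMap w p g y) := by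
  classical
  refine ⟨fun t : ℝ => if graphMap w p g (y + t • v) ∈ S then graphMap w p g (y + t • v)
    else graphMap w p g y, fun t => ?_, by simp, ?_⟩
  · dsimp only
    split_ifs with h
    · exact h
    · exact hy.self_of_nhds
  · have hline : HasDerivAt (fun t : ℝ => y + t • v) v 0 := by
      simpa using ((hasDerivAt_id (0 : ℝ)).smul_const v).const_add y
    have hG := hasFDerivAt_graphMap w (p := p) (hg y).hasFDerivAt
    have hG' : HasDerivAt (fun t : ℝ => graphMap w p g (y + t • v))
        (tangentMap w v + fderiv ℝ g y v • w (Fin.last n)) 0 := by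
      have hG2 : HasFDerivAt (graphMap w p g)
          (tangentMap w + (fderiv ℝ g y).smulRight (w (Fin.last n))) (y + (0 : ℝ) • v) := by
        simpa using hG
      exact hG2.comp_hasDerivAt (0 : ℝ) hline
    refine hG'.congr_of_eventuallyEq ?_
    have hct : Tendsto (fun t : ℝ => y + t • v) (𝓝 0) (𝓝 y) := by
      simpa using hline.continuousAt.tendsto
    filter_upwards [hct.eventually hy] with t ht
    simp [ht]

/-- The Hessian of the height function at the origin is the second fundamental form, by
differentiating the orthogonality of the normal field and the tangent vectors of the graph. -/
lemma fderiv_fderiv_eq_of_principal {U : Set (EuclideanSpace ℝ (Fin (n + 1)))} (hpU : p ∈ U)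
    {N : EuclideanSpace ℝ (Fin (n + 1)) → EuclideanSpace ℝ (Fin (n + 1))}
    (hN : IsUnitNormalField S U N) {κ : Fin n → ℝ}
    (hNp : N p = w (Fin.last n)) (hκ : ∀ i, -(fderiv ℝ N p (w i.castSucc)) = κ i • w i.castSucc)
    (hg : ContDiff ℝ 3 g) (hg0 : g 0 = 0) (hg' : fderiv ℝ g 0 = 0)
    (hS : ∀ᶠ x in 𝓝 p,
      (x ∈ S ↔ inner ℝ (w (Fin.last n)) (x - p) = g (tangentCoords w (x - p))))
    (u v : EuclideanSpace ℝ (Fin n)) :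
    fderiv ℝ (fderiv ℝ g) 0 u v = ∑ i, κ i * u i * v i := by
  have hgd : Differentiable ℝ g := hg.differentiable (by norm_num)
  have hF0 := graphMap_zero w (p := p) hg0
  have hmem := eventually_graphMap_mem w hg.continuous hg0 hS
  have hNd : HasFDerivAt N (fderiv ℝ N p) p :=
    ((hN.smooth.contDiffAt (hN.isOpen.mem_nhds hpU)).differentiableAt (by simp)).hasFDerivAt
  have hFd : HasFDerivAt (graphMap w p g) (tangentMap w) 0 := by
    have := hasFDerivAt_graphMap w (p := p) (hgd 0).hasFDerivAt
    rw [hg'] at this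
    refine this.congr_fderiv ?_
    ext1 z
    simp
  have hNF : HasFDerivAt (fun y => N (graphMap w p g y)) (fderiv ℝ N p ∘L tangentMap w) 0 := by
    refine HasFDerivAt.comp (g := N) 0 ?_ hFd
    rw [hF0]; exact hNd
  have hg2 : HasFDerivAt (fderiv ℝ g) (fderiv ℝ (fderiv ℝ g) 0) 0 :=
    ((hg.fderiv_right (m := 2) (by norm_num)).differentiable (by norm_num) 0).hasFDerivAt
  have hT : HasFDerivAt (fun y => tangentMap w v + fderiv ℝ g y v • w (Fin.last n))
      (((ContinuousLinearMap.apply ℝ ℝ v) ∘L fderiv ℝ (fderiv ℝ g) 0).smulRight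
        (w (Fin.last n))) 0 :=
    (((ContinuousLinearMap.apply ℝ ℝ v).hasFDerivAt.comp 0 hg2).smul_const _).const_add _
  have hperp : (fun y => inner ℝ (N (graphMap w p g y))
      (tangentMap w v + fderiv ℝ g y v • w (Fin.last n))) =ᶠ[𝓝 0] fun _ => (0 : ℝ) := by
    have hU : ∀ᶠ y in 𝓝 0, graphMap w p g y ∈ U := by
      have ht := (continuous_graphMap w (p := p) hg.continuous).tendsto 0
      rw [hF0] at ht
      exact ht.eventually (hN.isOpen.mem_nhds hpU)
    filter_upwards [hmem.eventually_nhds, hU] with y hy hyU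
    exact hN.normal _ ⟨hy.self_of_nhds, hyU⟩ _ (mem_tangentVectors_graphMap w hgd hy v)
  have hin := hNF.inner ℝ hT
  have hz := hin.unique ((hasFDerivAt_const (0 : ℝ) _).congr_of_eventuallyEq hperp)
  have hu := DFunLike.congr_fun hz u
  have hNu : fderiv ℝ N p (tangentMap w u) = -∑ i, (κ i * u i) • w i.castSucc := by
    rw [tangentMap_apply, map_sum, ← Finset.sum_neg_distrib]
    refine Finset.sum_congr rfl fun i _ => ?_
    rw [map_smul, ← neg_neg (fderiv ℝ N p (w i.castSucc)), hκ, smul_neg, smul_smul,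
      mul_comm (u i)]
  simp only [ContinuousLinearMap.comp_apply, fderivInnerCLM_apply, ContinuousLinearMap.prod_apply,
    hF0, hg', zero_apply, zero_smul, add_zero, hNp, hNu,
    ContinuousLinearMap.smulRight_apply, ContinuousLinearMap.apply_apply, inner_smul_right,
    inner_neg_left, sum_inner, inner_smul_left, inner_castSucc_tangentMap] at hu
  simp at hu
  linarith

/-- If the derivative of a map vanishing at the origin is of order `m`, the map is of order
`m + 1`. -/
lemma norm_le_of_norm_fderiv_le {X F : Type*} [NormedAddCommGroup X] [NormedSpace ℝ X]
    [NormedAddCommGroup F] [NormedSpace ℝ F] {G : X → F} {G' : X → X →L[ℝ] F} {K : ℝ} {m : ℕ}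
    (hK : 0 ≤ K) (hG : ∀ x, HasFDerivAt G (G' x) x) (h0 : G 0 = 0)
    (hG' : ∀ x, ‖x‖ ≤ 1 → ‖G' x‖ ≤ K * ‖x‖ ^ m) (x : X) (hx : ‖x‖ ≤ 1) :
    ‖G x‖ ≤ K * ‖x‖ ^ (m + 1) := by
  have := (convex_closedBall (0 : X) ‖x‖).norm_image_sub_le_of_norm_hasFDerivWithin_le
    (f := G) (f' := G') (C := K * ‖x‖ ^ m) (x := 0) (y := x)
    (fun z _ => (hG z).hasFDerivWithinAt)
    (fun z hz => by
      have hz' : ‖z‖ ≤ ‖x‖ := by simpa using hz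
      exact (hG' z (hz'.trans hx)).trans (by gcongr)) (by simp) (by simp)
  rw [h0, sub_zero, sub_zero] at this
  rwa [pow_succ, ← mul_assoc]

end SecondDerivative

/-! ### Expansion and area measure of the graph -/

section GraphExpansion

open Filter Topology Set Metric

variable {n : ℕ} {g : EuclideanSpace ℝ (Fin n) → ℝ}

/-- The area density of the graph of `g`. -/
noncomputable def areaDensity (g : EuclideanSpace ℝ (Fin n) → ℝ)
    (y : EuclideanSpace ℝ (Fin n)) : ℝ :=
  √(1 + ‖fderiv ℝ g y‖ ^ 2)

lemma abs_sqrt_one_add_sub_le {A : ℝ} (hA : 0 ≤ A) : |√(1 + A) - 1 - A / 2| ≤ A ^ 2 := by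
  have h1 : √(1 + A) ≤ 1 + A / 2 := by
    rw [Real.sqrt_le_left (by positivity)]
    nlinarith [sq_nonneg A]
  have h2 : 1 + A / 2 - A ^ 2 ≤ √(1 + A) := by
    rcases le_or_gt (1 + A / 2 - A ^ 2) 0 with h | h
    · exact h.trans (Real.sqrt_nonneg _)
    · have hA2 : A ≤ 3 := by nlinarith
      refine Real.le_sqrt_of_sq_le ?_
      nlinarith [mul_nonneg hA hA, mul_nonneg (mul_nonneg hA hA) hA,
        mul_nonneg (mul_nonneg hA hA) h.le]
  rw [abs_le]
  constructor <;> nlinarith [sq_nonneg A]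

lemma fderiv_quad_eq_innerSL (κ : Fin n → ℝ) (x : EuclideanSpace ℝ (Fin n)) :
    (∑ i, (κ i * x i) • (EuclideanSpace.proj i : EuclideanSpace ℝ (Fin n) →L[ℝ] ℝ)) =
      innerSL ℝ (WithLp.toLp 2 fun i => κ i * x i) := by
  ext v
  simp [PiLp.inner_apply, mul_comm]

set_option maxSynthPendingDepth 3 in
/-- The height and area density of the graph of a function of class `C³` with vanishing value and
differential at the origin, and Hessian `diag κ` there. -/
lemma exists_isGraphExpansion {κ : Fin n → ℝ} (hg : ContDiff ℝ 3 g) (hg0 : g 0 = 0)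
    (hg' : fderiv ℝ g 0 = 0)
    (hg'' : ∀ u v, fderiv ℝ (fderiv ℝ g) 0 u v = ∑ i, κ i * u i * v i) :
    ∃ K, IsGraphExpansion κ g (areaDensity g) K := by
  have hc1 : ContDiff ℝ 2 (fderiv ℝ g) := hg.fderiv_right (by norm_num)
  have hc2 : ContDiff ℝ 1 (fderiv ℝ (fderiv ℝ g)) := hc1.fderiv_right (by norm_num)
  have hc3 : Continuous (fderiv ℝ (fderiv ℝ (fderiv ℝ g))) := hc2.continuous_fderiv (by norm_num)
  obtain ⟨K, hK⟩ :=
    (isCompact_closedBall (0 : EuclideanSpace ℝ (Fin n)) 1).exists_bound_of_continuousOn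
    hc3.continuousOn
  have hK0 : 0 ≤ K := (norm_nonneg _).trans (hK 0 (by simp))
  set D := fderiv ℝ (fderiv ℝ g) 0 with hD
  have hDx : ∀ x, D x = ∑ i, (κ i * x i) •
      (EuclideanSpace.proj i : EuclideanSpace ℝ (Fin n) →L[ℝ] ℝ) := by
    intro x
    ext v
    rw [hg'']
    simp
  -- Taylor's formula, by integrating the bound on the third derivative three times
  have h2 := norm_le_of_norm_fderiv_le (m := 0) hK0
    (G := fun x => fderiv ℝ (fderiv ℝ g) x - D) (G' := fderiv ℝ (fderiv ℝ (fderiv ℝ g)))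
    (fun x => ((hc2.differentiable (by norm_num) x).hasFDerivAt).sub_const D) (by simp [hD])
    (fun x hx => by simpa using hK x (by simpa using hx))
  have h1 := norm_le_of_norm_fderiv_le (m := 1) hK0
    (G := fun x => fderiv ℝ g x - D x) (G' := fun x => fderiv ℝ (fderiv ℝ g) x - D)
    (fun x => ((hc1.differentiable (by norm_num) x).hasFDerivAt).sub D.hasFDerivAt)
    (by simp [hg']) h2
  have h0 := norm_le_of_norm_fderiv_le (m := 2) hK0
    (G := fun x => g x - quad κ x) (G' := fun x => fderiv ℝ g x - D x)
    (fun x => ((hg.differentiable (by norm_num) x).hasFDerivAt).sub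
      (by rw [hDx]; exact hasFDerivAt_quad κ x))
    (by simp [hg0, quad]) h1
  set M := ‖D‖ with hM
  have hM0 : 0 ≤ M := norm_nonneg _
  refine ⟨K + (M + K) ^ 4 + K * (2 * M + K), hg.continuous, ?_, by positivity, ?_, ?_⟩
  · have := hg.continuous_fderiv (by norm_num)
    unfold areaDensity
    fun_prop
  · intro x hx
    refine (h0 x hx).trans ?_
    gcongr
    have : 0 ≤ (M + K) ^ 4 := by positivity
    have : 0 ≤ K * (2 * M + K) := by positivity
    linarith
  · intro x hx
    set r := ‖x‖ with hr
    have hr0 : 0 ≤ r := norm_nonneg _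
    have hB : ‖D x‖ ^ 2 = 2 * quad (fun i => κ i ^ 2) x := by
      rw [hDx, fderiv_quad_eq_innerSL, innerSL_apply_norm, EuclideanSpace.norm_sq_eq, quad]
      simp [mul_pow]
    have hDr : ‖D x‖ ≤ M * r := D.le_opNorm x
    have hdiff : ‖fderiv ℝ g x - D x‖ ≤ K * r ^ 2 := h1 x hx
    have hr2 : r ^ 2 ≤ r := by nlinarith
    have hKr2 : K * r ^ 2 ≤ K * r := by gcongr
    have hgn : ‖fderiv ℝ g x‖ ≤ (M + K) * r := by
      have : ‖fderiv ℝ g x‖ ≤ ‖fderiv ℝ g x - D x‖ + ‖D x‖ := by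
        simpa using norm_add_le (fderiv ℝ g x - D x) (D x)
      linarith
    have hA := abs_sqrt_one_add_sub_le (sq_nonneg ‖fderiv ℝ g x‖)
    have hA4 : (‖fderiv ℝ g x‖ ^ 2) ^ 2 ≤ (M + K) ^ 4 * r ^ 3 := by
      calc _ = ‖fderiv ℝ g x‖ ^ 4 := by ring
        _ ≤ ((M + K) * r) ^ 4 := by gcongr
        _ = (M + K) ^ 4 * (r ^ 3 * r) := by ring
        _ ≤ (M + K) ^ 4 * (r ^ 3 * 1) := by gcongr
        _ = _ := by ring
    have hAB : |‖fderiv ℝ g x‖ ^ 2 - ‖D x‖ ^ 2| ≤ K * (2 * M + K) * r ^ 3 := by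
      have e : ‖fderiv ℝ g x‖ ^ 2 - ‖D x‖ ^ 2 =
          (‖fderiv ℝ g x‖ - ‖D x‖) * (‖fderiv ℝ g x‖ + ‖D x‖) := by ring
      rw [e, abs_mul, abs_of_nonneg (by positivity : 0 ≤ ‖fderiv ℝ g x‖ + ‖D x‖)]
      calc _ ≤ (K * r ^ 2) * ((2 * M + K) * r) := by
            gcongr
            · exact (abs_norm_sub_norm_le _ _).trans hdiff
            · linarith
        _ = _ := by ring
    have e : areaDensity g x - 1 - quad (fun i => κ i ^ 2) x =
        (√(1 + ‖fderiv ℝ g x‖ ^ 2) - 1 - ‖fderiv ℝ g x‖ ^ 2 / 2) +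
          (‖fderiv ℝ g x‖ ^ 2 - ‖D x‖ ^ 2) / 2 := by
      rw [hB, areaDensity]; ring
    rw [e]
    refine (abs_add_le _ _).trans ?_
    rw [abs_div, abs_two]
    have h6 : 0 ≤ K * r ^ 3 := by positivity
    have h7 : 0 ≤ K * (2 * M + K) * r ^ 3 := by positivity
    linarith

variable (w : OrthonormalBasis (Fin (n + 1)) ℝ (EuclideanSpace ℝ (Fin (n + 1))))
  {S : Set (EuclideanSpace ℝ (Fin (n + 1)))} {p : EuclideanSpace ℝ (Fin (n + 1))}

lemma leftInverse_graphMap (p : EuclideanSpace ℝ (Fin (n + 1)))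
    (g : EuclideanSpace ℝ (Fin n) → ℝ) :
    Function.LeftInverse (fun x => tangentCoords w (x - p)) (graphMap w p g) := by
  intro y
  simp only [graphMap_sub, tangentCoords_tangentMap_add]

lemma measurableEmbedding_graphMap (p : EuclideanSpace ℝ (Fin (n + 1))) (hg : Continuous g) :
    MeasurableEmbedding (graphMap w p g) := by
  have hc : Continuous fun x => tangentCoords w (x - p) :=
    (continuous_tangentCoords w).comp (continuous_id.sub continuous_const)
  exact (leftInverse_graphMap w p g).isClosedEmbedding hc
    (continuous_graphMap w hg) |>.measurableEmbedding

/-- The area measure of a graph, in the coordinates of the tangent space. -/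
lemma comap_graphMap_eq_withDensity (p : EuclideanSpace ℝ (Fin (n + 1))) (hg : ContDiff ℝ 3 g) :
    Measure.comap (graphMap w p g) μHE[n] =
      (volume : Measure (EuclideanSpace ℝ (Fin n))).withDensity
        fun y => ENNReal.ofReal (areaDensity g y) := by
  have hd : ∀ y, HasStrictFDerivAt g (fderiv ℝ g y) y := fun y =>
    hg.contDiffAt.hasStrictFDerivAt (by norm_num)
  have hinner : ∀ y u v, inner ℝ
      ((tangentMap w + (fderiv ℝ g y).smulRight (w (Fin.last n))) u)
      ((tangentMap w + (fderiv ℝ g y).smulRight (w (Fin.last n))) v) =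
      inner ℝ u v + fderiv ℝ g y u * fderiv ℝ g y v := by
    intro y u v
    simp only [add_apply, ContinuousLinearMap.smulRight_apply,
      inner_add_left, inner_add_right, inner_tangentMap, inner_smul_left, inner_smul_right,
      real_inner_comm (w (Fin.last n)) (tangentMap w u), inner_last_tangentMap]
    simp
    ring
  have hJ : ∀ y, ((tangentMap w + (fderiv ℝ g y).smulRight (w (Fin.last n)) :
      EuclideanSpace ℝ (Fin n) →L[ℝ] EuclideanSpace ℝ (Fin (n + 1))) :
      EuclideanSpace ℝ (Fin n) →ₗ[ℝ] EuclideanSpace ℝ (Fin (n + 1))).normDet =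
      areaDensity g y := by
    intro y
    rw [normDet_eq_sqrt_one_add_norm_sq _ ((InnerProductSpace.toDual ℝ _).symm (fderiv ℝ g y)),
      LinearIsometryEquiv.norm_map, areaDensity]
    intro u v
    simp only [InnerProductSpace.toDual_symm_apply]
    exact hinner y u v
  have hinj : ∀ y, Function.Injective
      (tangentMap w + (fderiv ℝ g y).smulRight (w (Fin.last n))) := by
    intro y
    rw [injective_iff_map_eq_zero]
    intro u hu
    have := hinner y u u
    rw [hu, inner_zero_left, real_inner_self_eq_norm_sq] at this
    have h2 : ‖u‖ ^ 2 = 0 := by nlinarith [sq_nonneg ‖u‖, mul_self_nonneg (fderiv ℝ g y u)]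
    simpa using h2
  have := comap_euclideanHausdorffMeasure_eq_withDensity
    (fun y => hasStrictFDerivAt_graphMap w (p := p) (hd y)) hinj
    (measurableEmbedding_graphMap w p hg.continuous)
  simp only [hJ, finrank_euclideanSpace_fin] at this
  exact this

end GraphExpansion

/-! ### Mass, barycenter and covariance of a small patch -/

section Patch

open Filter Topology Set Metric Asymptotics

variable {n : ℕ} (w : OrthonormalBasis (Fin (n + 1)) ℝ (EuclideanSpace ℝ (Fin (n + 1))))
  {S : Set (EuclideanSpace ℝ (Fin (n + 1)))} {p : EuclideanSpace ℝ (Fin (n + 1))}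
  {g : EuclideanSpace ℝ (Fin n) → ℝ}

lemma graphMap_mem_closedBall_iff {ε : ℝ} (hε : 0 ≤ ε) (y : EuclideanSpace ℝ (Fin n)) :
    graphMap w p g y ∈ closedBall p ε ↔ y ∈ projectedPatch g ε := by
  rw [mem_closedBall, dist_eq_norm, ← sq_le_sq₀ (norm_nonneg _) hε, norm_graphMap_sub_sq]
  rfl

/-- A small patch is the part of the graph over the projected patch. -/
lemma exists_patch_eq_image (hS : ∀ᶠ x in 𝓝 p,
      (x ∈ S ↔ inner ℝ (w (Fin.last n)) (x - p) = g (tangentCoords w (x - p)))) :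
    ∃ ε₀ > 0, ∀ ε, 0 < ε → ε < ε₀ → patch S p ε = graphMap w p g '' projectedPatch g ε := by
  obtain ⟨r, hr, hball⟩ := Metric.eventually_nhds_iff_ball.1 hS
  refine ⟨r, hr, fun ε hε hεr => ?_⟩
  ext x
  constructor
  · rintro ⟨hxS, hxε⟩
    have h1 := (hball x (closedBall_subset_ball hεr hxε)).1 hxS
    have h2 := graphMap_tangentCoords w h1
    refine ⟨tangentCoords w (x - p), ?_, h2⟩
    rw [← graphMap_mem_closedBall_iff w (p := p) hε.le, h2]
    exact hxε
  · rintro ⟨y, hy, rfl⟩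
    have h1 := (graphMap_mem_closedBall_iff w (p := p) (g := g) hε.le y).2 hy
    refine ⟨(hball _ (closedBall_subset_ball hεr h1)).2 ?_, h1⟩
    rw [graphMap_sub, inner_last_tangentMap_add, tangentCoords_tangentMap_add]

/-- The area measure of a patch is the image of a weighted Lebesgue measure on the tangent
space. -/
lemma patchMeasure_eq_map (hg : ContDiff ℝ 3 g) {ε : ℝ}
    (hp : patch S p ε = graphMap w p g '' projectedPatch g ε) :
    patchMeasure S p ε = Measure.map (graphMap w p g)
      ((volume.restrict (projectedPatch g ε)).withDensity
        fun y => ENNReal.ofReal (areaDensity g y)) := by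
  have hemb := measurableEmbedding_graphMap w p hg.continuous
  have hm : MeasurableSet (projectedPatch g ε) :=
    (isClosed_le (by have := hg.continuous; fun_prop) continuous_const).measurableSet
  rw [patchMeasure, hp, ← restrict_withDensity hm, ← comap_graphMap_eq_withDensity w p hg]
  have h1 : (μHE[n] : Measure (EuclideanSpace ℝ (Fin (n + 1)))).restrict
      (graphMap w p g '' projectedPatch g ε) =
      (Measure.map (graphMap w p g) (Measure.comap (graphMap w p g) μHE[n])).restrict
        (graphMap w p g '' projectedPatch g ε) := by
    rw [hemb.map_comap, Measure.restrict_restrict_of_subset (image_subset_range _ _)]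
  rw [h1, hemb.restrict_map, preimage_image_eq _ hemb.injective]

lemma continuous_areaDensity (hg : ContDiff ℝ 3 g) : Continuous (areaDensity g) := by
  have := hg.continuous_fderiv (by norm_num)
  unfold areaDensity
  fun_prop

lemma areaDensity_nonneg (y : EuclideanSpace ℝ (Fin n)) : 0 ≤ areaDensity g y := Real.sqrt_nonneg _

variable {V : Type*} [NormedAddCommGroup V] [NormedSpace ℝ V]

lemma integrable_patchMeasure (hg : ContDiff ℝ 3 g) {ε : ℝ} (hε : 0 ≤ ε)
    (hp : patch S p ε = graphMap w p g '' projectedPatch g ε)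
    {f : EuclideanSpace ℝ (Fin (n + 1)) → V} (hf : Continuous f) :
    Integrable f (patchMeasure S p ε) := by
  rw [patchMeasure_eq_map w hg hp,
    (measurableEmbedding_graphMap w p hg.continuous).integrable_map_iff,
    integrable_withDensity_iff_integrable_smul'
      (continuous_areaDensity hg).measurable.ennreal_ofReal (by simp)]
  have hcF : Continuous (graphMap w p g) := continuous_graphMap w hg.continuous
  have hcJ := continuous_areaDensity hg
  have hc : Continuous fun y => areaDensity g y • f (graphMap w p g y) :=
    hcJ.smul (hf.comp hcF)
  refine (hc.continuousOn.integrableOn_compact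
    (isCompact_projectedPatch hg.continuous hε)).congr (Eventually.of_forall fun y => ?_)
  simp [ENNReal.toReal_ofReal (areaDensity_nonneg y)]

lemma integral_patchMeasure (hg : ContDiff ℝ 3 g) {ε : ℝ} (hε : 0 < ε)
    (hp : patch S p ε = graphMap w p g '' projectedPatch g ε)
    (f : EuclideanSpace ℝ (Fin (n + 1)) → ℝ) :
    ∫ x, f x ∂(patchMeasure S p ε) =
      ballVolume n ε * patchMoment g (areaDensity g) (fun y => f (graphMap w p g y)) ε := by
  rw [patchMeasure_eq_map w hg hp,
    (measurableEmbedding_graphMap w p hg.continuous).integral_map,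
    integral_withDensity_eq_integral_toReal_smul
      (continuous_areaDensity hg).measurable.ennreal_ofReal (by simp), patchMoment,
    mul_div_cancel₀ _ (ballVolume_pos hε).ne']
  refine integral_congr_ae (Eventually.of_forall fun y => ?_)
  simp [ENNReal.toReal_ofReal (areaDensity_nonneg y), mul_comm]

lemma isFiniteMeasure_patchMeasure (hg : ContDiff ℝ 3 g) {ε : ℝ} (hε : 0 ≤ ε)
    (hp : patch S p ε = graphMap w p g '' projectedPatch g ε) :
    IsFiniteMeasure (patchMeasure S p ε) := by
  have := integrable_patchMeasure w hg hε hp (f := fun _ => (1 : ℝ)) continuous_const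
  rw [integrable_const_iff] at this
  exact this.resolve_left one_ne_zero

lemma mass_patchMeasure (hg : ContDiff ℝ 3 g) {ε : ℝ} (hε : 0 < ε)
    (hp : patch S p ε = graphMap w p g '' projectedPatch g ε) :
    mass (patchMeasure S p ε) =
      ballVolume n ε * patchMoment g (areaDensity g) (fun _ => 1) ε := by
  rw [← integral_patchMeasure w hg hε hp fun _ => 1]
  simp [mass]

/-- The coordinates of the points of the graph in the orthonormal frame at `p`. -/
noncomputable def frameCoord (g : EuclideanSpace ℝ (Fin n) → ℝ) (k : Fin (n + 1))
    (y : EuclideanSpace ℝ (Fin n)) : ℝ :=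
  Fin.lastCases (motive := fun _ => ℝ) (g y) (fun i => y i) k

lemma inner_graphMap_sub (k : Fin (n + 1)) (y : EuclideanSpace ℝ (Fin n)) :
    inner ℝ (w k) (graphMap w p g y - p) = frameCoord g k y := by
  rw [graphMap_sub]
  refine Fin.lastCases ?_ (fun i => ?_) k
  · simp [frameCoord, inner_last_tangentMap_add]
  · simp only [frameCoord, Fin.lastCases_castSucc]
    exact congrArg (fun v : EuclideanSpace ℝ (Fin n) => v i)
      (tangentCoords_tangentMap_add w y (g y))

lemma inner_barycenter_sub (hg : ContDiff ℝ 3 g) {ε : ℝ} (hε : 0 < ε)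
    (hp : patch S p ε = graphMap w p g '' projectedPatch g ε)
    (hmass : mass (patchMeasure S p ε) ≠ 0) (k : Fin (n + 1)) :
    inner ℝ (w k) (barycenter (patchMeasure S p ε) - p) =
      patchMoment g (areaDensity g) (frameCoord g k) ε /
        patchMoment g (areaDensity g) (fun _ => 1) ε := by
  have hfin := isFiniteMeasure_patchMeasure w hg hε.le hp
  have h1 : inner ℝ (w k) (barycenter (patchMeasure S p ε) - p) =
      (mass (patchMeasure S p ε))⁻¹ * ∫ x, inner ℝ (w k) (x - p) ∂(patchMeasure S p ε) := by
    simp only [inner_sub_right]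
    rw [integral_sub (integrable_patchMeasure w hg hε.le hp (by fun_prop)) (integrable_const _),
      integral_const,
      integral_inner (f := fun x => x) (integrable_patchMeasure w hg hε.le hp continuous_id),
      barycenter, inner_smul_right, mul_sub]
    congr 1
    rw [show (patchMeasure S p ε).real univ = mass (patchMeasure S p ε) from rfl, smul_eq_mul,
      inv_mul_cancel_left₀ hmass]
  rw [h1, integral_patchMeasure w hg hε hp, mass_patchMeasure w hg hε hp]
  simp only [inner_graphMap_sub]
  have hv := (ballVolume_pos (n := n) hε).ne'
  rw [mul_inv, div_eq_inv_mul]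
  field_simp

lemma inner_covarianceMatrix {m : ℕ} (ρ : Measure (EuclideanSpace ℝ (Fin m)))
    (hρ : ∀ f : EuclideanSpace ℝ (Fin m) → ℝ, Continuous f → Integrable f ρ)
    (u v : EuclideanSpace ℝ (Fin m)) :
    inner ℝ u (Matrix.toEuclideanLin (covarianceMatrix ρ) v) =
      ∫ x, inner ℝ u (x - barycenter ρ) * inner ℝ v (x - barycenter ρ) ∂ρ := by
  have h1 : inner ℝ u (Matrix.toEuclideanLin (covarianceMatrix ρ) v) =
      ∑ i, ∑ j, u i * v j * ∫ x, (x i - barycenter ρ i) * (x j - barycenter ρ j) ∂ρ := by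
    simp only [PiLp.inner_apply, Matrix.toLpLin_apply, Matrix.mulVec, dotProduct,
      covarianceMatrix, Matrix.of_apply]
    refine Finset.sum_congr rfl fun i _ => ?_
    simp only [RCLike.inner_apply, conj_trivial, Finset.sum_mul]
    exact Finset.sum_congr rfl fun j _ => by ring
  rw [h1]
  simp only [← integral_const_mul]
  rw [Finset.sum_congr rfl fun i _ => (integral_finsetSum _ fun j _ =>
    hρ _ (by fun_prop)).symm, ← integral_finsetSum _ fun i _ => hρ _ (by fun_prop)]
  congr 1
  funext x
  simp only [PiLp.inner_apply, RCLike.inner_apply, conj_trivial, PiLp.sub_apply,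
    Finset.sum_mul_sum]
  exact Finset.sum_congr rfl fun i _ => Finset.sum_congr rfl fun j _ => by ring

/-- The covariance matrix in the orthonormal frame at `p`, divided by the volume of the flat
ball. -/
noncomputable def frameCovariance (S : Set (EuclideanSpace ℝ (Fin (n + 1))))
    (p : EuclideanSpace ℝ (Fin (n + 1))) (ε : ℝ) (k k' : Fin (n + 1)) : ℝ :=
  inner ℝ (w k) (Matrix.toEuclideanLin (covarianceMatrix (patchMeasure S p ε)) (w k')) /
    ballVolume n ε

lemma frameCovariance_eq (hg : ContDiff ℝ 3 g) {ε : ℝ} (hε : 0 < ε)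
    (hp : patch S p ε = graphMap w p g '' projectedPatch g ε)
    (hmass : mass (patchMeasure S p ε) ≠ 0) (k k' : Fin (n + 1)) :
    frameCovariance w S p ε k k' =
      patchMoment g (areaDensity g) (fun y => frameCoord g k y * frameCoord g k' y) ε -
      patchMoment g (areaDensity g) (frameCoord g k) ε *
        patchMoment g (areaDensity g) (frameCoord g k') ε /
          patchMoment g (areaDensity g) (fun _ => 1) ε := by
  have hfin := isFiniteMeasure_patchMeasure w hg hε.le hp
  set ρ := patchMeasure S p ε with hρ
  have hi : ∀ f : EuclideanSpace ℝ (Fin (n + 1)) → ℝ, Continuous f → Integrable f ρ :=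
    fun f hf => integrable_patchMeasure w hg hε.le hp hf
  have hv := (ballVolume_pos (n := n) hε).ne'
  have hb := fun k => inner_barycenter_sub w hg hε hp hmass k
  have hm := mass_patchMeasure w hg hε hp
  rw [← hρ] at hb hm
  set s := barycenter ρ - p with hs
  have e : ∀ x k, inner ℝ (w k) (x - barycenter ρ) = inner ℝ (w k) (x - p) - inner ℝ (w k) s := by
    intro x k
    rw [← inner_sub_right, hs]; congr 1; abel
  rw [frameCovariance, inner_covarianceMatrix ρ hi]
  simp only [e]
  have e2 : ∀ x, (inner ℝ (w k) (x - p) - inner ℝ (w k) s) *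
      (inner ℝ (w k') (x - p) - inner ℝ (w k') s) =
      inner ℝ (w k) (x - p) * inner ℝ (w k') (x - p) -
        (inner ℝ (w k') s * inner ℝ (w k) (x - p) + inner ℝ (w k) s * inner ℝ (w k') (x - p)) +
        inner ℝ (w k) s * inner ℝ (w k') s := fun x => by ring
  simp only [e2]
  rw [integral_add (hi _ (by fun_prop)) (hi _ (by fun_prop)),
    integral_sub (hi _ (by fun_prop)) (hi _ (by fun_prop)),
    integral_add (hi _ (by fun_prop)) (hi _ (by fun_prop)),
    integral_const_mul, integral_const_mul, integral_patchMeasure w hg hε hp,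
    integral_patchMeasure w hg hε hp, integral_patchMeasure w hg hε hp, integral_const,
    show ρ.real univ = mass ρ from rfl, hm, hb, hb]
  simp only [inner_graphMap_sub, smul_eq_mul]
  have h1 : patchMoment g (areaDensity g) (fun _ => 1) ε ≠ 0 := by
    intro h0
    rw [h0, mul_zero] at hm
    exact hmass hm
  simp only [show (fun y => frameCoord g k y) = frameCoord g k from rfl,
    show (fun y => frameCoord g k' y) = frameCoord g k' from rfl]
  field_simp
  ring

end Patch

/-! ### Eigenvalue decompositions of the covariance matrices of small patches -/

section SmallRadius

open Filter Topology Set Metric Asymptotics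

variable {n : ℕ} {S : Set (EuclideanSpace ℝ (Fin (n + 1)))} {p : EuclideanSpace ℝ (Fin (n + 1))}

/-- All eigenvalue decompositions of the covariance matrices of the patches of `S` about `p`, of
all radii. Asymptotic statements along the radius are then uniform in the choice of the
decomposition. -/
structure PatchEVD (S : Set (EuclideanSpace ℝ (Fin (n + 1))))
    (p : EuclideanSpace ℝ (Fin (n + 1))) where
  /-- The radius. -/
  radius : ℝ
  /-- The eigenvalues. -/
  lam : Fin (n + 1) → ℝ
  /-- The eigenvectors. -/
  e : OrthonormalBasis (Fin (n + 1)) ℝ (EuclideanSpace ℝ (Fin (n + 1)))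
  isEVD : IsEVD (covarianceMatrix (patchMeasure S p radius)) lam e

/-- The filter of eigenvalue decompositions with radius tending to `0` from above. -/
def smallRadius (S : Set (EuclideanSpace ℝ (Fin (n + 1)))) (p : EuclideanSpace ℝ (Fin (n + 1))) :
    Filter (PatchEVD S p) :=
  comap PatchEVD.radius (𝓝[>] 0)

lemma tendsto_radius : Tendsto (PatchEVD.radius (S := S) (p := p)) (smallRadius S p) (𝓝[>] 0) :=
  tendsto_comap

lemma eventually_smallRadius_iff {P : PatchEVD S p → Prop} :
    (∀ᶠ x in smallRadius S p, P x) ↔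
      ∃ ε₀ > 0, ∀ x : PatchEVD S p, 0 < x.radius → x.radius < ε₀ → P x := by
  rw [smallRadius, eventually_comap, eventually_nhdsWithin_iff, Metric.eventually_nhds_iff]
  constructor
  · rintro ⟨ε₀, hε₀, h⟩
    exact ⟨ε₀, hε₀, fun x hx hx' => h (by simpa [abs_of_pos hx] using hx') hx x rfl⟩
  · rintro ⟨ε₀, hε₀, h⟩
    refine ⟨ε₀, hε₀, fun ε hε hpos x hx => h x (hx ▸ hpos) ?_⟩
    rw [hx]
    exact (le_abs_self ε).trans_lt (by simpa using hε)

lemma eventually_radius_pos : ∀ᶠ x in smallRadius S p, 0 < x.radius :=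
  tendsto_radius self_mem_nhdsWithin

lemma isBigO_div_radius_pow {f : PatchEVD S p → ℝ} {k m : ℕ}
    (hf : f =O[smallRadius S p] fun x => x.radius ^ (k + m)) :
    (fun x => f x / x.radius ^ k) =O[smallRadius S p] fun x => x.radius ^ m := by
  refine (hf.mul (isBigO_refl (fun x : PatchEVD S p => (x.radius ^ k)⁻¹) _)).congr'
    (by simp only [div_eq_mul_inv]; rfl) ?_
  filter_upwards [eventually_radius_pos] with x hx
  rw [pow_add]
  field_simp

lemma exists_bound_of_isBigO_radius {f : PatchEVD S p → ℝ}
    (hf : f =O[smallRadius S p] PatchEVD.radius) :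
    ∃ C, ∀ᶠ x in smallRadius S p, |f x| ≤ C * x.radius := by
  obtain ⟨C, hC⟩ := hf.bound
  refine ⟨C, ?_⟩
  filter_upwards [hC, eventually_radius_pos] with x hx hpos
  simpa [abs_of_pos hpos] using hx

lemma tendsto_of_isBigO_radius {f : PatchEVD S p → ℝ} {a : ℝ}
    (hf : (fun x => f x - a) =O[smallRadius S p] PatchEVD.radius) :
    Tendsto f (smallRadius S p) (𝓝 a) := by
  have := hf.trans_tendsto (tendsto_radius.mono_right nhdsWithin_le_nhds)
  simpa using this.add_const a

end SmallRadius

/-! ### Expansions in a principal frame -/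

section FrameAsymptotics

open Filter Topology Set Metric Asymptotics

variable {n : ℕ} [NeZero n] {κ : Fin n → ℝ} {g J : EuclideanSpace ℝ (Fin n) → ℝ} {K : ℝ}

lemma IsGraphExpansion.tendsto_mass (h : IsGraphExpansion κ g J K) :
    Tendsto (patchMoment g J fun _ => 1) (𝓝[>] 0) (𝓝 1) := by
  have h1 := h.mass_isBigO.trans_tendsto (show Tendsto (fun ε : ℝ => ε ^ 3) (𝓝[>] 0) (𝓝 0) by
    have := ((continuous_pow 3).tendsto (0 : ℝ)).mono_left (nhdsWithin_le_nhds (s := Ioi 0))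
    simpa using this)
  have h2 : Tendsto (fun ε : ℝ => 1 + massCoeff κ * ε ^ 2) (𝓝[>] 0) (𝓝 1) := by
    have : Continuous fun ε : ℝ => 1 + massCoeff κ * ε ^ 2 := by fun_prop
    simpa using (this.tendsto 0).mono_left (nhdsWithin_le_nhds (s := Ioi 0))
  simpa using h1.add h2

/-- Dividing by the normalized mass does not change the order of a function. -/
lemma IsGraphExpansion.div_mass_isBigO (h : IsGraphExpansion κ g J K) {f : ℝ → ℝ} {k : ℕ}
    (hf : f =O[𝓝[>] 0] fun ε => ε ^ k) :
    (fun ε => f ε / patchMoment g J (fun _ => 1) ε) =O[𝓝[>] 0] fun ε => ε ^ k := by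
  have h1 : (fun ε => (patchMoment g J (fun _ => 1) ε)⁻¹) =O[𝓝[>] 0] fun _ => (1 : ℝ) :=
    (h.tendsto_mass.inv₀ one_ne_zero).isBigO_one ℝ
  simpa [div_eq_mul_inv] using hf.mul h1

lemma const_mul_pow_isBigO (c : ℝ) (k : ℕ) :
    (fun ε : ℝ => c * ε ^ k) =O[𝓝[>] 0] fun ε => ε ^ k := isBigO_const_mul_self _ _ _

lemma IsGraphExpansion.height_isBigO_sq (h : IsGraphExpansion κ g J K) :
    patchMoment g J g =O[𝓝[>] 0] fun ε => ε ^ 2 := by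
  refine ((h.height_isBigO.trans (pow_isBigO_pow (show 2 ≤ 3 by norm_num))).add
    (const_mul_pow_isBigO (heightCoeff κ) 2)).congr_left fun ε => ?_
  ring

/-- The height of the barycenter. -/
lemma IsGraphExpansion.barycenter_height_isBigO (h : IsGraphExpansion κ g J K) :
    (fun ε => patchMoment g J g ε / patchMoment g J (fun _ => 1) ε - heightCoeff κ * ε ^ 2)
      =O[𝓝[>] 0] fun ε => ε ^ 3 := by
  -- `1 - v = O(ε²)` for the normalized mass `v`
  have h1 : (fun ε => 1 - patchMoment g J (fun _ => 1) ε) =O[𝓝[>] 0] fun ε => ε ^ 2 := by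
    refine ((h.mass_isBigO.trans (pow_isBigO_pow (show 2 ≤ 3 by norm_num))).add
      (const_mul_pow_isBigO (massCoeff κ) 2)).neg_left.congr_left fun ε => ?_
    ring
  have h2 := (h1.mul (const_mul_pow_isBigO (heightCoeff κ) 2))
  simp only [← pow_add] at h2
  have h3 := h.div_mass_isBigO (h.height_isBigO.add
    (h2.trans (pow_isBigO_pow (show 3 ≤ 2 + 2 by norm_num))))
  refine h3.congr' ?_ EventuallyEq.rfl
  filter_upwards [h.tendsto_mass.eventually_ne one_ne_zero] with ε hε
  field_simp
  ring

lemma IsGraphExpansion.covariance_tangent_isBigO (h : IsGraphExpansion κ g J K) (i j : Fin n) :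
    (fun ε => patchMoment g J (fun y => y i * y j) ε -
      patchMoment g J (fun y => y i) ε * patchMoment g J (fun y => y j) ε /
        patchMoment g J (fun _ => 1) ε -
      if i = j then 1 / ((n : ℝ) + 2) * ε ^ 2 + tangentCoeff κ i * ε ^ 4 else 0)
      =O[𝓝[>] 0] fun ε => ε ^ 5 := by
  have h1 := (h.coord_isBigO i).mul (h.coord_isBigO j)
  simp only [← pow_add] at h1
  have h2 := h.div_mass_isBigO (h1.trans (pow_isBigO_pow (show 5 ≤ 3 + 3 by norm_num)))
  refine ((h.coord_mul_coord_isBigO i j).sub h2).congr_left fun ε => ?_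
  split_ifs <;> ring

lemma IsGraphExpansion.covariance_mixed_isBigO (h : IsGraphExpansion κ g J K) (i : Fin n) :
    (fun ε => patchMoment g J (fun y => y i * g y) ε -
      patchMoment g J (fun y => y i) ε * patchMoment g J g ε /
        patchMoment g J (fun _ => 1) ε) =O[𝓝[>] 0] fun ε => ε ^ 4 := by
  have h1 := (h.coord_isBigO i).mul h.height_isBigO_sq
  simp only [← pow_add] at h1
  have h2 := h.div_mass_isBigO (h1.trans (pow_isBigO_pow (show 4 ≤ 3 + 2 by norm_num)))
  exact (h.coord_mul_height_isBigO i).sub h2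

lemma IsGraphExpansion.covariance_normal_isBigO (h : IsGraphExpansion κ g J K) :
    (fun ε => patchMoment g J (fun y => g y * g y) ε -
      patchMoment g J g ε * patchMoment g J g ε / patchMoment g J (fun _ => 1) ε -
      (heightSqCoeff κ - heightCoeff κ ^ 2) * ε ^ 4) =O[𝓝[>] 0] fun ε => ε ^ 5 := by
  have h1 := h.barycenter_height_isBigO.mul h.height_isBigO_sq
  have h2 := h.height_isBigO.mul (const_mul_pow_isBigO (heightCoeff κ) 2)
  simp only [← pow_add] at h1 h2
  refine ((h.height_sq_isBigO.sub h1).sub h2).congr_left fun ε => ?_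
  ring

variable (w : OrthonormalBasis (Fin (n + 1)) ℝ (EuclideanSpace ℝ (Fin (n + 1))))
  {S : Set (EuclideanSpace ℝ (Fin (n + 1)))} {p : EuclideanSpace ℝ (Fin (n + 1))}

/-- A hypersurface near one of its points, in a principal frame `w` at that point whose last vector
is normal: `S` is the graph of `g`, and `g` has the second order expansion given by the principal
curvatures. -/
structure IsPrincipalGraph (S : Set (EuclideanSpace ℝ (Fin (n + 1))))
    (p : EuclideanSpace ℝ (Fin (n + 1))) (κ : Fin n → ℝ)
    (w : OrthonormalBasis (Fin (n + 1)) ℝ (EuclideanSpace ℝ (Fin (n + 1))))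
    (g : EuclideanSpace ℝ (Fin n) → ℝ) (K : ℝ) : Prop where
  contDiff : ContDiff ℝ 3 g
  expansion : IsGraphExpansion κ g (areaDensity g) K
  patch_eq : ∀ᶠ ε in 𝓝[>] (0 : ℝ), patch S p ε = graphMap w p g '' projectedPatch g ε

namespace IsPrincipalGraph

variable {w} (h : IsPrincipalGraph S p κ w g K)
include h

lemma eventually_mass_ne_zero : ∀ᶠ ε in 𝓝[>] (0 : ℝ), mass (patchMeasure S p ε) ≠ 0 := by
  filter_upwards [h.patch_eq, self_mem_nhdsWithin,
    h.expansion.tendsto_mass.eventually_ne one_ne_zero] with ε hp hε hne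
  rw [mass_patchMeasure w h.contDiff hε hp]
  exact mul_ne_zero (ballVolume_pos hε).ne' hne

lemma eventually_measure_ne : ∀ᶠ ε in 𝓝[>] (0 : ℝ), patchMeasure S p ε Set.univ ≠ 0 ∧
    patchMeasure S p ε Set.univ ≠ ⊤ := by
  filter_upwards [h.patch_eq, self_mem_nhdsWithin, h.eventually_mass_ne_zero] with ε hp hε hne
  have := isFiniteMeasure_patchMeasure w h.contDiff (le_of_lt hε) hp
  refine ⟨fun h0 => hne ?_, measure_ne_top _ _⟩
  simp [mass, Measure.real, h0]

lemma mass_isBigO :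
    (fun ε => mass (patchMeasure S p ε) / ballVolume n ε - (1 + massCoeff κ * ε ^ 2))
      =O[𝓝[>] 0] fun ε => ε ^ 3 := by
  refine h.expansion.mass_isBigO.congr' ?_ EventuallyEq.rfl
  filter_upwards [h.patch_eq, self_mem_nhdsWithin] with ε hp hε
  rw [mass_patchMeasure w h.contDiff hε hp, mul_div_cancel_left₀ _ (ballVolume_pos hε).ne']

lemma barycenter_tangent_isBigO (i : Fin n) :
    (fun ε => inner ℝ (w i.castSucc) (barycenter (patchMeasure S p ε) - p))
      =O[𝓝[>] 0] fun ε => ε ^ 3 := by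
  refine (h.expansion.div_mass_isBigO (h.expansion.coord_isBigO i)).congr' ?_ EventuallyEq.rfl
  filter_upwards [h.patch_eq, self_mem_nhdsWithin, h.eventually_mass_ne_zero] with ε hp hε hne
  rw [inner_barycenter_sub w h.contDiff hε hp hne]
  congr 2
  funext y
  simp [frameCoord]

lemma barycenter_normal_isBigO :
    (fun ε => inner ℝ (w (Fin.last n)) (barycenter (patchMeasure S p ε) - p) -
      heightCoeff κ * ε ^ 2) =O[𝓝[>] 0] fun ε => ε ^ 3 := by
  refine h.expansion.barycenter_height_isBigO.congr' ?_ EventuallyEq.rfl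
  filter_upwards [h.patch_eq, self_mem_nhdsWithin, h.eventually_mass_ne_zero] with ε hp hε hne
  rw [inner_barycenter_sub w h.contDiff hε hp hne]
  have : frameCoord g (Fin.last n) = g := by funext y; simp [frameCoord]
  rw [this]

lemma eventually_frameCovariance_eq : ∀ᶠ ε in 𝓝[>] (0 : ℝ), ∀ k k',
    frameCovariance w S p ε k k' =
      patchMoment g (areaDensity g) (fun y => frameCoord g k y * frameCoord g k' y) ε -
      patchMoment g (areaDensity g) (frameCoord g k) ε *
        patchMoment g (areaDensity g) (frameCoord g k') ε /
          patchMoment g (areaDensity g) (fun _ => 1) ε := by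
  filter_upwards [h.patch_eq, self_mem_nhdsWithin, h.eventually_mass_ne_zero] with ε hp hε hne
  exact frameCovariance_eq w h.contDiff hε hp hne

lemma frameCovariance_tangent_isBigO (i j : Fin n) :
    (fun ε => frameCovariance w S p ε i.castSucc j.castSucc -
      if i = j then 1 / ((n : ℝ) + 2) * ε ^ 2 + tangentCoeff κ i * ε ^ 4 else 0)
      =O[𝓝[>] 0] fun ε => ε ^ 5 := by
  refine (h.expansion.covariance_tangent_isBigO i j).congr' ?_ EventuallyEq.rfl
  filter_upwards [h.eventually_frameCovariance_eq] with ε hε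
  have e : ∀ i : Fin n, frameCoord g i.castSucc = fun y => y i := fun i => by
    funext y; simp [frameCoord]
  simp only [hε, e]

lemma frameCovariance_mixed_isBigO (i : Fin n) :
    (fun ε => frameCovariance w S p ε i.castSucc (Fin.last n)) =O[𝓝[>] 0] fun ε => ε ^ 4 := by
  refine (h.expansion.covariance_mixed_isBigO i).congr' ?_ EventuallyEq.rfl
  filter_upwards [h.eventually_frameCovariance_eq] with ε hε
  have e : ∀ i : Fin n, frameCoord g i.castSucc = fun y => y i := fun i => by
    funext y; simp [frameCoord]
  have e' : frameCoord g (Fin.last n) = g := by funext y; simp [frameCoord]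
  simp only [hε, e, e']

lemma frameCovariance_normal_isBigO :
    (fun ε => frameCovariance w S p ε (Fin.last n) (Fin.last n) -
      (heightSqCoeff κ - heightCoeff κ ^ 2) * ε ^ 4) =O[𝓝[>] 0] fun ε => ε ^ 5 := by
  refine h.expansion.covariance_normal_isBigO.congr' ?_ EventuallyEq.rfl
  filter_upwards [h.eventually_frameCovariance_eq] with ε hε
  have e' : frameCoord g (Fin.last n) = g := by funext y; simp [frameCoord]
  simp only [hε, e']

end IsPrincipalGraph

lemma IsPrincipalGraph.isPerturbedEVD (h : IsPrincipalGraph S p κ w g K) :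
    IsPerturbedEVD (smallRadius S p) PatchEVD.radius (1 / ((n : ℝ) + 2))
      (heightSqCoeff κ - heightCoeff κ ^ 2) (tangentCoeff κ)
      (fun x => frameCovariance w S p x.radius) (fun x k i => inner ℝ (w i) (x.e k))
      (fun x k => x.lam k / ballVolume n x.radius) where
  tendsto := tendsto_radius
  pos := by positivity
  tangent i j := (h.frameCovariance_tangent_isBigO i j).comp_tendsto tendsto_radius
  mixed i := (h.frameCovariance_mixed_isBigO i).comp_tendsto tendsto_radius
  normal := h.frameCovariance_normal_isBigO.comp_tendsto tendsto_radius
  symm x i j := by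
    unfold frameCovariance
    congr 1
    have hC : (covarianceMatrix (patchMeasure S p x.radius)).IsHermitian := by
      ext a b
      simp [covarianceMatrix, mul_comm]
    have := Matrix.isSymmetric_toEuclideanLin_iff.2 hC
    rw [← this (w i) (w j), real_inner_comm]
  row x k := by
    have := w.sum_sq_inner_right (x.e k)
    simpa using this
  col x i := by
    have := x.e.sum_sq_inner_left (w i)
    simpa using this
  orth x k k' hkk' := by
    have := w.sum_inner_mul_inner (x.e k) (x.e k')
    rw [orthonormal_iff_ite.1 x.e.orthonormal, if_neg hkk'] at this
    rw [← this]
    exact Finset.sum_congr rfl fun i _ => by rw [real_inner_comm]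
  eigen x k i := by
    have h1 := x.isEVD.eigen k
    have h2 : inner ℝ (w i) (Matrix.toEuclideanLin
        (covarianceMatrix (patchMeasure S p x.radius)) (x.e k)) =
        ∑ j, inner ℝ (w i) (Matrix.toEuclideanLin
        (covarianceMatrix (patchMeasure S p x.radius)) (w j)) * inner ℝ (w j) (x.e k) := by
      conv_lhs => rw [← w.sum_repr' (x.e k), map_sum, inner_sum]
      refine Finset.sum_congr rfl fun j _ => ?_
      rw [map_smul, inner_smul_right, mul_comm]
    rw [h1, inner_smul_right] at h2
    simp only [frameCovariance, div_mul_eq_mul_div, ← Finset.sum_div]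
    rw [← h2]
  antitone x i j hij :=
    div_le_div_of_nonneg_right (x.isEVD.antitone hij) measureReal_nonneg

end FrameAsymptotics

/-! ### Asymptotics of the descriptors -/

section Descriptors

open Filter Topology Set Asymptotics

variable {n : ℕ} {κ : Fin n → ℝ}

lemma scalarCurvature_eq (κ : Fin n → ℝ) :
    scalarCurvature κ = (∑ i, κ i) ^ 2 - ∑ i, κ i ^ 2 := by
  have h1 := Finset.sum_sum_Ioi_add_eq_sum_sum_off_diag fun i j => κ i * κ j
  have h2 : ∀ i, ∑ j, κ j * κ i = κ i ^ 2 + ∑ j ∈ {i}ᶜ, κ j * κ i := fun i => by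
    rw [Fintype.sum_eq_add_sum_compl i, sq]
  have h3 : (∑ i, κ i) ^ 2 = ∑ i, ∑ j, κ j * κ i := by
    rw [sq, Finset.sum_mul_sum, Finset.sum_comm]
  rw [h3, Finset.sum_congr rfl fun i _ => h2 i, Finset.sum_add_distrib, ← h1, scalarCurvature,
    Finset.mul_sum]
  rw [add_sub_cancel_left]
  refine Finset.sum_congr rfl fun i _ => ?_
  rw [Finset.mul_sum]
  exact Finset.sum_congr rfl fun j _ => by ring

lemma sign_eq_sign_of_abs_sub_lt {a b : ℝ} (h : |a - b| < |b|) :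
    Real.sign a = Real.sign b := by
  obtain ⟨h1, h2⟩ := abs_lt.1 h
  rcases lt_trichotomy b 0 with hb | rfl | hb
  · rw [abs_of_neg hb] at h1 h2
    rw [Real.sign_of_neg hb, Real.sign_of_neg (by linarith)]
  · simp only [abs_zero] at h
    exact absurd h (abs_nonneg _).not_gt
  · rw [abs_of_pos hb] at h1 h2
    rw [Real.sign_of_pos hb, Real.sign_of_pos (by linarith)]

lemma sign_mul_of_pos_right (a : ℝ) {b : ℝ} (hb : 0 < b) :
    Real.sign (a * b) = Real.sign a := by
  rcases lt_trichotomy a 0 with ha | rfl | ha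
  · rw [Real.sign_of_neg ha, Real.sign_of_neg (mul_neg_of_neg_of_pos ha hb)]
  · simp
  · rw [Real.sign_of_pos ha, Real.sign_of_pos (mul_pos ha hb)]

lemma sign_sq_of_ne_zero {a : ℝ} (ha : a ≠ 0) : Real.sign a ^ 2 = 1 := by
  rcases Real.sign_apply_eq_of_ne_zero a ha with h | h <;> simp [h]

/-- A unit vector is close to another one, up to sign, if the modulus of their inner product is
close to `1`. -/
lemma norm_sub_lt_or_norm_add_lt {E : Type*} [NormedAddCommGroup E] [InnerProductSpace ℝ E]
    {u v : E} (hu : ‖u‖ = 1) (hv : ‖v‖ = 1) {δ : ℝ} (hδ : 0 < δ)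
    (h : 1 - δ ^ 2 / 2 < |inner ℝ v u|) : ‖u - v‖ < δ ∨ ‖u + v‖ < δ := by
  rw [real_inner_comm] at h
  rcases lt_abs.1 h with h | h
  · refine Or.inl (lt_of_pow_lt_pow_left₀ 2 hδ.le ?_)
    rw [norm_sub_sq_real, hu, hv]
    linarith
  · refine Or.inr (lt_of_pow_lt_pow_left₀ 2 hδ.le ?_)
    rw [norm_add_sq_real, hu, hv]
    linarith

/-- An eigenvector whose components vanish in the limit, except for one, converges up to sign to
the corresponding frame vector. -/
lemma IsPerturbedEVD.tendsto_abs_entry {ι : Type*} {l : Filter ι} {ε : ι → ℝ} {α τ : ℝ}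
    {t : Fin n → ℝ} {M O : ι → Fin (n + 1) → Fin (n + 1) → ℝ} {lam : ι → Fin (n + 1) → ℝ}
    (h : IsPerturbedEVD l ε α τ t M O lam) {k j : Fin (n + 1)}
    (hj : ∀ i, i ≠ j → Tendsto (fun x => O x k i) l (𝓝 0)) :
    Tendsto (fun x => |O x k j|) l (𝓝 1) := by
  have h1 : Tendsto (fun x => ∑ i ∈ {j}ᶜ, O x k i ^ 2) l (𝓝 0) := by
    have := tendsto_finsetSum (s := ({j}ᶜ : Finset (Fin (n + 1))))
      (f := fun i x => O x k i ^ 2) (a := fun _ => 0) (x := l) fun i hi => by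
        simpa using (hj i (by simpa using hi)).pow 2
    simpa using this
  have h2 := (h1.const_sub 1).sqrt
  simp only [sub_zero, Real.sqrt_one] at h2
  refine h2.congr fun x => ?_
  rw [← h.row x k, Fintype.sum_eq_add_sum_compl j, add_sub_cancel_right, Real.sqrt_sq_eq_abs]

variable {S : Set (EuclideanSpace ℝ (Fin (n + 1)))} {p : EuclideanSpace ℝ (Fin (n + 1))}

lemma antitone_tangentCoeff (hκ : Monotone fun μ => meanCurvature κ * κ μ) :
    Antitone (tangentCoeff κ) := by
  intro i j hij
  have h1 : meanCurvature κ * κ i ≤ meanCurvature κ * κ j := hκ hij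
  rw [meanCurvature] at h1
  unfold tangentCoeff
  gcongr ?_ / _
  linarith

lemma tangentCoeff_ne (hH : meanCurvature κ ≠ 0) {i j : Fin n} (hij : κ i ≠ κ j) :
    tangentCoeff κ i ≠ tangentCoeff κ j := by
  intro he
  unfold tangentCoeff at he
  have h2 : 8 * (((n : ℝ) + 2) * (n + 4)) ≠ 0 := by positivity
  rw [div_left_inj' h2] at he
  exact hij (mul_left_cancel₀ hH (by rw [meanCurvature]; linarith))

/-- A smooth hypersurface with a principal frame at `p` is a graph over its tangent space, with the
second order expansion given by the principal curvatures. -/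
lemma exists_isPrincipalGraph (hS : IsSmoothHypersurface S) (hp : p ∈ S)
    {U : Set (EuclideanSpace ℝ (Fin (n + 1)))} (hpU : p ∈ U)
    {N : EuclideanSpace ℝ (Fin (n + 1)) → EuclideanSpace ℝ (Fin (n + 1))}
    (hN : IsUnitNormalField S U N) {d : Fin n → EuclideanSpace ℝ (Fin (n + 1))}
    (hd : IsPrincipalFrame S N p κ d) :
    ∃ w : OrthonormalBasis (Fin (n + 1)) ℝ (EuclideanSpace ℝ (Fin (n + 1))),
      (∀ i, w i.castSucc = d i) ∧ w (Fin.last n) = N p ∧ ∃ g K, IsPrincipalGraph S p κ w g K := by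
  have horth : Orthonormal ℝ (Fin.snoc (α := fun _ => EuclideanSpace ℝ (Fin (n + 1))) d (N p)) := by
    have hdN : ∀ i, inner ℝ (N p) (d i) = 0 := fun i => hN.normal p ⟨hp, hpU⟩ _ (hd.tangent i)
    constructor
    · intro i
      induction i using Fin.lastCases with
      | last => simpa using hN.norm_eq_one p ⟨hp, hpU⟩
      | cast i => simpa using hd.orthonormal.1 i
    · intro i j hij
      induction i using Fin.lastCases with
      | last =>
        induction j using Fin.lastCases with
        | last => exact absurd rfl hij
        | cast j => simpa using hdN j
      | cast i =>
        induction j using Fin.lastCases with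
        | last => simpa [real_inner_comm] using hdN i
        | cast j => simpa using hd.orthonormal.2 (fun h => hij (by rw [h]))
  have hspan := horth.linearIndependent.span_eq_top_of_card_eq_finrank' (by simp)
  set w := OrthonormalBasis.mk horth hspan.ge with hw
  have hwd : ∀ i, w i.castSucc = d i := fun i => by simp [hw]
  have hwN : w (Fin.last n) = N p := by simp [hw]
  obtain ⟨g, hg, hg0, hg', hSg⟩ :=
    hS.exists_graph w hp fun i => (hwd i).symm ▸ hd.tangent i
  obtain ⟨K, hK⟩ := exists_isGraphExpansion hg hg0 hg' (fderiv_fderiv_eq_of_principal w hpU hN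
    hwN.symm (fun i => by rw [hwd]; exact hd.shape_eq i) hg hg0 hg' hSg)
  obtain ⟨ε₀, hε₀, hpatch⟩ := exists_patch_eq_image w hSg
  refine ⟨w, hwd, hwN, g, K, hg, hK, ?_⟩
  filter_upwards [Ioo_mem_nhdsGT hε₀] with ε hε
  exact hpatch ε hε.1 hε.2

variable [NeZero n] {g : EuclideanSpace ℝ (Fin n) → ℝ} {K : ℝ}
  {w : OrthonormalBasis (Fin (n + 1)) ℝ (EuclideanSpace ℝ (Fin (n + 1)))}

namespace IsPrincipalGraph

variable (h : IsPrincipalGraph S p κ w g K)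
include h

lemma mass_remainder_isBigO :
    (fun x : PatchEVD S p => (mass (patchMeasure S p x.radius) / ballVolume n x.radius -
      (1 + massCoeff κ * x.radius ^ 2)) / x.radius ^ 2) =O[smallRadius S p] PatchEVD.radius := by
  have := isBigO_div_radius_pow (S := S) (p := p) (k := 2) (m := 1)
    (h.mass_isBigO.comp_tendsto tendsto_radius)
  simpa using this

lemma last_remainder_isBigO :
    (fun x : PatchEVD S p => (x.lam (Fin.last n) / ballVolume n x.radius -
      (heightSqCoeff κ - heightCoeff κ ^ 2) * x.radius ^ 4) / x.radius ^ 4)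
      =O[smallRadius S p] PatchEVD.radius := by
  have := isBigO_div_radius_pow (k := 4) (m := 1) h.isPerturbedEVD.last_isBigO
  simpa using this

lemma tangent_remainder_isBigO (ht : Antitone (tangentCoeff κ)) (μ : Fin n) :
    (fun x : PatchEVD S p => (x.lam μ.castSucc / ballVolume n x.radius -
      (1 / ((n : ℝ) + 2) * x.radius ^ 2 + tangentCoeff κ μ * x.radius ^ 4)) / x.radius ^ 4)
      =O[smallRadius S p] PatchEVD.radius := by
  have := isBigO_div_radius_pow (k := 4) (m := 1) (h.isPerturbedEVD.tangent_isBigO ht μ)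
  simpa using this

lemma patchScalar_isBigO :
    (fun x : PatchEVD S p => scalarCurvature κ - patchScalar S p x.radius x.lam)
      =O[smallRadius S p] PatchEVD.radius := by
  refine ((h.mass_remainder_isBigO.const_mul_left (8 * ((n : ℝ) + 1) * (n + 2) / n)).sub
    (h.last_remainder_isBigO.const_mul_left (2 * ((n : ℝ) + 2) ^ 2 * (n + 4) / n))).congr'
    ?_ EventuallyEq.rfl
  filter_upwards [eventually_radius_pos] with x hx
  have hB : ballVolume n x.radius ≠ 0 := (ballVolume_pos hx).ne'
  have hn : (n : ℝ) ≠ 0 := NeZero.ne _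
  have h2 : (n : ℝ) + 2 ≠ 0 := by positivity
  have h4 : (n : ℝ) + 4 ≠ 0 := by positivity
  rw [scalarCurvature_eq, patchScalar, scalarDescriptor, massCoeff, heightSqCoeff, heightCoeff]
  field_simp
  ring

lemma meanRadicand_isBigO :
    (fun x : PatchEVD S p => meanCurvature κ ^ 2 - meanRadicand n x.radius
      (mass (patchMeasure S p x.radius)) (x.lam (Fin.last n)))
      =O[smallRadius S p] PatchEVD.radius := by
  refine ((h.mass_remainder_isBigO.const_mul_left (8 * ((n : ℝ) + 2) ^ 2 / n)).sub
    (h.last_remainder_isBigO.const_mul_left (4 * ((n : ℝ) + 2) ^ 2 * (n + 4) / n))).congr'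
    ?_ EventuallyEq.rfl
  filter_upwards [eventually_radius_pos] with x hx
  have hB : ballVolume n x.radius ≠ 0 := (ballVolume_pos hx).ne'
  have hn : (n : ℝ) ≠ 0 := NeZero.ne _
  have h2 : (n : ℝ) + 2 ≠ 0 := by positivity
  have h4 : (n : ℝ) + 4 ≠ 0 := by positivity
  rw [meanCurvature, meanRadicand, massCoeff, heightSqCoeff, heightCoeff]
  field_simp
  ring

/-- The component of the barycenter along the last eigenvector comes, to leading order, from its
height along the normal. -/
lemma inner_last_barycenter_isBigO :
    (fun x : PatchEVD S p =>
      inner ℝ (x.e (Fin.last n)) (barycenter (patchMeasure S p x.radius) - p) -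
      inner ℝ (w (Fin.last n)) (x.e (Fin.last n)) * (heightCoeff κ * x.radius ^ 2))
      =O[smallRadius S p] fun x => x.radius ^ 3 := by
  have hE := h.isPerturbedEVD
  have h1 : (fun x : PatchEVD S p => ∑ i : Fin n,
      inner ℝ (w i.castSucc) (x.e (Fin.last n)) *
        inner ℝ (w i.castSucc) (barycenter (patchMeasure S p x.radius) - p))
      =O[smallRadius S p] fun x => x.radius ^ 3 := by
    refine IsBigO.fun_sum fun i _ => ?_
    simpa using (hE.entry_isBigO_one (Fin.last n) i.castSucc).mul
      ((h.barycenter_tangent_isBigO i).comp_tendsto tendsto_radius)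
  have h2 : (fun x : PatchEVD S p => inner ℝ (w (Fin.last n)) (x.e (Fin.last n)) *
      (inner ℝ (w (Fin.last n)) (barycenter (patchMeasure S p x.radius) - p) -
        heightCoeff κ * x.radius ^ 2)) =O[smallRadius S p] fun x => x.radius ^ 3 := by
    simpa using (hE.entry_isBigO_one (Fin.last n) (Fin.last n)).mul
      (h.barycenter_normal_isBigO.comp_tendsto tendsto_radius)
  refine (h1.add h2).congr_left fun x => ?_
  rw [← w.sum_inner_mul_inner (x.e (Fin.last n)), Fin.sum_univ_castSucc]
  simp only [real_inner_comm (x.e (Fin.last n))]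
  rw [real_inner_comm (w (Fin.last n)) (x.e (Fin.last n))]
  ring

/-- The barycenter lies on the side of the tangent space to which the hypersurface is curved on
average, so that the orientation sign is the sign of the mean curvature with respect to the normal
oriented by the last eigenvector. -/
lemma eventually_orientationSign_eq (hH : meanCurvature κ ≠ 0) :
    ∀ᶠ x in smallRadius S p, orientationSign S p x.radius x.e ≠ 0 ∧
      orientationSign S p x.radius x.e =
        Real.sign (meanCurvature κ * inner ℝ (x.e (Fin.last n)) (w (Fin.last n))) := by
  have hn2 : (0 : ℝ) < 2 * (n + 2) := by positivity
  have hc : 0 < |heightCoeff κ| := abs_pos.2 (div_ne_zero hH hn2.ne')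
  obtain ⟨C, hC⟩ := h.inner_last_barycenter_isBigO.bound
  have hsmall : Tendsto (fun x : PatchEVD S p => C * x.radius) (smallRadius S p) (𝓝 0) := by
    simpa using (tendsto_radius.mono_right nhdsWithin_le_nhds).const_mul C
  filter_upwards [hC, eventually_radius_pos, h.isPerturbedEVD.eventually_half_le_abs_last,
    hsmall.eventually (gt_mem_nhds (half_pos hc))] with x hx hpos hhalf hs
  have hpos2 : 0 < x.radius ^ 2 := pow_pos hpos 2
  set o : ℝ := inner ℝ (w (Fin.last n)) (x.e (Fin.last n)) with ho
  have ho0 : o ≠ 0 := abs_pos.1 (lt_of_lt_of_le (by norm_num) hhalf)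
  have hlt : |inner ℝ (x.e (Fin.last n)) (barycenter (patchMeasure S p x.radius) - p) -
      o * (heightCoeff κ * x.radius ^ 2)| < |o * (heightCoeff κ * x.radius ^ 2)| := by
    rw [Real.norm_eq_abs, Real.norm_of_nonneg (pow_nonneg hpos.le 3)] at hx
    rw [abs_mul o, abs_mul, abs_of_pos hpos2]
    calc _ ≤ C * x.radius ^ 3 := hx
      _ = C * x.radius * x.radius ^ 2 := by ring
      _ < |heightCoeff κ| / 2 * x.radius ^ 2 := by gcongr
      _ = 1 / 2 * (|heightCoeff κ| * x.radius ^ 2) := by ring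
      _ ≤ _ := by gcongr
  have hsign : orientationSign S p x.radius x.e = Real.sign (meanCurvature κ * o) := by
    rw [orientationSign, sign_eq_sign_of_abs_sub_lt hlt,
      ← sign_mul_of_pos_right (meanCurvature κ * o) (div_pos hpos2 hn2), heightCoeff, meanCurvature]
    congr 1
    ring
  rw [real_inner_comm]
  exact ⟨hsign ▸ Real.sign_eq_zero_iff.not.2 (mul_ne_zero hH ho0), hsign⟩

/-- If the mean curvature does not vanish, the square of its descriptor is the radicand. -/
lemma eventually_patchMean_sq (hH : meanCurvature κ ≠ 0) :
    ∀ᶠ x in smallRadius S p, 0 < meanRadicand n x.radius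
        (mass (patchMeasure S p x.radius)) (x.lam (Fin.last n)) ∧
      patchMean S p x.radius x.lam x.e ^ 2 = meanRadicand n x.radius
        (mass (patchMeasure S p x.radius)) (x.lam (Fin.last n)) := by
  have ht := tendsto_of_isBigO_radius (h.meanRadicand_isBigO.neg_left.congr_left
    fun x => neg_sub _ _)
  filter_upwards [h.eventually_orientationSign_eq hH,
    ht.eventually (lt_mem_nhds (sq_pos_of_ne_zero hH))] with x hx hpos
  refine ⟨hpos, ?_⟩
  rw [patchMean, meanDescriptor, mul_pow, Real.sq_sqrt hpos.le, orientationSign,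
    sign_sq_of_ne_zero (fun h0 => hx.1 (by rw [orientationSign, h0, Real.sign_zero])), one_mul]

/-- If the mean curvature vanishes, the radicand may be negative and the sign may be `0`; then the
square of the descriptor is still at most the modulus of the radicand. -/
lemma patchMean_sq_isBigO :
    (fun x : PatchEVD S p => meanCurvature κ ^ 2 - patchMean S p x.radius x.lam x.e ^ 2)
      =O[smallRadius S p] PatchEVD.radius := by
  by_cases hH : meanCurvature κ = 0
  · refine IsBigO.trans (IsBigO.of_bound 1 (Eventually.of_forall fun x => ?_))
      h.meanRadicand_isBigO
    rw [hH, zero_pow two_ne_zero, zero_sub, zero_sub, norm_neg, norm_neg, one_mul, patchMean,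
      meanDescriptor, mul_pow, norm_mul, Real.norm_eq_abs, Real.norm_eq_abs]
    have h1 : |orientationSign S p x.radius x.e ^ 2| ≤ 1 := by
      rcases Real.sign_apply_eq (inner ℝ (x.e (Fin.last n))
        (barycenter (patchMeasure S p x.radius) - p)) with h | h | h <;>
        simp [orientationSign, h]
    refine (mul_le_mul_of_nonneg_right h1 (abs_nonneg _)).trans ?_
    rw [one_mul, abs_of_nonneg (sq_nonneg _)]
    rcases le_total 0 (meanRadicand n x.radius (mass (patchMeasure S p x.radius))
      (x.lam (Fin.last n))) with h0 | h0
    · rw [Real.sq_sqrt h0]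
      exact le_abs_self _
    · rw [Real.sqrt_eq_zero_of_nonpos h0, zero_pow two_ne_zero]
      exact abs_nonneg _
  · refine h.meanRadicand_isBigO.congr' ?_ EventuallyEq.rfl
    filter_upwards [h.eventually_patchMean_sq hH] with x hx
    rw [hx.2]

/-- The product of the descriptors of a principal curvature and of the mean curvature. -/
lemma patchPrincipal_mul_patchMean_isBigO (hH : meanCurvature κ ≠ 0)
    (ht : Antitone (tangentCoeff κ)) (μ : Fin n) :
    (fun x : PatchEVD S p =>
      patchPrincipal S p x.radius x.lam x.e μ * patchMean S p x.radius x.lam x.e -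
        meanCurvature κ * κ μ) =O[smallRadius S p] PatchEVD.radius := by
  refine ((h.mass_remainder_isBigO.const_mul_left (2 * ((n : ℝ) + 2))).sub
    ((h.tangent_remainder_isBigO ht μ).const_mul_left (2 * ((n : ℝ) + 2) * (n + 4)))).congr'
    ?_ EventuallyEq.rfl
  filter_upwards [eventually_radius_pos, h.eventually_patchMean_sq hH] with x hx hQ
  have hm : patchMean S p x.radius x.lam x.e ≠ 0 := fun h0 => by
    rw [h0, zero_pow two_ne_zero] at hQ
    exact hQ.1.ne hQ.2
  have hB : ballVolume n x.radius ≠ 0 := (ballVolume_pos hx).ne'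
  have hn : (n : ℝ) ≠ 0 := NeZero.ne _
  have h2 : (n : ℝ) + 2 ≠ 0 := by positivity
  have h4 : (n : ℝ) + 4 ≠ 0 := by positivity
  rw [patchPrincipal, principalDescriptor, massCoeff, tangentCoeff, meanCurvature]
  field_simp
  ring

lemma patchPrincipal_sq_isBigO (hH : meanCurvature κ ≠ 0)
    (ht : Antitone (tangentCoeff κ)) (μ : Fin n) :
    (fun x : PatchEVD S p => κ μ ^ 2 - patchPrincipal S p x.radius x.lam x.e μ ^ 2)
      =O[smallRadius S p] PatchEVD.radius := by
  have h1 := h.patchPrincipal_mul_patchMean_isBigO hH ht μ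
  have hb : (fun x : PatchEVD S p =>
      patchPrincipal S p x.radius x.lam x.e μ * patchMean S p x.radius x.lam x.e +
        meanCurvature κ * κ μ) =O[smallRadius S p] fun _ => (1 : ℝ) :=
    ((tendsto_of_isBigO_radius h1).add_const _).isBigO_one ℝ
  have h2 := h1.mul hb
  simp only [mul_one] at h2
  have hinv : (fun x : PatchEVD S p => (patchMean S p x.radius x.lam x.e ^ 2)⁻¹)
      =O[smallRadius S p] fun _ => (1 : ℝ) :=
    ((tendsto_of_isBigO_radius (h.patchMean_sq_isBigO.neg_left.congr_left
      fun x => neg_sub _ _)).inv₀ (pow_ne_zero 2 hH)).isBigO_one ℝ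
  -- `κ² - k² = ((H² κ² - h² k²) - κ² (H² - h²)) / h²` for the descriptors `k` and `h`
  have h3 := ((h.patchMean_sq_isBigO.const_mul_left (κ μ ^ 2)).add h2).neg_left.mul hinv
  simp only [mul_one] at h3
  refine h3.congr' ?_ EventuallyEq.rfl
  filter_upwards [h.eventually_patchMean_sq hH] with x hQ
  have hm : patchMean S p x.radius x.lam x.e ≠ 0 := fun h0 => by
    rw [h0, zero_pow two_ne_zero] at hQ
    exact hQ.1.ne hQ.2
  field_simp
  ring

lemma eventually_norm_lt_of_tendsto {k j : Fin (n + 1)}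
    (hj : ∀ i, i ≠ j → Tendsto (fun x : PatchEVD S p => (inner ℝ (w i) (x.e k) : ℝ))
      (smallRadius S p) (𝓝 0)) {δ : ℝ} (hδ : 0 < δ) :
    ∀ᶠ x in smallRadius S p, ‖x.e k - w j‖ < δ ∨ ‖x.e k + w j‖ < δ := by
  have ht := h.isPerturbedEVD.tendsto_abs_entry hj
  have hlt : 1 - δ ^ 2 / 2 < 1 := by
    have : 0 < δ ^ 2 := pow_pos hδ 2
    linarith
  filter_upwards [ht.eventually (lt_mem_nhds hlt)] with x hx
  exact norm_sub_lt_or_norm_add_lt (x.e.orthonormal.norm_eq_one k) (w.orthonormal.norm_eq_one j)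
    hδ hx

lemma eventually_norm_last_lt {δ : ℝ} (hδ : 0 < δ) :
    ∀ᶠ x in smallRadius S p, ‖x.e (Fin.last n) - w (Fin.last n)‖ < δ ∨
      ‖x.e (Fin.last n) + w (Fin.last n)‖ < δ := by
  refine h.eventually_norm_lt_of_tendsto (fun i hi => ?_) hδ
  induction i using Fin.lastCases with
  | last => exact absurd rfl hi
  | cast i =>
    exact h.isPerturbedEVD.tendsto_of_isBigO_pow two_ne_zero
      (h.isPerturbedEVD.last_tangent_isBigO i)

lemma eventually_norm_tangent_lt (ht : Antitone (tangentCoeff κ)) {μ : Fin n}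
    (hμ : ∀ ν, ν ≠ μ → tangentCoeff κ ν ≠ tangentCoeff κ μ) {δ : ℝ} (hδ : 0 < δ) :
    ∀ᶠ x in smallRadius S p, ‖x.e μ.castSucc - w μ.castSucc‖ < δ ∨
      ‖x.e μ.castSucc + w μ.castSucc‖ < δ := by
  refine h.eventually_norm_lt_of_tendsto (fun i hi => ?_) hδ
  induction i using Fin.lastCases with
  | last =>
    exact h.isPerturbedEVD.tendsto_of_isBigO_pow two_ne_zero
      (h.isPerturbedEVD.tangent_last_isBigO μ)
  | cast i =>
    exact h.isPerturbedEVD.tendsto_entry_of_ne ht (hμ i fun hiμ => hi (by rw [hiμ])).symm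

end IsPrincipalGraph

end Descriptors

end PatchInvariants

theorem mainTheorem7 (n : ℕ) (hn : 1 ≤ n)
    (S : Set (EuclideanSpace ℝ (Fin (n + 1)))) (hS : PatchInvariants.IsSmoothHypersurface S)
    (p : EuclideanSpace ℝ (Fin (n + 1))) (hp : p ∈ S)
    (U : Set (EuclideanSpace ℝ (Fin (n + 1)))) (hpU : p ∈ U)
    (N : EuclideanSpace ℝ (Fin (n + 1)) → EuclideanSpace ℝ (Fin (n + 1)))
    (hN : PatchInvariants.IsUnitNormalField S U N)
    (κ : Fin n → ℝ) (d : Fin n → EuclideanSpace ℝ (Fin (n + 1)))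
    (hd : PatchInvariants.IsPrincipalFrame S N p κ d) :
    -- the patch has positive finite area; errors of the descriptors of `R` and `H ^ 2`
    (∃ K : ℝ, ∃ ε₀ > 0, ∀ ε : ℝ, 0 < ε → ε < ε₀ →
      PatchInvariants.patchMeasure S p ε Set.univ ≠ 0 ∧
      PatchInvariants.patchMeasure S p ε Set.univ ≠ ⊤ ∧
      ∀ (lam : Fin (n + 1) → ℝ)
        (e : OrthonormalBasis (Fin (n + 1)) ℝ (EuclideanSpace ℝ (Fin (n + 1)))),
        PatchInvariants.IsEVD
          (PatchInvariants.covarianceMatrix (PatchInvariants.patchMeasure S p ε)) lam e →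
        |PatchInvariants.scalarCurvature κ - PatchInvariants.patchScalar S p ε lam| ≤ K * ε ∧
        |PatchInvariants.meanCurvature κ ^ 2 -
          PatchInvariants.meanRadicand n ε
            (PatchInvariants.mass (PatchInvariants.patchMeasure S p ε)) (lam (Fin.last n))|
              ≤ K * ε ∧
        |PatchInvariants.meanCurvature κ ^ 2 - PatchInvariants.patchMean S p ε lam e ^ 2|
              ≤ K * ε) ∧
    -- the last eigenvector converges, up to sign, to the normal
    (∀ δ > 0, ∃ ε₀ > 0, ∀ ε : ℝ, 0 < ε → ε < ε₀ →
      ∀ (lam : Fin (n + 1) → ℝ)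
        (e : OrthonormalBasis (Fin (n + 1)) ℝ (EuclideanSpace ℝ (Fin (n + 1)))),
        PatchInvariants.IsEVD
          (PatchInvariants.covarianceMatrix (PatchInvariants.patchMeasure S p ε)) lam e →
        ‖e (Fin.last n) - N p‖ < δ ∨ ‖e (Fin.last n) + N p‖ < δ) ∧
    -- when `H ≠ 0`, with `H κ₁ ≤ … ≤ H κₙ`: orientation sign, principal curvatures, directions
    (PatchInvariants.meanCurvature κ ≠ 0 →
      Monotone (fun μ => PatchInvariants.meanCurvature κ * κ μ) →
      (∃ K : ℝ, ∃ ε₀ > 0, ∀ ε : ℝ, 0 < ε → ε < ε₀ →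
        ∀ (lam : Fin (n + 1) → ℝ)
          (e : OrthonormalBasis (Fin (n + 1)) ℝ (EuclideanSpace ℝ (Fin (n + 1)))),
          PatchInvariants.IsEVD
            (PatchInvariants.covarianceMatrix (PatchInvariants.patchMeasure S p ε)) lam e →
          PatchInvariants.orientationSign S p ε e ≠ 0 ∧
          PatchInvariants.orientationSign S p ε e =
            Real.sign (PatchInvariants.meanCurvature κ * inner ℝ (e (Fin.last n)) (N p)) ∧
          PatchInvariants.patchMean S p ε lam e ≠ 0 ∧
          ∀ μ : Fin n,
            |κ μ ^ 2 - PatchInvariants.patchPrincipal S p ε lam e μ ^ 2| ≤ K * ε) ∧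
      (∀ μ : Fin n, (∀ ν : Fin n, ν ≠ μ → κ ν ≠ κ μ) →
        ∀ δ > 0, ∃ ε₀ > 0, ∀ ε : ℝ, 0 < ε → ε < ε₀ →
          ∀ (lam : Fin (n + 1) → ℝ)
            (e : OrthonormalBasis (Fin (n + 1)) ℝ (EuclideanSpace ℝ (Fin (n + 1)))),
            PatchInvariants.IsEVD
              (PatchInvariants.covarianceMatrix (PatchInvariants.patchMeasure S p ε)) lam e →
            ‖e μ.castSucc - d μ‖ < δ ∨ ‖e μ.castSucc + d μ‖ < δ)) := by
  have : NeZero n := ⟨by omega⟩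
  obtain ⟨w, hwd, hwN, g, K, h⟩ :=
    PatchInvariants.exists_isPrincipalGraph hS hp hpU hN hd
  refine ⟨?_, ?_, ?_⟩
  · obtain ⟨C₁, h₁⟩ := PatchInvariants.exists_bound_of_isBigO_radius h.patchScalar_isBigO
    obtain ⟨C₂, h₂⟩ := PatchInvariants.exists_bound_of_isBigO_radius h.meanRadicand_isBigO
    obtain ⟨C₃, h₃⟩ := PatchInvariants.exists_bound_of_isBigO_radius h.patchMean_sq_isBigO
    obtain ⟨ε₁, hε₁, hE⟩ := PatchInvariants.eventually_smallRadius_iff.1 (h₁.and (h₂.and h₃))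
    obtain ⟨ε₂, hε₂, hM⟩ := mem_nhdsGT_iff_exists_Ioo_subset.1 h.eventually_measure_ne
    refine ⟨max C₁ (max C₂ C₃), min ε₁ ε₂, lt_min hε₁ hε₂, fun ε hε hlt => ?_⟩
    obtain ⟨hm0, hm1⟩ := hM ⟨hε, hlt.trans_le (min_le_right _ _)⟩
    refine ⟨hm0, hm1, fun lam e he => ?_⟩
    obtain ⟨hR, hQ, hH⟩ := hE ⟨ε, lam, e, he⟩ hε (hlt.trans_le (min_le_left _ _))
    refine ⟨hR.trans ?_, hQ.trans ?_, hH.trans ?_⟩ <;>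
      exact mul_le_mul_of_nonneg_right (by simp) hε.le
  · intro δ hδ
    obtain ⟨ε₀, hε₀, hE⟩ :=
      PatchInvariants.eventually_smallRadius_iff.1 (h.eventually_norm_last_lt hδ)
    rw [← hwN]
    exact ⟨ε₀, hε₀, fun ε hε hlt lam e he => hE ⟨ε, lam, e, he⟩ hε hlt⟩
  · intro hH hmono
    have ht := PatchInvariants.antitone_tangentCoeff hmono
    refine ⟨?_, fun μ hμ δ hδ => ?_⟩
    · choose C hC using fun μ =>
        PatchInvariants.exists_bound_of_isBigO_radius (h.patchPrincipal_sq_isBigO hH ht μ)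
      obtain ⟨ε₀, hε₀, hE⟩ := PatchInvariants.eventually_smallRadius_iff.1
        ((h.eventually_orientationSign_eq hH).and ((h.eventually_patchMean_sq hH).and
          (Filter.eventually_all.2 hC)))
      refine ⟨∑ μ, |C μ|, ε₀, hε₀, fun ε hε hlt lam e he => ?_⟩
      obtain ⟨⟨hs0, hs⟩, ⟨hQ, hmean⟩, hκ⟩ := hE ⟨ε, lam, e, he⟩ hε hlt
      rw [hwN] at hs
      refine ⟨hs0, hs, fun h0 => ?_, fun μ => (hκ μ).trans ?_⟩
      · rw [h0, zero_pow two_ne_zero] at hmean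
        exact hQ.ne hmean
      · exact mul_le_mul_of_nonneg_right ((le_abs_self _).trans
          (Finset.single_le_sum (f := fun μ => |C μ|) (fun _ _ => abs_nonneg _)
            (Finset.mem_univ μ))) hε.le
    · obtain ⟨ε₀, hε₀, hE⟩ := PatchInvariants.eventually_smallRadius_iff.1
        (h.eventually_norm_tangent_lt ht
          (fun ν hν => PatchInvariants.tangentCoeff_ne hH (hμ ν hν)) hδ)
      rw [← hwd μ]
      exact ⟨ε₀, hε₀, fun ε hε hlt lam e he => hE ⟨ε, lam, e, he⟩ hε hlt⟩
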